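/- **Setting.** Let $\hbar,m_e,\omega_p,\omega_c,a_1,a_2,a_3>0$ and $0<\theta<\pi$. Let $v_{\rm ext}:\mathbb R^3\to\mathbb R$ be periodic with respect to the Bravais lattice $\mathbf R_{\mathbf n}=(na_1+ma_2\cos\theta,\;ma_2\sin\theta,\;la_3)$, $\mathbf n=(n,m,l)\in\mathbb Z^3$, and square integrable over the unit cell. On functions of $(x,y,z,u)\in\mathbb R^4$ consider $$\hat H_{\rm eff}=-\tfrac{\hbar^2}{2m_e}\nabla^2+i\hbar\Big(u\sqrt{\tfrac{\hbar\omega_p}{m_e}}-y\omega_c\Big)\partial_x+v_{\rm ext}(\mathbf r)+\tfrac{m_e}{2}\Big(u\sqrt{\tfrac{\hbar\omega_p}{m_e}}-y\omega_c\Big)^2-\tfrac{\hbar\omega_p}{2}\partial_u^2 .$$ Put $\tilde u=u\sqrt{\hbar\omega_p/m_e}$, $\tilde y=\omega_c y$, $m_p=m_e/\omega_p^2$, $m_c=m_e/\omega_c^2$, $M=\frac{m_p+m_c}2$, $\mu=\frac{m_pm_c}{M}$, $\Omega=\sqrt{2m_e/\mu}$, and $$w=\frac{m_p\tilde u+m_c\tilde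 y}{\sqrt2M},\qquad v=\frac{\tilde u-\tilde y}{\sqrt2}.$$ For real $\nu,m,n,l$ put $G^x_\nu=\frac{2\pi\nu}{a_1}$, $G^z_l=\frac{2\pi l}{a_3}$, $G_{m,n}=\frac{2\pi m}{a_2\sin\theta}-\frac{G^x_n\cos\theta}{\sin\theta}$, $G^w_{m,n}=\frac{G_{m,n}}{\sqrt2\omega_c}$, $G^v_{m,n}=\frac{m_pG_{m,n}}{\sqrt2M\omega_c}$, $A^{k_x}_\nu=\frac{\hbar(k_x+G^x_\nu)}{\sqrt2m_e}$ and $\alpha_{n,m}=-\sqrt{\frac{\mu\Omega}{2\hbar}}A^0_n-i\sqrt{\frac{\hbar}{2\mu\Omega}}G^v_{m,n}$. For $\mathbf n=(n,m,l)\in\mathbb Z^3$ put $\mathbf G^w_{\mathbf n}=(G^x_n,G^w_{m,n},G^z_l)$, and let $V_{\mathbf n}$ be the Fourier coefficient (mean over the unit cell) of $v_{\rm ext}(\mathbf r)e^{-i(G^x_nx+G_{m,n}y+G^z_lz)}$. Let $\phi_j$ ($j\ge0$) be the normalized Hermite functions of the oscillator of mass $\mu$ and frequency $\Omega$, $\mathcal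 E_j=\hbar\Omega(j+\frac12)$, $b=\sqrt{\frac{\mu\Omega}{2\hbar}}\,s+\sqrt{\frac{\hbar}{2\mu\Omega}}\,\partial_s$, $b^\dagger=\sqrt{\frac{\mu\Omega}{2\hbar}}\,s-\sqrt{\frac{\hbar}{2\mu\Omega}}\,\partial_s$, and $\hat D(\alpha)=\exp(\alpha b^\dagger-\alpha^*b)$, given on the $\phi_j$ by the exponential series. Let $\mathbf r_w=(x,w,z)$. Then: 1. *Polaritonic form.* $\Omega^2=2m_e/\mu=\omega_p^2+\omega_c^2$. The map $(x,y,z,u)\mapsto(x,w,z,v)$ is bijective, with $y=\frac{w}{\sqrt2\omega_c}-\frac{m_pv}{\sqrt2M\omega_c}$, and on $C^2$ functions it transforms $\hat H_{\rm eff}$ into $$-\tfrac{\hbar^2}{2m_e}\partial_z^2-\tfrac{\hbar^2}{2M}\partial_w^2+v_{\rm ext}(\mathbf r)-\tfrac{\hbar^2}{2\mu}\partial_v^2+\tfrac{\mu\Omega^2}{2}\Big(v+\tfrac{i\hbar}{\sqrt2m_e}\partial_x\Big)^2 .$$ $\hat H_{\rm eff}$ is invariant under $(\mathbf r,u)\mapsto\big(\mathbf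 r+\mathbf R_{\mathbf n},\,u+ma_2\sin\theta\,\omega_c\sqrt{m_e/(\hbar\omega_p)}\big)$, which in the new coordinates is the polaritonic translation $(x,w,z,v)\mapsto(x+na_1+ma_2\cos\theta,\;w+\sqrt2\,\omega_c\,ma_2\sin\theta,\;z+la_3,\;v)$. 2. *Reduction.* On $e^{i(\mathbf k+\mathbf G^w_{\mathbf n})\cdot\mathbf r_w}f(v)$, with $f\in C^2$, the Hamiltonian acts as $\frac{\hbar^2(k_z+G^z_l)^2}{2m_e}+\frac{\hbar^2(k_w+G^w_{m,n})^2}{2M}+v_{\rm ext}(\mathbf r)$ plus the shifted oscillator $-\frac{\hbar^2}{2\mu}\partial_v^2+\frac{\mu\Omega^2}2(v-A^{k_x}_n)^2$ on $f$. The functions $\phi_j(v-A)$ are eigenfunctions of the oscillator shifted by $A$, for every $A\in\mathbb R$, with eigenvalues $\mathcal E_j$, and the $\phi_j$ are orthonormal in $L^2(\mathbb R)$. 3. *Matrix elements.* The exponential series for $\hat D(\alpha)\phi_j$ converges pointwise and in $L^2(\mathbb R)$ for all $\alpha\in\mathbb C$. For all real $k_x$, all integers $n,n',m,m'$ and all $i,j\ge0$,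 $$\big\langle\phi_i(v-A^{k_x}_n)\big|e^{-iG^v_{m-m',n-n'}v}\big|\phi_j(v-A^{k_x}_{n'})\big\rangle=e^{-iG^v_{m-m',n-n'}A^{k_x}_{(n+n')/2}}\,\langle\phi_i|\hat D(\alpha_{n-n',m-m'})|\phi_j\rangle .$$ For all $\alpha\in\mathbb C$, $\langle\phi_i|\hat D(\alpha)|\phi_j\rangle=\sqrt{\frac{j!}{i!}}\,\alpha^{i-j}e^{-|\alpha|^2/2}L_j^{(i-j)}(|\alpha|^2)$ if $i\ge j$, with $L_j^{(i-j)}$ the associated Laguerre polynomial, and $\langle\phi_i|\hat D(\alpha)|\phi_j\rangle=(-1)^{j-i}\,\overline{\langle\phi_j|\hat D(\alpha)|\phi_i\rangle}$ if $i<j$. 4. *Central equation.* Let $\mathbf k=(k_x,k_w,k_z)\in\mathbb R^3$. Consider Bloch waves $\Psi_{\mathbf k}(\mathbf r_w,v)=e^{i\mathbf k\cdot\mathbf r_w}U^{\mathbf k}(\mathbf r_w,v)$, where $U^{\mathbf k}$ is (almost everywhere) invariant under the polaritonic translations and square integrable over (polaritonic unit cell)$\,\times\,\mathbb R_v$. Each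 such $U^{\mathbf k}$ has a unique expansion $$U^{\mathbf k}=\sum_{\mathbf n,j}U^{\mathbf k}_{\mathbf n,j}\,e^{i\mathbf G^w_{\mathbf n}\cdot\mathbf r_w}\,\phi_j(v-A^{k_x}_n),$$ convergent in $L^2$ of that set, and the coefficient families that occur are exactly the square summable ones. For every real $E$, $\Psi_{\mathbf k}$ satisfies $\hat H_{\rm eff}\Psi_{\mathbf k}=E\Psi_{\mathbf k}$ in the sense of distributions on the configuration space of $(x,y,z,u)$ (if $U^{\mathbf k}$ is $C^2$: pointwise almost everywhere) if and only if, for all $\mathbf n\in\mathbb Z^3$ and $i\ge0$, $$U^{\mathbf k}_{\mathbf n,i}\Big[\tfrac{\hbar^2(k_z+G^z_l)^2}{2m_e}+\tfrac{\hbar^2(k_w+G^w_{m,n})^2}{2M}+\mathcal E_i-E\Big]+\sum_{\mathbf n',j}V_{\mathbf n-\mathbf n'}U^{\mathbf k}_{\mathbf n',j}\,e^{-iG^v_{m-m',n-n'}A^{k_x}_{(n+n')/2}}\langle\phi_i|\hat D(\alpha_{n-n',m-m'})|\phi_j\rangle=0,$$ the series being absolutely convergent. In particular a Bloch wave of this kind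 that is not almost everywhere zero and solves the eigenproblem with energy $E$ exists if and only if the central equation has a nonzero square summable solution. -/

import Mathlib

open MeasureTheory Filter Topology
open scoped ContDiff ComplexConjugate

noncomputable section

namespace QEDBloch

/-- The physical parameters: `ℏ`, the electron mass, the diamagnetic (plasma) frequency of the
cavity mode, the cyclotron frequency, the three lattice constants and the angle `θ` between the
in-plane primitive vectors. -/
structure Params where
  hbar : ℝ
  me : ℝ
  ωp : ℝ
  ωc : ℝ
  a₁ : ℝ
  a₂ : ℝ
  a₃ : ℝ
  θ : ℝ
  hbar_pos : 0 < hbar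
  me_pos : 0 < me
  ωp_pos : 0 < ωp
  ωc_pos : 0 < ωc
  a₁_pos : 0 < a₁
  a₂_pos : 0 < a₂
  a₃_pos : 0 < a₃
  θ_pos : 0 < θ
  θ_lt_pi : θ < Real.pi

/-- Three-dimensional space: `r = (x, y, z)`, `r_w = (x, w, z)`, or `k = (k_x, k_w, k_z)`. -/
abbrev Space : Type := ℝ × ℝ × ℝ

/-- Configuration space of one electron and one photon coordinate, either with the original
coordinates `(x, y, z, u)` or with the polaritonic coordinates `(x, w, z, v)`. -/
abbrev Config : Type := ℝ × ℝ × ℝ × ℝ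

/-- Indices `n = (n, m, l)` of Bravais and reciprocal lattice vectors. -/
abbrev LatticeIndex : Type := ℤ × ℤ × ℤ

/-! ### Partial derivatives on configuration space -/

/-- Partial derivative in the first coordinate. -/
def partial1 (f : Config → ℂ) (p : Config) : ℂ :=
  deriv (fun t : ℝ => f (t, p.2.1, p.2.2.1, p.2.2.2)) p.1

/-- Partial derivative in the second coordinate. -/
def partial2 (f : Config → ℂ) (p : Config) : ℂ :=
  deriv (fun t : ℝ => f (p.1, t, p.2.2.1, p.2.2.2)) p.2.1

/-- Partial derivative in the third coordinate. -/
def partial3 (f : Config → ℂ) (p : Config) : ℂ :=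
  deriv (fun t : ℝ => f (p.1, p.2.1, t, p.2.2.2)) p.2.2.1

/-- Partial derivative in the fourth coordinate. -/
def partial4 (f : Config → ℂ) (p : Config) : ℂ :=
  deriv (fun t : ℝ => f (p.1, p.2.1, p.2.2.1, t)) p.2.2.2

namespace Params

variable (P : Params)

/-! ### Masses, frequencies and coordinates -/

/-- `m_p = m_e / ω_p²`. -/
def mp : ℝ := P.me / P.ωp ^ 2

/-- `m_c = m_e / ω_c²`. -/
def mc : ℝ := P.me / P.ωc ^ 2

/-- `M = (m_p + m_c) / 2`. -/
def M : ℝ := (P.mp + P.mc) / 2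

/-- `μ = m_p m_c / M`. -/
def μ : ℝ := P.mp * P.mc / P.M

/-- The dressed frequency `Ω`, with `Ω² = 2 m_e / μ`. -/
def Ω : ℝ := Real.sqrt (2 * P.me / P.μ)

/-- The oscillator energies `ℏ Ω (j + 1/2)`. -/
def energy (j : ℕ) : ℝ := P.hbar * P.Ω * ((j : ℝ) + 1 / 2)

/-- The scaled photon coordinate `ũ = u √(ℏ ω_p / m_e)`. -/
def uTilde (u : ℝ) : ℝ := u * Real.sqrt (P.hbar * P.ωp / P.me)

/-- The scaled electron coordinate `ỹ = ω_c y`. -/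
def yTilde (y : ℝ) : ℝ := P.ωc * y

/-- The change of coordinates `(x, y, z, u) ↦ (x, w, z, v)`, where
`w = (m_p ũ + m_c ỹ) / (√2 M)` and `v = (ũ - ỹ) / √2`. -/
def toPolaritonic (p : Config) : Config :=
  (p.1,
    (P.mp * P.uTilde p.2.2.2 + P.mc * P.yTilde p.2.1) / (Real.sqrt 2 * P.M),
    p.2.2.1,
    (P.uTilde p.2.2.2 - P.yTilde p.2.1) / Real.sqrt 2)

/-- The electron position `r = (x, y, z)` as a function of the polaritonic coordinates. -/
def positionOf (q : Config) : Space :=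
  (q.1,
    q.2.1 / (Real.sqrt 2 * P.ωc) - P.mp * q.2.2.2 / (Real.sqrt 2 * P.M * P.ωc),
    q.2.2.1)

/-! ### Hamiltonians -/

/-- The effective one-electron Hamiltonian, in the coordinates `(x, y, z, u)`:
`-ℏ²/(2mₑ) ∇² + iℏ (u √(ℏωₚ/mₑ) - y ω_c) ∂ₓ + v_ext(r) + (mₑ/2) (u √(ℏωₚ/mₑ) - y ω_c)²
  - (ℏωₚ/2) ∂ᵤ²`. -/
def Heff (vext : Space → ℝ) (f : Config → ℂ) (p : Config) : ℂ :=
  -((P.hbar ^ 2 / (2 * P.me) : ℝ) : ℂ) *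
      (partial1 (partial1 f) p + partial2 (partial2 f) p + partial3 (partial3 f) p)
    + Complex.I * (P.hbar : ℂ) *
      ((p.2.2.2 * Real.sqrt (P.hbar * P.ωp / P.me) - p.2.1 * P.ωc : ℝ) : ℂ) * partial1 f p
    + (vext (p.1, p.2.1, p.2.2.1) : ℂ) * f p
    + ((P.me / 2 * (p.2.2.2 * Real.sqrt (P.hbar * P.ωp / P.me) - p.2.1 * P.ωc) ^ 2 : ℝ) : ℂ)
      * f p
    - ((P.hbar * P.ωp / 2 : ℝ) : ℂ) * partial4 (partial4 f) p

/-- The first order operator `v + (iℏ / (√2 mₑ)) ∂ₓ`. -/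
def shiftOp (F : Config → ℂ) (q : Config) : ℂ :=
  (q.2.2.2 : ℂ) * F q
    + Complex.I * ((P.hbar / (Real.sqrt 2 * P.me) : ℝ) : ℂ) * partial1 F q

/-- The Hamiltonian in polaritonic coordinates `(x, w, z, v)`, in compact form:
`-ℏ²/(2mₑ) ∂_z² - ℏ²/(2M) ∂_w² + v_ext(r) - ℏ²/(2μ) ∂_v² + (μΩ²/2) (v + iℏ/(√2mₑ) ∂ₓ)²`. -/
def Hpol (vext : Space → ℝ) (F : Config → ℂ) (q : Config) : ℂ :=
  -((P.hbar ^ 2 / (2 * P.me) : ℝ) : ℂ) * partial3 (partial3 F) q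
    - ((P.hbar ^ 2 / (2 * P.M) : ℝ) : ℂ) * partial2 (partial2 F) q
    + (vext (P.positionOf q) : ℂ) * F q
    - ((P.hbar ^ 2 / (2 * P.μ) : ℝ) : ℂ) * partial4 (partial4 F) q
    + ((P.μ * P.Ω ^ 2 / 2 : ℝ) : ℂ) * P.shiftOp (P.shiftOp F) q

/-- The oscillator `-ℏ²/(2μ) d²/dv² + (μΩ²/2) (v - A)²`. -/
def shiftedOscillator (A : ℝ) (f : ℝ → ℂ) (v : ℝ) : ℂ :=
  -((P.hbar ^ 2 / (2 * P.μ) : ℝ) : ℂ) * deriv (deriv f) v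
    + ((P.μ * P.Ω ^ 2 / 2 * (v - A) ^ 2 : ℝ) : ℂ) * f v

/-! ### The lattice, its reciprocal lattice, and the periodic potential -/

/-- The vector `t₁ a₁ + t₂ a₂ + t₃ a₃`, for the primitive vectors `a₁ = (a₁, 0, 0)`,
`a₂ = (a₂ cos θ, a₂ sin θ, 0)` and `a₃ = (0, 0, a₃)`. -/
def latticeComb (t₁ t₂ t₃ : ℝ) : Space :=
  (t₁ * P.a₁ + t₂ * (P.a₂ * Real.cos P.θ), t₂ * (P.a₂ * Real.sin P.θ), t₃ * P.a₃)

/-- The Bravais lattice vectors. -/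
def bravais (n : LatticeIndex) : Space := P.latticeComb n.1 n.2.1 n.2.2

/-- The unit cell of the crystal. -/
def unitCell : Set Space :=
  {r | ∃ t₁ ∈ Set.Ico (0 : ℝ) 1, ∃ t₂ ∈ Set.Ico (0 : ℝ) 1, ∃ t₃ ∈ Set.Ico (0 : ℝ) 1,
    r = P.latticeComb t₁ t₂ t₃}

/-- `G^x_ν = 2πν / a₁`, for real `ν` (half-integers occur below). -/
def Gx (ν : ℝ) : ℝ := 2 * Real.pi * ν / P.a₁

/-- `G^y_m = 2πm / a₂`. -/
def Gy (m : ℝ) : ℝ := 2 * Real.pi * m / P.a₂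

/-- `G^z_l = 2πl / a₃`. -/
def Gz (l : ℝ) : ℝ := 2 * Real.pi * l / P.a₃

/-- `G_{m,n} = G^y_m / sin θ - G^x_n cos θ / sin θ`. -/
def Gmn (m n : ℝ) : ℝ :=
  P.Gy m / Real.sin P.θ - P.Gx n * Real.cos P.θ / Real.sin P.θ

/-- `G^w_{m,n} = G_{m,n} / (√2 ω_c)`. -/
def Gw (m n : ℝ) : ℝ := P.Gmn m n / (Real.sqrt 2 * P.ωc)

/-- `G^v_{m,n} = m_p G_{m,n} / (√2 M ω_c)`. -/
def Gv (m n : ℝ) : ℝ := P.mp * P.Gmn m n / (Real.sqrt 2 * P.M * P.ωc)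

/-- The potential has the periodicity of the crystal. -/
def IsLatticePeriodic (vext : Space → ℝ) : Prop :=
  ∀ (n : LatticeIndex) (r : Space), vext (r + P.bravais n) = vext r

/-- The Fourier coefficient `V_n` of the potential: the mean of `v_ext(r) exp(-i G_n · r)` over
the unit cell, with `G_n = (G^x_n, G_{m,n}, G^z_l)`. -/
def fourierCoeff (vext : Space → ℝ) (n : LatticeIndex) : ℂ :=
  ⨍ r in P.unitCell, (vext r : ℂ) *
    Complex.exp (-Complex.I *
      ((P.Gx n.1 * r.1 + P.Gmn n.2.1 n.1 * r.2.1 + P.Gz n.2.2 * r.2.2 : ℝ) : ℂ))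

/-! ### Generalized translations and Bloch waves -/

/-- The generalized translation of the electronic and the photonic coordinate,
`(r, u) ↦ (r + R_n, u + m a₂ sin θ ω_c √(mₑ / (ℏ ω_p)))`. -/
def translate (n : LatticeIndex) (p : Config) : Config :=
  (p.1 + (P.bravais n).1, p.2.1 + (P.bravais n).2.1, p.2.2.1 + (P.bravais n).2.2,
    p.2.2.2 + (P.bravais n).2.1 * P.ωc * Real.sqrt (P.me / (P.hbar * P.ωp)))

/-- The vector `t₁ a₁ + t₂ a₂ + t₃ a₃` of the polaritonic lattice in the coordinates
`(x, w, z)`: a length `y` of the crystal corresponds to the length `√2 ω_c y` along `w`. -/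
def polLatticeComb (t₁ t₂ t₃ : ℝ) : Space :=
  (t₁ * P.a₁ + t₂ * (P.a₂ * Real.cos P.θ),
    Real.sqrt 2 * P.ωc * (t₂ * (P.a₂ * Real.sin P.θ)), t₃ * P.a₃)

/-- The translation `(x, w, z, v) ↦ (x + n a₁ + m a₂ cos θ, w + √2 ω_c m a₂ sin θ, z + l a₃, v)`
in polaritonic coordinates. -/
def polTranslate (n : LatticeIndex) (q : Config) : Config :=
  (q.1 + (P.polLatticeComb n.1 n.2.1 n.2.2).1, q.2.1 + (P.polLatticeComb n.1 n.2.1 n.2.2).2.1,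
    q.2.2.1 + (P.polLatticeComb n.1 n.2.1 n.2.2).2.2, q.2.2.2)

/-- The polaritonic unit cell in `(x, w, z)`, times the whole `v`-axis. -/
def polCell : Set Config :=
  {q | ∃ t₁ ∈ Set.Ico (0 : ℝ) 1, ∃ t₂ ∈ Set.Ico (0 : ℝ) 1, ∃ t₃ ∈ Set.Ico (0 : ℝ) 1,
    (q.1, q.2.1, q.2.2.1) = P.polLatticeComb t₁ t₂ t₃}

/-- Admissible Bloch amplitudes `U(r_w, v)`: periodic under the polaritonic translations, and
square integrable over (polaritonic unit cell) × (`v`-axis). -/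
def IsBlochAmplitude (u : Config → ℂ) : Prop :=
  (∀ n : LatticeIndex, ∀ᵐ q : Config, u (P.polTranslate n q) = u q) ∧
    MemLp u 2 (volume.restrict P.polCell)

/-- The Bloch wave `Ψ(r_w, v) = exp(i k · r_w) U(r_w, v)`. -/
def blochWave (k : Space) (u : Config → ℂ) (q : Config) : ℂ :=
  Complex.exp (Complex.I * ((k.1 * q.1 + k.2.1 * q.2.1 + k.2.2 * q.2.2.1 : ℝ) : ℂ)) * u q

/-! ### Landau polaritons and the expansion -/

/-- The Hermite functions of the oscillator with mass `μ` and frequency `Ω`; with the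
physicists' Hermite polynomials `H_j(ξ) = 2^{j/2} He_j(√2 ξ)` this is
`φ_j(s) = (μΩ/(πℏ))^{1/4} (2^j j!)^{-1/2} H_j(ξ) exp(-ξ²/2)`, `ξ = √(μΩ/ℏ) s`. -/
def phi (j : ℕ) (s : ℝ) : ℂ :=
  (((P.μ * P.Ω / (Real.pi * P.hbar)) ^ (1 / 4 : ℝ) / Real.sqrt (j.factorial : ℝ)
    * Polynomial.aeval (Real.sqrt 2 * (Real.sqrt (P.μ * P.Ω / P.hbar) * s))
        (Polynomial.hermite j)
    * Real.exp (-(P.μ * P.Ω / P.hbar * s ^ 2) / 2) : ℝ) : ℂ)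

/-- The shift `A^{k_x}_ν = ℏ (k_x + G^x_ν) / (√2 mₑ)`, for real `ν`. -/
def A (kx ν : ℝ) : ℝ := P.hbar * (kx + P.Gx ν) / (Real.sqrt 2 * P.me)

/-- `exp(i G^w_n · r_w)` with `G^w_n = (G^x_n, G^w_{m,n}, G^z_l)`. -/
def planeWave (n : LatticeIndex) (q : Config) : ℂ :=
  Complex.exp (Complex.I *
    ((P.Gx n.1 * q.1 + P.Gw n.2.1 n.1 * q.2.1 + P.Gz n.2.2 * q.2.2.1 : ℝ) : ℂ))

/-- The amplitude `u` is the sum, in `L²` of (polaritonic unit cell) × (`v`-axis), of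
`U_{n,j} exp(i G^w_n · r_w) φ_j(v - A^{k_x}_n)` over all `n` and `j`. -/
def HasPolaritonExpansion (k : Space) (u : Config → ℂ) (U : LatticeIndex × ℕ → ℂ) : Prop :=
  Tendsto
    (fun S : Finset (LatticeIndex × ℕ) =>
      eLpNorm
        (fun q : Config =>
          u q - ∑ c ∈ S, U c * (P.planeWave c.1 q * P.phi c.2 (q.2.2.2 - P.A k.1 c.1.1)))
        2 (volume.restrict P.polCell))
    atTop (𝓝 0)

/-- `H_eff ψ = E ψ` in the sense of distributions on the original configuration space:
`⟨H_eff χ, ψ⟩ = E ⟨χ, ψ⟩` for all test functions `χ`. -/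
def IsWeakEigenfunction (vext : Space → ℝ) (E : ℝ) (ψ : Config → ℂ) : Prop :=
  ∀ χ : Config → ℂ, ContDiff ℝ ∞ χ → HasCompactSupport χ →
    ∫ p, conj (P.Heff vext χ p) * ψ p = (E : ℂ) * ∫ p, conj (χ p) * ψ p

/-! ### Displacement operators and the central equation -/

/-- The annihilation operator `b = √(μΩ/(2ℏ)) s + √(ℏ/(2μΩ)) d/ds`. -/
def lower (f : ℝ → ℂ) (s : ℝ) : ℂ :=
  ((Real.sqrt (P.μ * P.Ω / (2 * P.hbar)) * s : ℝ) : ℂ) * f s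
    + (Real.sqrt (P.hbar / (2 * P.μ * P.Ω)) : ℂ) * deriv f s

/-- The creation operator `b† = √(μΩ/(2ℏ)) s - √(ℏ/(2μΩ)) d/ds`. -/
def raise (f : ℝ → ℂ) (s : ℝ) : ℂ :=
  ((Real.sqrt (P.μ * P.Ω / (2 * P.hbar)) * s : ℝ) : ℂ) * f s
    - (Real.sqrt (P.hbar / (2 * P.μ * P.Ω)) : ℂ) * deriv f s

/-- The operator `α b† - α* b`. -/
def displacementGen (α : ℂ) (f : ℝ → ℂ) (s : ℝ) : ℂ :=
  α * P.raise f s - conj α * P.lower f s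

/-- The `k`-th term `(α b† - α* b)^k f / k!` of the exponential series. -/
def displacementTerm (α : ℂ) (f : ℝ → ℂ) (k : ℕ) (s : ℝ) : ℂ :=
  ((k.factorial : ℂ))⁻¹ * ((P.displacementGen α)^[k] f) s

/-- The displacement operator `D(α) = exp(α b† - α* b)`, given by the exponential series. It is
used on the Hermite functions only, which are analytic vectors: the series converges on them. -/
def displacement (α : ℂ) (f : ℝ → ℂ) (s : ℝ) : ℂ := ∑' k : ℕ, P.displacementTerm α f k s

/-- The inner product `⟨f | g⟩` of `L²(ℝ)`. -/
def _root_.QEDBloch.braket (f g : ℝ → ℂ) : ℂ := ∫ s : ℝ, conj (f s) * g s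

/-- The matrix element `⟨φ_i | D(α) | φ_j⟩`. -/
def displacementMatrix (α : ℂ) (i j : ℕ) : ℂ :=
  braket (P.phi i) (P.displacement α (P.phi j))

/-- `α_{n,m} = -√(μΩ/(2ℏ)) A^0_n - i √(ℏ/(2μΩ)) G^v_{m,n}`. -/
def alpha (n m : ℝ) : ℂ :=
  -((Real.sqrt (P.μ * P.Ω / (2 * P.hbar)) * P.A 0 n : ℝ) : ℂ)
    - Complex.I * ((Real.sqrt (P.hbar / (2 * P.μ * P.Ω)) * P.Gv m n : ℝ) : ℂ)

/-- The associated Laguerre polynomial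
`L_n^{(k)}(x) = ∑_{i ≤ n} (-1)^i (n + k choose n - i) x^i / i!`. -/
def _root_.QEDBloch.laguerre (n k : ℕ) (x : ℝ) : ℝ :=
  ∑ i ∈ Finset.range (n + 1),
    (-1) ^ i * ((n + k).choose (n - i) : ℝ) * x ^ i / (i.factorial : ℝ)

/-- The kinetic energy `ℏ²(k_z + G^z_l)²/(2mₑ) + ℏ²(k_w + G^w_{m,n})²/(2M)`. -/
def kinetic (k : Space) (n : LatticeIndex) : ℝ :=
  P.hbar ^ 2 * (k.2.2 + P.Gz n.2.2) ^ 2 / (2 * P.me)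
    + P.hbar ^ 2 * (k.2.1 + P.Gw n.2.1 n.1) ^ 2 / (2 * P.M)

/-- The term of index `(n', j)` in the potential part of row `(n, i)` of the central equation:
`V_{n-n'} U_{n',j} exp(-i G^v_{m-m',n-n'} A^{k_x}_{(n+n')/2}) ⟨φ_i | D(α_{n-n',m-m'}) | φ_j⟩`. -/
def couplingTerm (vext : Space → ℝ) (k : Space) (U : LatticeIndex × ℕ → ℂ)
    (n : LatticeIndex) (i : ℕ) (c : LatticeIndex × ℕ) : ℂ :=
  P.fourierCoeff vext (n - c.1) * U c *
    Complex.exp (-Complex.I *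
      ((P.Gv ((n.2.1 : ℝ) - c.1.2.1) ((n.1 : ℝ) - c.1.1)
        * P.A k.1 (((n.1 : ℝ) + c.1.1) / 2) : ℝ) : ℂ)) *
    P.displacementMatrix (P.alpha ((n.1 : ℝ) - c.1.1) ((n.2.1 : ℝ) - c.1.2.1)) i c.2

/-- The QED-Bloch central equation: for all `n` and `i`, the sum over all `(n', j)` of the
coupling terms converges and
`U_{n,i} [ℏ²(k_z + G^z_l)²/(2mₑ) + ℏ²(k_w + G^w_{m,n})²/(2M) + ℏΩ(i + 1/2) - E] + ∑ = 0`. -/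
def CentralEquation (vext : Space → ℝ) (k : Space) (E : ℝ) (U : LatticeIndex × ℕ → ℂ) : Prop :=
  ∀ (n : LatticeIndex) (i : ℕ),
    Summable (P.couplingTerm vext k U n i) ∧
      U (n, i) * ((P.kinetic k n + P.energy i - E : ℝ) : ℂ)
        + ∑' c : LatticeIndex × ℕ, P.couplingTerm vext k U n i c = 0

end Params

end QEDBloch

end

/-! Outside the potential, the Hamiltonian contains `u` and `y` only through `ũ - ỹ`. Since `m_p
ω_p² = m_c ω_c² = m_e`, the weights chosen in `w` cancel the mixed derivative `∂_w ∂_v`. What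
remains is free motion in `w` and `z`, and an oscillator in `v` whose centre is moved by the
momentum along `x`. On a plane wave `exp(i (k + G) · r_w)` this displacement is a number `A_n`, so
plane waves times shifted Hermite functions are eigenfunctions as long as the potential is absent
(`Hpol_modeWave`, `shiftedOscillator_phi`).

Hermite functions are treated as polynomials times a Gaussian, hence as entire functions. On them `α
b† - α* b` is an operator `i a s - c d/ds`, and its exponential series is the Taylor series,
evaluated at `t = 1`, of the entire curve `t ↦ exp(i (a t s - a c t² / 2)) f(s - c t)`. So `D(α)` is
a modulated translation, and Cauchy estimates on the circle of radius two give convergence in `L²`.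
Commuting the ladder operators with this translation gives recursions for the matrix elements; their
solution `weylSum` is a Laguerre polynomial up to elementary factors (`weylMatrix_eq`).

In lattice coordinates `t` the polaritonic cell becomes the unit cube, and the expansion functions
become `φ_j(v - A_n) exp(2πi n · t)` on the strip `ℝ × cube`, a Hilbert basis (`modeBasis`). The
potential becomes a function of `t - v σ`. The shear `t ↦ t - v σ` modulo integers preserves
measure, so the potential times a basis function is in `L²` with a norm that does not depend on the
basis function, and its matrix elements split into a Fourier coefficient and a matrix element in
`v`. Parseval then gives the series in the central equation (`hasSum_couplingTerm`).

The weak eigenvalue equation is an integral over all of configuration space; unfolding rewrites it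
as a strip integral against periodized test functions. If the central equation holds, the weak
equation follows because it is a combination of its rows, weighted by the coefficients of the test
function (`hasSum_rows`). The potential is an unbounded multiplication operator, so this needs those
coefficients to be absolutely summable (`summable_norm_modeCoeff`). Conversely, a row is the weak
equation tested with a basis function, made admissible by a partition of unity in `t` and a cutoff
in `v` that is removed by dominated convergence. For `C²` amplitudes, integration by parts and the
fundamental lemma of the calculus of variations turn the weak equation into the pointwise one. -/

namespace QEDBloch

/-! ### Polynomials times Gaussians, and Weyl translations. -/

open Polynomial in
/-- The entire function `p(z) exp(-c z²)`. -/
noncomputable def polyGauss (c : ℝ) (p : ℂ[X]) (z : ℂ) : ℂ := p.eval z * Complex.exp (-(c * z ^ 2))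

open Polynomial in
/-- The polynomial factor of the derivative of `p(z) exp(-c z²)`. -/
noncomputable def gaussDeriv (c : ℝ) (p : ℂ[X]) : ℂ[X] := derivative p - C (2 * (c : ℂ)) * X * p

theorem hasDerivAt_polyGauss (c : ℝ) (p : Polynomial ℂ) (z : ℂ) :
    HasDerivAt (polyGauss c p) (polyGauss c (gaussDeriv c p) z) z := by
  have h1 := p.hasDerivAt z
  have h2 : HasDerivAt (fun z : ℂ => Complex.exp (-(c * z ^ 2)))
      (Complex.exp (-(c * z ^ 2)) * (-(c * (2 * z)))) z := by
    have := ((((hasDerivAt_id z).pow 2).const_mul (c : ℂ)).neg).cexp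
    simpa using this
  refine (h1.mul h2).congr_deriv ?_
  simp [polyGauss, gaussDeriv]
  ring

theorem hasDerivAt_polyGauss_real (c : ℝ) (p : Polynomial ℂ) (s : ℝ) :
    HasDerivAt (fun s : ℝ => polyGauss c p s) (polyGauss c (gaussDeriv c p) s) s :=
  (hasDerivAt_polyGauss c p s).comp_ofReal

theorem continuous_polyGauss (c : ℝ) (p : Polynomial ℂ) : Continuous (polyGauss c p) := by
  unfold polyGauss
  fun_prop

theorem contDiff_polyGauss_real (c : ℝ) (p : Polynomial ℂ) :
    ContDiff ℝ ∞ (fun s : ℝ => polyGauss c p s) := by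
  unfold polyGauss
  have h1 : ContDiff ℝ ∞ (fun s : ℝ => (s : ℂ)) := Complex.ofRealCLM.contDiff
  have h2 : ContDiff ℝ ∞ (fun s : ℝ => p.eval (s : ℂ)) := by
    have : ContDiff ℂ ∞ (fun z : ℂ => p.eval z) := by
      simpa using p.contDiff_aeval (𝕜 := ℂ) (n := ∞)
    exact (this.restrict_scalars ℝ).comp h1
  exact h2.mul ((contDiff_const.mul (h1.pow 2)).neg.cexp)

theorem exists_norm_eval_le_exp (p : Polynomial ℂ) :
    ∃ C : ℝ, 0 ≤ C ∧ ∀ z : ℂ, ‖p.eval z‖ ≤ C * Real.exp ‖z‖ := by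
  induction p using Polynomial.induction_on' with
  | add p q hp hq =>
    obtain ⟨C, hC, h⟩ := hp
    obtain ⟨D, hD, h'⟩ := hq
    refine ⟨C + D, by positivity, fun z => ?_⟩
    rw [Polynomial.eval_add, add_mul]
    exact (norm_add_le _ _).trans (add_le_add (h z) (h' z))
  | monomial n a =>
    refine ⟨‖a‖ * n.factorial, by positivity, fun z => ?_⟩
    rw [Polynomial.eval_monomial, norm_mul, norm_pow, mul_assoc]
    gcongr
    have := Real.pow_div_factorial_le_exp ‖z‖ (norm_nonneg z) n
    rw [div_le_iff₀ (by positivity)] at this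
    linarith

/-- Gaussian decay of `p(z) exp(-c z²)` along strips around the real axis. -/
theorem exists_norm_polyGauss_le {c : ℝ} (hc : 0 < c) (p : Polynomial ℂ) (r K : ℝ) :
    ∃ C : ℝ, 0 ≤ C ∧ ∀ (s : ℝ) (w : ℂ), ‖w‖ ≤ r →
      Real.exp (K * |s|) * ‖polyGauss c p (s - w)‖ ≤ C * Real.exp (-(c / 2) * s ^ 2) := by
  obtain ⟨C, hC, h⟩ := exists_norm_eval_le_exp p
  -- `L` collects the coefficients of `|s|`: `K` from the weight, `1` from the exponential bound of
  -- the polynomial, `2 c r` from the cross term of the shifted Gaussian. Completing the square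
  -- absorbs `L |s|` into half of the Gaussian.
  set L : ℝ := K + 1 + 2 * c * r with hL
  refine ⟨C * Real.exp (r + c * r ^ 2 + L ^ 2 / (2 * c)), by positivity, fun s w hw => ?_⟩
  have hr : 0 ≤ r := (norm_nonneg w).trans hw
  have hs : ‖(s : ℂ) - w‖ ≤ |s| + r := by
    refine (norm_sub_le _ _).trans ?_
    rw [Complex.norm_real, Real.norm_eq_abs]
    linarith
  have h1 : ‖Complex.exp (-(c * ((s : ℂ) - w) ^ 2))‖ ≤
      Real.exp (-(c * s ^ 2) + 2 * c * r * |s| + c * r ^ 2) := by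
    rw [Complex.norm_exp]
    apply Real.exp_le_exp.2
    have hre : (-((c : ℂ) * ((s : ℂ) - w) ^ 2)).re = -(c * ((s - w.re) ^ 2 - w.im ^ 2)) := by
      simp [pow_two]
    rw [hre]
    have hw2 : w.re ^ 2 + w.im ^ 2 ≤ r ^ 2 := by
      have : ‖w‖ ^ 2 ≤ r ^ 2 := by gcongr
      rw [Complex.sq_norm, Complex.normSq_apply] at this
      linarith
    have hwre : s * w.re ≤ |s| * r := by
      calc s * w.re ≤ |s * w.re| := le_abs_self _
        _ = |s| * |w.re| := abs_mul _ _
        _ ≤ |s| * r := by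
          gcongr
          exact (Complex.abs_re_le_norm w).trans hw
    nlinarith [sq_nonneg w.re, mul_le_mul_of_nonneg_left hwre hc.le,
      mul_le_mul_of_nonneg_left hw2 hc.le, mul_nonneg hc.le (sq_nonneg w.re)]
  calc Real.exp (K * |s|) * ‖polyGauss c p (s - w)‖
      ≤ Real.exp (K * |s|) * ((C * Real.exp (|s| + r)) *
          Real.exp (-(c * s ^ 2) + 2 * c * r * |s| + c * r ^ 2)) := by
        rw [polyGauss, norm_mul]
        gcongr
        exact (h _).trans (by gcongr)
    _ = C * Real.exp (K * |s| + (|s| + r) + (-(c * s ^ 2) + 2 * c * r * |s| + c * r ^ 2)) := by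
        rw [Real.exp_add (K * |s| + (|s| + r)), Real.exp_add (K * |s|)]
        ring
    _ ≤ C * Real.exp (r + c * r ^ 2 + L ^ 2 / (2 * c) + -(c / 2) * s ^ 2) := by
        refine mul_le_mul_of_nonneg_left (Real.exp_le_exp.2 ?_) hC
        have h2 : L * |s| ≤ c / 2 * s ^ 2 + L ^ 2 / (2 * c) := by
          have h3 : 0 ≤ (c * |s| - L) ^ 2 / (2 * c) := by positivity
          have h4 : (c * |s| - L) ^ 2 / (2 * c)
              = c / 2 * s ^ 2 + L ^ 2 / (2 * c) - L * |s| := by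
            field_simp
            rw [← sq_abs s]
            ring
          linarith
        have h5 : L * |s| = K * |s| + |s| + 2 * c * r * |s| := by rw [hL]; ring
        linarith
    _ = _ := by rw [Real.exp_add]; ring

theorem exists_norm_polyGauss_real_le {c : ℝ} (hc : 0 < c) (p : Polynomial ℂ) :
    ∃ C : ℝ, 0 ≤ C ∧ ∀ s : ℝ, ‖polyGauss c p s‖ ≤ C * Real.exp (-(c / 2) * s ^ 2) := by
  obtain ⟨C, hC, h⟩ := exists_norm_polyGauss_le hc p 0 0
  exact ⟨C, hC, fun s => by simpa using h s 0 (by simp)⟩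

theorem memLp_of_norm_le_gaussian {f : ℝ → ℂ} (hf : AEStronglyMeasurable f) {b C : ℝ} (hb : 0 < b)
    (h : ∀ s, ‖f s‖ ≤ C * Real.exp (-b * s ^ 2)) : MemLp f 2 := by
  rw [memLp_two_iff_integrable_sq_norm hf]
  refine ((integrable_exp_neg_mul_sq (b := 2 * b) (by positivity)).const_mul (C ^ 2)).mono'
    (hf.norm.pow 2) (Eventually.of_forall fun s => ?_)
  rw [Real.norm_of_nonneg (by positivity)]
  calc ‖f s‖ ^ 2 ≤ (C * Real.exp (-b * s ^ 2)) ^ 2 := by gcongr; exact h s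
    _ = _ := by
      rw [mul_pow, ← Real.exp_nat_mul]
      congr 2
      push_cast
      ring

/-- The Weyl translation `exp(i (a s - a c / 2)) f(s - c)`. -/
noncomputable def weylShift (a c : ℝ) (f : ℝ → ℂ) (s : ℝ) : ℂ :=
  Complex.exp (Complex.I * ((a * s - a * c / 2 : ℝ) : ℂ)) * f (s - c)

theorem norm_weylShift (a c : ℝ) (f : ℝ → ℂ) (s : ℝ) : ‖weylShift a c f s‖ = ‖f (s - c)‖ := by
  rw [weylShift, norm_mul, mul_comm Complex.I, Complex.norm_exp_ofReal_mul_I, one_mul]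

theorem weylShift_const_mul (a c : ℝ) (x : ℂ) (f : ℝ → ℂ) :
    weylShift a c (fun s => x * f s) = fun s => x * weylShift a c f s := by
  ext s
  simp only [weylShift]
  ring

theorem continuous_weylShift (a c : ℝ) {f : ℝ → ℂ} (hf : Continuous f) :
    Continuous (weylShift a c f) := by
  unfold weylShift
  fun_prop

theorem hasDerivAt_weylShift (a c : ℝ) {f : ℝ → ℂ} {f' : ℂ} {s : ℝ}
    (hf : HasDerivAt f f' (s - c)) :
    HasDerivAt (weylShift a c f)
      (Complex.I * a * weylShift a c f s
        + Complex.exp (Complex.I * ((a * s - a * c / 2 : ℝ) : ℂ)) * f') s := by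
  have h1 : HasDerivAt (fun s : ℝ => Complex.exp (Complex.I * ((a * s - a * c / 2 : ℝ) : ℂ)))
      (Complex.exp (Complex.I * ((a * s - a * c / 2 : ℝ) : ℂ)) * (Complex.I * (a : ℂ))) s := by
    have h0 : HasDerivAt (fun s : ℝ => a * s - a * c / 2) a s := by
      simpa using ((hasDerivAt_id s).const_mul a).sub_const (a * c / 2)
    exact (h0.ofReal_comp.const_mul Complex.I).cexp
  have h2 : HasDerivAt (fun s : ℝ => f (s - c)) f' s := hf.comp_sub_const s c
  refine (h1.mul h2).congr_deriv ?_
  simp only [weylShift]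
  ring

/-! ### Masses and frequencies, ladder operators, Hermite functions. -/

namespace Params

variable (P : Params)

theorem mp_pos : 0 < P.mp := div_pos P.me_pos (pow_pos P.ωp_pos 2)

theorem mc_pos : 0 < P.mc := div_pos P.me_pos (pow_pos P.ωc_pos 2)

theorem M_pos : 0 < P.M := div_pos (add_pos P.mp_pos P.mc_pos) two_pos

theorem μ_pos : 0 < P.μ := div_pos (mul_pos P.mp_pos P.mc_pos) P.M_pos

theorem Ω_pos : 0 < P.Ω := Real.sqrt_pos.2 (div_pos (mul_pos two_pos P.me_pos) P.μ_pos)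

theorem Ω_sq : P.Ω ^ 2 = 2 * P.me / P.μ :=
  Real.sq_sqrt (div_pos (mul_pos two_pos P.me_pos) P.μ_pos).le

theorem Ω_sq_eq_add : P.Ω ^ 2 = P.ωp ^ 2 + P.ωc ^ 2 := by
  have h1 := P.me_pos
  have h2 := P.ωp_pos
  have h3 := P.ωc_pos
  rw [Ω_sq, μ, M, mp, mc]
  field_simp
  ring

theorem energy_pos (j : ℕ) : 0 < P.energy j :=
  mul_pos (mul_pos P.hbar_pos P.Ω_pos) (by positivity)

/-- The coefficient `√(μΩ/(2ℏ))` of `s` in the ladder operators. -/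
noncomputable def κ : ℝ := Real.sqrt (P.μ * P.Ω / (2 * P.hbar))

/-- The coefficient `√(ℏ/(2μΩ))` of `d/ds` in the ladder operators. -/
noncomputable def η : ℝ := Real.sqrt (P.hbar / (2 * P.μ * P.Ω))

theorem κ_pos : 0 < P.κ :=
  Real.sqrt_pos.2 (div_pos (mul_pos P.μ_pos P.Ω_pos) (mul_pos two_pos P.hbar_pos))

theorem η_pos : 0 < P.η :=
  Real.sqrt_pos.2 (div_pos P.hbar_pos (mul_pos (mul_pos two_pos P.μ_pos) P.Ω_pos))

theorem κ_sq : P.κ ^ 2 = P.μ * P.Ω / (2 * P.hbar) :=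
  Real.sq_sqrt (div_pos (mul_pos P.μ_pos P.Ω_pos) (mul_pos two_pos P.hbar_pos)).le

theorem η_sq : P.η ^ 2 = P.hbar / (2 * P.μ * P.Ω) :=
  Real.sq_sqrt (div_pos P.hbar_pos (mul_pos (mul_pos two_pos P.μ_pos) P.Ω_pos)).le

/-- This is the canonical commutation relation: `[b, b†] = 2 κ η = 1`. -/
theorem κ_mul_η : P.κ * P.η = 1 / 2 := by
  have h1 := P.hbar_pos
  have h2 := P.μ_pos
  have h3 := P.Ω_pos
  have h : (P.κ * P.η) ^ 2 = (1 / 2) ^ 2 := by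
    rw [mul_pow, κ_sq, η_sq]
    field_simp
  exact (pow_left_inj₀ (mul_pos P.κ_pos P.η_pos).le (by norm_num) two_ne_zero).1 h

theorem κ_mul_η_complex : (P.κ : ℂ) * P.η = 1 / 2 := by
  rw [← Complex.ofReal_mul, κ_mul_η]
  norm_num

/-- The argument of the Hermite polynomial in `phi` is thus `2 κ s`, and the Gaussian is `exp(-κ²
s²)`. -/
theorem two_mul_κ : 2 * P.κ = Real.sqrt 2 * Real.sqrt (P.μ * P.Ω / P.hbar) := by
  have h1 := P.hbar_pos
  have h2 := mul_pos P.μ_pos P.Ω_pos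
  rw [← Real.sqrt_mul (by norm_num), κ, show (2 : ℝ) = Real.sqrt (2 ^ 2) by simp,
    ← Real.sqrt_mul (by norm_num)]
  congr 1
  rw [Real.sqrt_sq (by norm_num)]
  field_simp

/-- The normalization constant of the Hermite functions. -/
noncomputable def hermiteNorm : ℝ := (P.μ * P.Ω / (Real.pi * P.hbar)) ^ (1 / 4 : ℝ)

open Polynomial in
/-- The polynomial factor of `φ_j`. -/
noncomputable def phiPoly (j : ℕ) : ℂ[X] :=
  C ((P.hermiteNorm / Real.sqrt (j.factorial : ℝ) : ℝ) : ℂ) *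
    ((hermite j).map (Int.castRingHom ℂ)).comp (C ((2 * P.κ : ℝ) : ℂ) * X)

theorem phi_eq_polyGauss (j : ℕ) (s : ℝ) : P.phi j s = polyGauss (P.κ ^ 2) (P.phiPoly j) s := by
  have h1 := P.hbar_pos
  have he : -(P.μ * P.Ω / P.hbar * s ^ 2) / 2 = -(P.κ ^ 2 * s ^ 2) := by
    rw [κ_sq]
    field_simp
  have ha : Real.sqrt 2 * (Real.sqrt (P.μ * P.Ω / P.hbar) * s) = 2 * P.κ * s := by
    rw [two_mul_κ]
    ring
  rw [phi, he, ha, polyGauss, phiPoly, Polynomial.eval_mul, Polynomial.eval_C,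
    Polynomial.eval_comp, Complex.ofReal_mul, Complex.ofReal_mul, Complex.ofReal_exp, hermiteNorm]
  congr 2
  · rw [Polynomial.eval_map, Polynomial.eval_mul, Polynomial.eval_C, Polynomial.eval_X,
      ← Complex.ofReal_mul, ← algebraMap_int_eq, ← Polynomial.aeval_def]
    exact (Polynomial.aeval_algebraMap_apply ℂ (2 * P.κ * s : ℝ) (Polynomial.hermite j)).symm
  · push_cast
    ring

theorem phi_eq (j : ℕ) : P.phi j = fun s : ℝ => polyGauss (P.κ ^ 2) (P.phiPoly j) s :=
  funext (P.phi_eq_polyGauss j)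

theorem lower_eq (f : ℝ → ℂ) (s : ℝ) :
    P.lower f s = ((P.κ * s : ℝ) : ℂ) * f s + (P.η : ℂ) * deriv f s := rfl

theorem raise_eq (f : ℝ → ℂ) (s : ℝ) :
    P.raise f s = ((P.κ * s : ℝ) : ℂ) * f s - (P.η : ℂ) * deriv f s := rfl

theorem deriv_polyGauss_real (c : ℝ) (p : Polynomial ℂ) :
    deriv (fun s : ℝ => polyGauss c p s) = fun s : ℝ => polyGauss c (gaussDeriv c p) s :=
  funext fun s => (hasDerivAt_polyGauss_real c p s).deriv

-- Since `2 κ η = 1`, differentiating the Gaussian cancels the multiplication by `κ s`, and only the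
-- derivative of the polynomial is left. For `raise` the two contributions add up instead.
open Polynomial in
theorem lower_polyGauss (p : ℂ[X]) :
    P.lower (fun s : ℝ => polyGauss (P.κ ^ 2 : ℝ) p s) =
      fun s : ℝ => polyGauss (P.κ ^ 2 : ℝ) (C (P.η : ℂ) * derivative p) s := by
  ext s
  rw [lower_eq, deriv_polyGauss_real]
  simp only [polyGauss, gaussDeriv, eval_sub, eval_mul, eval_C, eval_X]
  push_cast
  linear_combination (-2 * P.κ * s * p.eval (s : ℂ) * Complex.exp (-(P.κ ^ 2 * s ^ 2))) *
    P.κ_mul_η_complex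

open Polynomial in
theorem raise_polyGauss (p : ℂ[X]) :
    P.raise (fun s : ℝ => polyGauss (P.κ ^ 2 : ℝ) p s) =
      fun s : ℝ => polyGauss (P.κ ^ 2 : ℝ)
        (C (2 * (P.κ : ℂ)) * X * p - C (P.η : ℂ) * derivative p) s := by
  ext s
  rw [raise_eq, deriv_polyGauss_real]
  simp only [polyGauss, gaussDeriv, eval_sub, eval_mul, eval_C, eval_X]
  push_cast
  linear_combination (2 * P.κ * s * p.eval (s : ℂ) * Complex.exp (-(P.κ ^ 2 * s ^ 2))) *
    P.κ_mul_η_complex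

end Params

/-- The Appell property, by induction from `He_{j+1} = X He_j - He_j'`. It makes `lower` act as a
step down on the Hermite functions. -/
theorem derivative_hermite_succ (j : ℕ) :
    Polynomial.derivative (Polynomial.hermite (j + 1))
      = ((j + 1 : ℕ) : Polynomial ℤ) * Polynomial.hermite j := by
  induction j with
  | zero => simp [Polynomial.hermite_zero]
  | succ j ih =>
    rw [Polynomial.hermite_succ (j + 1), Polynomial.derivative_sub, Polynomial.derivative_mul,
      ih, Polynomial.derivative_mul]
    simp only [Polynomial.derivative_X, Polynomial.derivative_natCast]
    rw [Polynomial.hermite_succ j]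
    push_cast
    ring

namespace Params

variable (P : Params)

theorem sqrt_succ_mul_div (j : ℕ) (a : ℝ) :
    Real.sqrt (j + 1) * (a / Real.sqrt ((j + 1).factorial : ℝ))
      = a / Real.sqrt (j.factorial : ℝ) := by
  have h : Real.sqrt ((j + 1).factorial : ℝ) = Real.sqrt (j + 1) * Real.sqrt (j.factorial) := by
    rw [Nat.factorial_succ]
    push_cast
    exact Real.sqrt_mul (by positivity) _
  have h1 : 0 < Real.sqrt ((j : ℝ) + 1) := Real.sqrt_pos.2 (by positivity)
  have h2 : 0 < Real.sqrt (j.factorial : ℝ) := Real.sqrt_pos.2 (by positivity)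
  rw [h]
  field_simp

open Polynomial in
theorem derivative_phiPoly (j : ℕ) : derivative (P.phiPoly j) =
    C ((P.hermiteNorm / Real.sqrt (j.factorial : ℝ) : ℝ) : ℂ) * C ((2 * P.κ : ℝ) : ℂ) *
    ((derivative (hermite j)).map (Int.castRingHom ℂ)).comp (C ((2 * P.κ : ℝ) : ℂ) * X) := by
  rw [phiPoly, derivative_C_mul, derivative_comp, derivative_C_mul, derivative_X,
    Polynomial.derivative_map]
  ring

/-- The chain rule for the argument `2 κ s` contributes a factor `2 κ`, which `η` turns into `1`;
what remains is the defining recursion of the Hermite polynomials. -/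
theorem raise_phi (j : ℕ) (s : ℝ) :
    P.raise (P.phi j) s = (Real.sqrt (j + 1) : ℂ) * P.phi (j + 1) s := by
  rw [phi_eq, raise_polyGauss, phi_eq_polyGauss]
  simp only [polyGauss]
  rw [← mul_assoc]
  congr 1
  rw [derivative_phiPoly, phiPoly, phiPoly]
  simp only [Polynomial.eval_sub, Polynomial.eval_mul, Polynomial.eval_C, Polynomial.eval_X,
    Polynomial.hermite_succ, Polynomial.map_sub, Polynomial.map_mul, Polynomial.map_X,
    Polynomial.sub_comp, Polynomial.mul_comp, Polynomial.X_comp]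
  rw [← sqrt_succ_mul_div j]
  push_cast
  have h := P.κ_mul_η_complex
  linear_combination (-2 * (Real.sqrt (j + 1) : ℂ) * ((P.hermiteNorm : ℂ)
    / (Real.sqrt ((j + 1).factorial : ℝ) : ℂ)) * Polynomial.eval (s : ℂ)
      (((Polynomial.derivative (Polynomial.hermite j)).map (Int.castRingHom ℂ)).comp
        (Polynomial.C (2 * (P.κ : ℂ)) * Polynomial.X))) * h

theorem lower_phi_zero (s : ℝ) : P.lower (P.phi 0) s = 0 := by
  rw [phi_eq, lower_polyGauss, derivative_phiPoly]
  simp [polyGauss]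

theorem lower_phi_succ (j : ℕ) (s : ℝ) :
    P.lower (P.phi (j + 1)) s = (Real.sqrt (j + 1) : ℂ) * P.phi j s := by
  rw [phi_eq, lower_polyGauss, phi_eq_polyGauss]
  simp only [polyGauss]
  rw [← mul_assoc]
  congr 1
  rw [derivative_phiPoly, phiPoly, derivative_hermite_succ]
  simp only [Polynomial.eval_mul, Polynomial.eval_C, Polynomial.map_mul, Polynomial.mul_comp,
    Polynomial.map_natCast, Polynomial.natCast_comp, Polynomial.eval_natCast]
  rw [← sqrt_succ_mul_div j]
  have h := P.κ_mul_η_complex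
  have h2 : (Real.sqrt (j + 1) : ℂ) * (Real.sqrt (j + 1) : ℂ) = (j : ℂ) + 1 := by
    rw [← Complex.ofReal_mul, Real.mul_self_sqrt (by positivity)]
    push_cast
    ring
  push_cast
  linear_combination (2 * ((j : ℂ) + 1) * ((P.hermiteNorm : ℂ)
    / (Real.sqrt ((j + 1).factorial : ℝ) : ℂ)) * Polynomial.eval (s : ℂ)
      (((Polynomial.hermite j).map (Int.castRingHom ℂ)).comp
        (Polynomial.C (2 * (P.κ : ℂ)) * Polynomial.X))) * h - (((P.hermiteNorm : ℂ)
    / (Real.sqrt ((j + 1).factorial : ℝ) : ℂ)) * Polynomial.eval (s : ℂ)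
      (((Polynomial.hermite j).map (Int.castRingHom ℂ)).comp
        (Polynomial.C (2 * (P.κ : ℂ)) * Polynomial.X))) * h2

theorem continuous_phi (j : ℕ) : Continuous (P.phi j) := by
  rw [phi_eq]
  exact (continuous_polyGauss _ _).comp Complex.continuous_ofReal

theorem contDiff_phi (j : ℕ) : ContDiff ℝ ∞ (P.phi j) := by
  rw [phi_eq]
  exact contDiff_polyGauss_real _ _

theorem conj_phi (j : ℕ) (s : ℝ) : conj (P.phi j s) = P.phi j s := by
  rw [phi, Complex.conj_ofReal]

theorem raise_lower_phi (j : ℕ) (s : ℝ) :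
    P.raise (P.lower (P.phi j)) s = (j : ℂ) * P.phi j s := by
  cases j with
  | zero =>
    have : P.lower (P.phi 0) = fun _ => 0 := funext P.lower_phi_zero
    rw [this, raise_eq]
    simp
  | succ j =>
    have : P.lower (P.phi (j + 1)) = fun s => (Real.sqrt (j + 1) : ℂ) * P.phi j s :=
      funext (P.lower_phi_succ j)
    have h2 : (Real.sqrt (j + 1) : ℂ) * (Real.sqrt (j + 1) : ℂ) = (j : ℂ) + 1 := by
      rw [← Complex.ofReal_mul, Real.mul_self_sqrt (by positivity)]
      push_cast
      ring
    have hr := P.raise_phi j s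
    rw [raise_eq] at hr
    rw [this, raise_eq, deriv_const_mul_field]
    push_cast at hr ⊢
    linear_combination (Real.sqrt (j + 1) : ℂ) * hr + P.phi (j + 1) s * h2

/-- The Hermite differential equation. -/
theorem deriv_deriv_phi (j : ℕ) (s : ℝ) :
    ((P.η ^ 2 : ℝ) : ℂ) * deriv (deriv (P.phi j)) s
      = ((P.κ ^ 2 * s ^ 2 - 1 / 2 - j : ℝ) : ℂ) * P.phi j s := by
  -- Expanding the number operator gives `b† b = κ² s² - 1/2 - η² d²/ds²`, with the `1/2` equal to
  -- `κ η`.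
  have h := P.raise_lower_phi j s
  have hd : Differentiable ℝ (P.phi j) := (P.contDiff_phi j).differentiable (by simp)
  have hd2 : Differentiable ℝ (deriv (P.phi j)) := by
    have := (contDiff_infty_iff_deriv.1 (P.contDiff_phi j)).2
    exact this.differentiable (by simp)
  have h1 : HasDerivAt (P.lower (P.phi j)) ((P.κ : ℂ) * P.phi j s
      + ((P.κ * s : ℝ) : ℂ) * deriv (P.phi j) s + (P.η : ℂ) * deriv (deriv (P.phi j)) s) s := by
    have h0 : HasDerivAt (fun s : ℝ => ((P.κ * s : ℝ) : ℂ)) (P.κ : ℂ) s := by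
      simpa using ((hasDerivAt_id s).const_mul P.κ).ofReal_comp
    exact (h0.mul (hd s).hasDerivAt).add ((hd2 s).hasDerivAt.const_mul _)
  rw [raise_eq, h1.deriv, lower_eq] at h
  have hk := P.κ_mul_η_complex
  push_cast at h ⊢
  linear_combination (-1 : ℂ) * h - P.phi j s * hk

/-- In these units the oscillator is `ℏΩ (κ² s² - η² d²/ds²)` with `s = v - a`, so the Hermite
equation applies. -/
theorem shiftedOscillator_phi (a : ℝ) (j : ℕ) (v : ℝ) :
    P.shiftedOscillator a (fun t => P.phi j (t - a)) v = (P.energy j : ℂ) * P.phi j (v - a) := by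
  have h := P.deriv_deriv_phi j (v - a)
  have h1 : deriv (fun t => P.phi j (t - a)) = fun t => deriv (P.phi j) (t - a) := by
    ext t
    rw [deriv_comp_sub_const]
  rw [shiftedOscillator, h1, deriv_comp_sub_const (f := deriv (P.phi j))]
  have e1 : P.hbar ^ 2 / (2 * P.μ) = P.hbar * P.Ω * P.η ^ 2 := by
    have := P.Ω_pos
    have := P.μ_pos
    rw [η_sq]
    field_simp
  have e2 : P.μ * P.Ω ^ 2 / 2 * (v - a) ^ 2 = P.hbar * P.Ω * (P.κ ^ 2 * (v - a) ^ 2) := by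
    have := P.hbar_pos
    rw [κ_sq]
    field_simp
  rw [e1, e2, energy]
  push_cast at h ⊢
  linear_combination -(P.hbar * P.Ω : ℂ) * h

end Params

/-! ### The exponential series of the displacement operator. -/

open Polynomial in
/-- The action of `i a s - c d/ds` on the polynomial factor of `p(s) exp(-b s²)`. -/
noncomputable def weylGen (a c b : ℝ) (p : ℂ[X]) : ℂ[X] :=
  C (Complex.I * a) * X * p - C (c : ℂ) * gaussDeriv b p

/-- The orbit of `p(s) exp(-b s²)` under the Weyl translations, for complex times. -/
noncomputable def weylOrbit (a c b s : ℝ) (p : Polynomial ℂ) (t : ℂ) : ℂ :=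
  Complex.exp (Complex.I * (a * t * s - a * c * t ^ 2 / 2)) * polyGauss b p (s - c * t)

/-- The phase `-a c t² / 2` is what makes this work: the derivative of the exponent is `i a (s - c
t)`, the multiplication by `i a s` evaluated at the translated point. Hence each derivative in `t`
applies the generator to the polynomial factor once more. -/
theorem hasDerivAt_weylOrbit (a c b s : ℝ) (p : Polynomial ℂ) (t : ℂ) :
    HasDerivAt (weylOrbit a c b s p) (weylOrbit a c b s (weylGen a c b p) t) t := by
  have h1 : HasDerivAt (fun t : ℂ => Complex.I * (a * t * s - a * c * t ^ 2 / 2))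
      (Complex.I * (a * s - a * c * t)) t := by
    have h := ((((hasDerivAt_id t).const_mul (a : ℂ)).mul_const (s : ℂ)).sub
      ((((hasDerivAt_id t).pow 2).const_mul ((a : ℂ) * c)).div_const 2)).const_mul Complex.I
    refine h.congr_deriv ?_
    simp only [id, Nat.cast_ofNat, pow_one, mul_one, Nat.add_one_sub_one]
    ring
  have h2 : HasDerivAt (fun t : ℂ => (s : ℂ) - c * t) (-(c : ℂ)) t := by
    simpa using ((hasDerivAt_id t).const_mul (c : ℂ)).const_sub (s : ℂ)
  have h3 := (hasDerivAt_polyGauss b p ((s : ℂ) - c * t)).comp t h2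
  refine (h1.cexp.mul h3).congr_deriv ?_
  simp only [weylOrbit, polyGauss, weylGen, Polynomial.eval_sub, Polynomial.eval_mul,
    Polynomial.eval_C, Polynomial.eval_X, Function.comp]
  ring

theorem differentiable_weylOrbit (a c b s : ℝ) (p : Polynomial ℂ) :
    Differentiable ℂ (weylOrbit a c b s p) :=
  fun t => (hasDerivAt_weylOrbit a c b s p t).differentiableAt

theorem iteratedDeriv_weylOrbit (a c b s : ℝ) (p : Polynomial ℂ) (k : ℕ) :
    iteratedDeriv k (weylOrbit a c b s p) = weylOrbit a c b s ((weylGen a c b)^[k] p) := by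
  induction k generalizing p with
  | zero => simp
  | succ k ih =>
    rw [iteratedDeriv_succ', Function.iterate_succ_apply, ← ih]
    congr 1
    ext t
    exact (hasDerivAt_weylOrbit a c b s p t).deriv

theorem weylOrbit_zero (a c b s : ℝ) (p : Polynomial ℂ) :
    weylOrbit a c b s p 0 = polyGauss b p s := by
  simp [weylOrbit]

theorem weylOrbit_one (a c b s : ℝ) (p : Polynomial ℂ) :
    weylOrbit a c b s p 1 = weylShift a c (fun s : ℝ => polyGauss b p s) s := by
  simp [weylOrbit, weylShift]

/-- A Gaussian bound for the orbit on the disc of radius two. -/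
theorem exists_norm_weylOrbit_le (a c : ℝ) {b : ℝ} (hb : 0 < b) (p : Polynomial ℂ) :
    ∃ C : ℝ, 0 ≤ C ∧ ∀ (s : ℝ) (t : ℂ), ‖t‖ ≤ 2 →
      ‖weylOrbit a c b s p t‖ ≤ C * Real.exp (-(b / 2) * s ^ 2) := by
  -- For `‖t‖ ≤ 2` the argument moves by at most `2 |c|`, and the complex phase grows like `exp(2
  -- |a| |s|)`.
  obtain ⟨C, hC, h⟩ := exists_norm_polyGauss_le hb p (2 * |c|) (2 * |a|)
  refine ⟨Real.exp (2 * |a * c|) * C, by positivity, fun s t ht => ?_⟩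
  have h1 : ‖Complex.exp (Complex.I * (a * t * s - a * c * t ^ 2 / 2))‖
      ≤ Real.exp (2 * |a * c|) * Real.exp (2 * |a| * |s|) := by
    rw [← Real.exp_add]
    refine (Complex.norm_exp_le_exp_norm _).trans (Real.exp_le_exp.2 ?_)
    rw [norm_mul, Complex.norm_I, one_mul]
    refine (norm_sub_le _ _).trans ?_
    simp only [norm_mul, norm_div, norm_pow, Complex.norm_real, Real.norm_eq_abs, abs_mul,
      Complex.norm_ofNat]
    have h2 : ‖t‖ ^ 2 ≤ 2 ^ 2 := by gcongr
    nlinarith [mul_le_mul_of_nonneg_left ht (mul_nonneg (abs_nonneg a) (abs_nonneg s)),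
      mul_le_mul_of_nonneg_left h2 (mul_nonneg (abs_nonneg a) (abs_nonneg c))]
  have h3 := h s (c * t) (by
    rw [norm_mul, Complex.norm_real, Real.norm_eq_abs]
    nlinarith [abs_nonneg c])
  calc ‖weylOrbit a c b s p t‖
      ≤ (Real.exp (2 * |a * c|) * Real.exp (2 * |a| * |s|)) * ‖polyGauss b p (s - c * t)‖ := by
        rw [weylOrbit, norm_mul]
        gcongr
    _ ≤ Real.exp (2 * |a * c|) * (C * Real.exp (-(b / 2) * s ^ 2)) := by
        rw [mul_assoc]
        gcongr
    _ = _ := by ring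

namespace Params

variable (P : Params)

/-- The frequency of the modulation in `D(α)`. -/
noncomputable def modFreq (α : ℂ) : ℝ := 2 * P.κ * α.im

/-- The length of the translation in `D(α)`. -/
noncomputable def shiftLen (α : ℂ) : ℝ := 2 * P.η * α.re

/-- The Weyl operator: the closed form of the displacement operator. -/
noncomputable def weyl (α : ℂ) (f : ℝ → ℂ) : ℝ → ℂ :=
  weylShift (P.modFreq α) (P.shiftLen α) f

theorem κ_sq_pos : 0 < P.κ ^ 2 := pow_pos P.κ_pos 2

/-- Grouping terms gives `α b† - α* b = (α - α*) κ s - (α + α*) η d/ds`, whose coefficients are `i`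
times `modFreq α` and minus `shiftLen α`. -/
theorem displacementGen_polyGauss (α : ℂ) (p : Polynomial ℂ) :
    P.displacementGen α (fun s : ℝ => polyGauss (P.κ ^ 2) p s) =
      fun s : ℝ => polyGauss (P.κ ^ 2) (weylGen (P.modFreq α) (P.shiftLen α) (P.κ ^ 2) p) s := by
  ext s
  rw [displacementGen, raise_eq, lower_eq, deriv_polyGauss_real]
  have h1 : α - conj α = 2 * Complex.I * α.im := by
    rw [Complex.sub_conj]
    push_cast
    ring
  have h2 : α + conj α = 2 * α.re := by
    rw [Complex.add_conj]
    push_cast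
    ring
  simp only [weylGen, modFreq, shiftLen, polyGauss, Polynomial.eval_sub, Polynomial.eval_mul,
    Polynomial.eval_C, Polynomial.eval_X]
  push_cast
  linear_combination (P.κ * s * Polynomial.eval (s : ℂ) p * Complex.exp (-(P.κ ^ 2 * s ^ 2))) * h1
    - (P.η * (Polynomial.eval (s : ℂ) (gaussDeriv (P.κ ^ 2) p)
      * Complex.exp (-(P.κ ^ 2 * s ^ 2)))) * h2

theorem iterate_displacementGen_polyGauss (α : ℂ) (p : Polynomial ℂ) (k : ℕ) :
    (P.displacementGen α)^[k] (fun s : ℝ => polyGauss (P.κ ^ 2) p s) =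
      fun s : ℝ => polyGauss (P.κ ^ 2)
        ((weylGen (P.modFreq α) (P.shiftLen α) (P.κ ^ 2))^[k] p) s := by
  induction k generalizing p with
  | zero => rfl
  | succ k ih =>
    rw [Function.iterate_succ_apply, displacementGen_polyGauss, ih, Function.iterate_succ_apply]

theorem displacementTerm_phi (α : ℂ) (j k : ℕ) (s : ℝ) :
    P.displacementTerm α (P.phi j) k s = ((k.factorial : ℂ))⁻¹ *
      iteratedDeriv k (weylOrbit (P.modFreq α) (P.shiftLen α) (P.κ ^ 2) s (P.phiPoly j)) 0 := by
  rw [displacementTerm, phi_eq, iterate_displacementGen_polyGauss, iteratedDeriv_weylOrbit,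
    weylOrbit_zero]

/-- For fixed `s` this is the Taylor expansion at `0` of the orbit, an entire function of complex
time, evaluated at time one. -/
theorem hasSum_displacementTerm (α : ℂ) (j : ℕ) (s : ℝ) :
    HasSum (fun r : ℕ => P.displacementTerm α (P.phi j) r s) (P.weyl α (P.phi j) s) := by
  have h := Complex.hasSum_taylorSeries_of_entire
    (differentiable_weylOrbit (P.modFreq α) (P.shiftLen α) (P.κ ^ 2) s (P.phiPoly j)) 0 1
  rw [weylOrbit_one, ← phi_eq] at h
  simp only [displacementTerm_phi]
  simpa [weyl] using h

theorem displacement_phi (α : ℂ) (j : ℕ) : P.displacement α (P.phi j) = P.weyl α (P.phi j) :=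
  funext fun s => (P.hasSum_displacementTerm α j s).tsum_eq

/-- Cauchy's estimate on the circle of radius `2`: any radius above `1` gives geometric decay in
`k`, while the bound on the orbit keeps a Gaussian in `s`. This is what upgrades pointwise
convergence to convergence in `L²`. -/
theorem exists_norm_displacementTerm_le (α : ℂ) (j : ℕ) :
    ∃ C : ℝ, 0 ≤ C ∧ ∀ (k : ℕ) (s : ℝ), ‖P.displacementTerm α (P.phi j) k s‖
      ≤ C * Real.exp (-(P.κ ^ 2 / 2) * s ^ 2) * (1 / 2) ^ k := by
  obtain ⟨C, hC, h⟩ := exists_norm_weylOrbit_le (P.modFreq α) (P.shiftLen α) P.κ_sq_pos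
    (P.phiPoly j)
  refine ⟨C, hC, fun k s => ?_⟩
  have h1 := Complex.norm_iteratedDeriv_le_of_forall_mem_sphere_norm_le (c := 0) (R := 2) k
    two_pos (differentiable_weylOrbit (P.modFreq α) (P.shiftLen α) (P.κ ^ 2) s
      (P.phiPoly j)).diffContOnCl (fun z hz => h s z (by simpa using (mem_sphere_iff_norm.1 hz).le))
  rw [displacementTerm_phi, norm_mul, norm_inv, Complex.norm_natCast]
  have hk : (0 : ℝ) < k.factorial := by positivity
  calc (k.factorial : ℝ)⁻¹ * _ ≤ (k.factorial : ℝ)⁻¹ *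
        (k.factorial * (C * Real.exp (-(P.κ ^ 2 / 2) * s ^ 2)) / 2 ^ k) := by gcongr
    _ = _ := by
      field_simp
      rw [mul_assoc, ← mul_pow]
      norm_num

theorem continuous_weyl_phi (α : ℂ) (j : ℕ) : Continuous (P.weyl α (P.phi j)) :=
  continuous_weylShift _ _ (P.continuous_phi j)

theorem memLp_phi (j : ℕ) : MemLp (P.phi j) 2 := by
  obtain ⟨C, -, h⟩ := exists_norm_polyGauss_real_le P.κ_sq_pos (P.phiPoly j)
  refine memLp_of_norm_le_gaussian (P.continuous_phi j).aestronglyMeasurable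
    (half_pos P.κ_sq_pos) (C := C) fun s => ?_
  rw [phi_eq_polyGauss]
  exact h s

theorem memLp_weyl_phi (α : ℂ) (j : ℕ) : MemLp (P.weyl α (P.phi j)) 2 := by
  have h : MemLp (fun s => P.phi j (s - P.shiftLen α)) 2 :=
    (P.memLp_phi j).comp_measurePreserving (measurePreserving_sub_right volume _)
  exact h.of_le (P.continuous_weyl_phi α j).aestronglyMeasurable
    (Eventually.of_forall fun s => (norm_weylShift _ _ _ s).le)

theorem tendsto_displacement_phi (α : ℂ) (j : ℕ) :
    Tendsto (fun N : ℕ => eLpNorm (fun s : ℝ => P.displacement α (P.phi j) s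
        - ∑ r ∈ Finset.range N, P.displacementTerm α (P.phi j) r s) 2 volume) atTop (𝓝 0) := by
  obtain ⟨C, hC, h⟩ := P.exists_norm_displacementTerm_le α j
  set H : ℝ → ℂ := fun s => ((C * Real.exp (-(P.κ ^ 2 / 2) * s ^ 2) : ℝ) : ℂ) with hH
  have hHc : Continuous H := by fun_prop
  have hH2 : MemLp H 2 := by
    refine memLp_of_norm_le_gaussian hHc.aestronglyMeasurable (half_pos P.κ_sq_pos) (C := C)
      fun s => ?_
    rw [hH, Complex.norm_real, Real.norm_of_nonneg (by positivity)]
  have hb : ∀ N : ℕ, eLpNorm (fun s : ℝ => P.displacement α (P.phi j) s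
        - ∑ r ∈ Finset.range N, P.displacementTerm α (P.phi j) r s) 2 volume
        ≤ ENNReal.ofReal (2 * (1 / 2) ^ N) * eLpNorm H 2 volume := by
    intro N
    refine eLpNorm_le_mul_eLpNorm_of_ae_le_mul (Eventually.of_forall fun s => ?_) 2
    have hs := (hasSum_nat_add_iff' N).2 (P.hasSum_displacementTerm α j s)
    rw [displacement_phi, ← hs.tsum_eq]
    have hg : HasSum (fun k : ℕ => C * Real.exp (-(P.κ ^ 2 / 2) * s ^ 2) * (1 / 2) ^ (k + N))
        (C * Real.exp (-(P.κ ^ 2 / 2) * s ^ 2) * (1 / 2) ^ N * 2) := by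
      have := hasSum_geometric_two.mul_left (C * Real.exp (-(P.κ ^ 2 / 2) * s ^ 2) * (1 / 2) ^ N)
      convert! this using 2
      rw [pow_add]
      ring
    refine (tsum_of_norm_bounded hg fun k => h (k + N) s).trans (le_of_eq ?_)
    rw [hH, Complex.norm_real, Real.norm_of_nonneg (by positivity)]
    ring
  refine tendsto_of_tendsto_of_tendsto_of_le_of_le tendsto_const_nhds ?_
    (fun _ => zero_le) hb
  have h0 : Tendsto (fun N : ℕ => ENNReal.ofReal (2 * (1 / 2) ^ N)) atTop (𝓝 0) := by
    rw [← ENNReal.ofReal_zero]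
    refine ENNReal.tendsto_ofReal ?_
    simpa using (tendsto_pow_atTop_nhds_zero_of_lt_one (r := (1 / 2 : ℝ)) (by norm_num)
      (by norm_num)).const_mul 2
  simpa using ENNReal.Tendsto.mul_const h0 (Or.inr hH2.2.ne)

/-- With `shiftLen_alpha`, this explains the choice of `alpha`: `D(α_{n,m})` modulates by `exp(-i
G^v_{m,n} v)` and translates by `-A^0_n`. -/
theorem modFreq_alpha (n m : ℝ) : P.modFreq (P.alpha n m) = -P.Gv m n := by
  have h := P.κ_mul_η
  have : (P.alpha n m).im = -(P.η * P.Gv m n) := by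
    simp [alpha, η, Complex.mul_im]
  rw [modFreq, this]
  linear_combination (-2 * P.Gv m n) * h

theorem shiftLen_alpha (n m : ℝ) : P.shiftLen (P.alpha n m) = -P.A 0 n := by
  have h := P.κ_mul_η
  have : (P.alpha n m).re = -(P.κ * P.A 0 n) := by
    simp [alpha, κ, Complex.mul_re]
  rw [shiftLen, this]
  linear_combination (-2 * P.A 0 n) * h

theorem A_sub_A (kx n n' : ℝ) : P.A kx n - P.A kx n' = P.A 0 (n - n') := by
  simp only [A, Gx]
  ring

/-- Matrix elements of plane waves between shifted oscillator functions. -/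
theorem braket_planeWave (kx : ℝ) (n n' m m' : ℤ) (i j : ℕ) :
    braket (fun v => P.phi i (v - P.A kx n))
          (fun v => Complex.exp (-Complex.I *
            ((P.Gv ((m : ℝ) - m') ((n : ℝ) - n') * v : ℝ) : ℂ)) * P.phi j (v - P.A kx n')) =
        Complex.exp (-Complex.I * ((P.Gv ((m : ℝ) - m') ((n : ℝ) - n')
            * P.A kx (((n : ℝ) + n') / 2) : ℝ) : ℂ)) *
          P.displacementMatrix (P.alpha ((n : ℝ) - n') ((m : ℝ) - m')) i j := by
  rw [displacementMatrix, displacement_phi, braket, braket, ← integral_const_mul,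
    ← integral_add_right_eq_self _ (P.A kx n)]
  congr 1
  ext v
  rw [weyl, weylShift, modFreq_alpha, shiftLen_alpha, ← P.A_sub_A kx]
  have h1 : v + P.A kx n - P.A kx n' = v - -(P.A kx n - P.A kx n') := by ring
  rw [add_sub_cancel_right, h1]
  -- After centring at `A_n`, the phase is `-G (v + A_n)`. The Weyl translation by `-(A_n - A_n')`
  -- carries `-G v - G (A_n - A_n') / 2`, so the difference is the phase at the mean of the two
  -- centres.
  have h2 : P.A kx (((n : ℝ) + n') / 2) = (P.A kx n + P.A kx n') / 2 := by
    simp only [A, Gx]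
    ring
  have h3 : Complex.exp (-Complex.I * ((P.Gv ((m : ℝ) - m') ((n : ℝ) - n')
      * (v + P.A kx n) : ℝ) : ℂ)) = Complex.exp (-Complex.I * ((P.Gv ((m : ℝ) - m') ((n : ℝ) - n')
        * ((P.A kx n + P.A kx n') / 2) : ℝ) : ℂ)) * Complex.exp (Complex.I *
        ((-P.Gv ((m : ℝ) - m') ((n : ℝ) - n') * v - -P.Gv ((m : ℝ) - m') ((n : ℝ) - n')
          * -(P.A kx n - P.A kx n') / 2 : ℝ) : ℂ)) := by
    rw [← Complex.exp_add]
    congr 1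
    push_cast
    ring
  rw [h2, h3]
  ring

end Params

/-! ### Recursions for the matrix elements and their solution. -/

theorem memLp_polyGauss {c : ℝ} (hc : 0 < c) (p : Polynomial ℂ) :
    MemLp (fun s : ℝ => polyGauss c p s) 2 := by
  obtain ⟨C, -, h⟩ := exists_norm_polyGauss_real_le hc p
  exact memLp_of_norm_le_gaussian
    ((continuous_polyGauss c p).comp Complex.continuous_ofReal).aestronglyMeasurable
    (half_pos hc) h

theorem MemLp.integrable_conj_mul {α : Type*} [MeasurableSpace α] {μ : Measure α} {f g : α → ℂ}
    (hf : MemLp f 2 μ) (hg : MemLp g 2 μ) : Integrable (fun x => conj (f x) * g x) μ :=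
  hf.star.integrable_mul hg

namespace Params

variable (P : Params)

theorem differentiable_phi (j : ℕ) : Differentiable ℝ (P.phi j) :=
  (P.contDiff_phi j).differentiable (by simp)

theorem memLp_deriv_phi (j : ℕ) : MemLp (deriv (P.phi j)) 2 := by
  rw [phi_eq, deriv_polyGauss_real]
  exact memLp_polyGauss P.κ_sq_pos _

theorem memLp_mul_phi (j : ℕ) : MemLp (fun s : ℝ => (s : ℂ) * P.phi j s) 2 := by
  have h := memLp_polyGauss P.κ_sq_pos (Polynomial.X * P.phiPoly j)
  convert! h using 2 with s
  rw [phi_eq_polyGauss, polyGauss, polyGauss, Polynomial.eval_mul, Polynomial.eval_X, mul_assoc]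

theorem hasDerivAt_weyl (α : ℂ) {f : ℝ → ℂ} (hf : Differentiable ℝ f) (s : ℝ) :
    HasDerivAt (P.weyl α f) (Complex.I * P.modFreq α * P.weyl α f s + P.weyl α (deriv f) s) s :=
  hasDerivAt_weylShift _ _ (hf _).hasDerivAt

/-- Conjugation by `D(α)` adds constants to the ladder operators: `κ s` gains `κ` times the shift
length, that is `Re α`, and `η d/ds` gains `i η` times the frequency, that is `i Im α`. The sum
gives `α` for `b`, the difference gives `α*` for `b†`. -/
theorem raise_weyl (α : ℂ) {f : ℝ → ℂ} (hf : Differentiable ℝ f) (s : ℝ) :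
    P.raise (P.weyl α f) s = P.weyl α (P.raise f) s + conj α * P.weyl α f s := by
  rw [raise_eq, (P.hasDerivAt_weyl α hf s).deriv]
  have hk := P.κ_mul_η_complex
  have hα : conj α = α.re - Complex.I * α.im := by
    apply Complex.ext <;> simp
  simp only [weyl, weylShift, raise_eq, hα]
  generalize Complex.exp _ = x
  generalize f _ = y
  simp only [modFreq, shiftLen]
  push_cast
  linear_combination (2 * (α.re - Complex.I * α.im) * y * x) * hk

theorem lower_weyl (α : ℂ) {f : ℝ → ℂ} (hf : Differentiable ℝ f) (s : ℝ) :
    P.lower (P.weyl α f) s = P.weyl α (P.lower f) s + α * P.weyl α f s := by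
  rw [lower_eq, (P.hasDerivAt_weyl α hf s).deriv]
  have hk := P.κ_mul_η_complex
  have hα : α = α.re + Complex.I * α.im := by
    apply Complex.ext <;> simp
  rw [show α * P.weyl α f s = (α.re + Complex.I * α.im) * P.weyl α f s by rw [← hα]]
  simp only [weyl, weylShift, lower_eq]
  generalize Complex.exp _ = x
  generalize f _ = y
  simp only [modFreq, shiftLen]
  push_cast
  linear_combination (2 * (α.re + Complex.I * α.im) * y * x) * hk

theorem memLp_weyl (α : ℂ) {f : ℝ → ℂ} (hf : MemLp f 2) : MemLp (P.weyl α f) 2 := by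
  have h : MemLp (fun s => f (s - P.shiftLen α)) 2 :=
    hf.comp_measurePreserving (measurePreserving_sub_right volume _)
  have hm : AEStronglyMeasurable (P.weyl α f) := by
    refine AEStronglyMeasurable.mul ?_ h.aestronglyMeasurable
    exact Continuous.aestronglyMeasurable (by fun_prop)
  exact h.of_le hm (Eventually.of_forall fun s => (norm_weylShift _ _ _ s).le)

/-- The ladder operators are adjoint to each other. -/
theorem integral_conj_mul_deriv {f g g' : ℝ → ℂ} (hf : Differentiable ℝ f)
    (hg : ∀ s, HasDerivAt g (g' s) s)
    (hf2 : MemLp f 2) (hf2' : MemLp (deriv f) 2) (hg2 : MemLp g 2) (hg2' : MemLp g' 2) :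
    ∫ s, conj (f s) * g' s = -∫ s, conj (deriv f s) * g s :=
  integral_mul_deriv_eq_deriv_mul_of_integrable
    (fun s _ => (hf s).hasDerivAt.star) (fun s _ => hg s)
    (MemLp.integrable_conj_mul hf2 hg2') (MemLp.integrable_conj_mul hf2' hg2)
    (MemLp.integrable_conj_mul hf2 hg2)

theorem integrable_mul_conj_phi_mul {g : ℝ → ℂ} (i : ℕ) (hg : MemLp g 2) :
    Integrable (fun s : ℝ => (s : ℂ) * (conj (P.phi i s) * g s)) := by
  refine (MemLp.integrable_conj_mul (P.memLp_mul_phi i) hg).congr (Eventually.of_forall fun s => ?_)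
  simp only [map_mul, Complex.conj_ofReal]
  ring

/-- Adjointness of `b†` and `b`, needed for `g` a displaced Hermite function; the `L²` bounds on `g`
and `g'` make the boundary terms vanish. -/
theorem braket_raise {g g' : ℝ → ℂ} (i : ℕ)
    (hg : ∀ s, HasDerivAt g (g' s) s) (hg2 : MemLp g 2) (hg2' : MemLp g' 2) :
    braket (P.phi i) (P.raise g) = braket (P.lower (P.phi i)) g := by
  have h := integral_conj_mul_deriv (P.differentiable_phi i) hg (P.memLp_phi i)
    (P.memLp_deriv_phi i) hg2 hg2'
  have i1 := P.integrable_mul_conj_phi_mul i hg2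
  have i2 := MemLp.integrable_conj_mul (P.memLp_phi i) hg2'
  have i3 := MemLp.integrable_conj_mul (P.memLp_deriv_phi i) hg2
  calc braket (P.phi i) (P.raise g)
      = ∫ s : ℝ, ((P.κ : ℂ) * (s * (conj (P.phi i s) * g s))
          - P.η * (conj (P.phi i s) * g' s)) := by
        refine integral_congr_ae (Eventually.of_forall fun s => ?_)
        simp only [raise_eq, (hg s).deriv]
        push_cast
        ring
    _ = ∫ s : ℝ, ((P.κ : ℂ) * (s * (conj (P.phi i s) * g s))
          + P.η * (conj (deriv (P.phi i) s) * g s)) := by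
        rw [integral_sub (i1.const_mul _) (i2.const_mul _),
          integral_add (i1.const_mul _) (i3.const_mul _), integral_const_mul (P.η : ℂ),
          integral_const_mul (P.η : ℂ), h]
        ring
    _ = _ := by
        refine integral_congr_ae (Eventually.of_forall fun s => ?_)
        simp only [lower_eq, map_add, map_mul, Complex.conj_ofReal]
        push_cast
        ring

theorem braket_lower {g g' : ℝ → ℂ} (i : ℕ)
    (hg : ∀ s, HasDerivAt g (g' s) s) (hg2 : MemLp g 2) (hg2' : MemLp g' 2) :
    braket (P.phi i) (P.lower g) = braket (P.raise (P.phi i)) g := by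
  have h := integral_conj_mul_deriv (P.differentiable_phi i) hg (P.memLp_phi i)
    (P.memLp_deriv_phi i) hg2 hg2'
  have i1 := P.integrable_mul_conj_phi_mul i hg2
  have i2 := MemLp.integrable_conj_mul (P.memLp_phi i) hg2'
  have i3 := MemLp.integrable_conj_mul (P.memLp_deriv_phi i) hg2
  calc braket (P.phi i) (P.lower g)
      = ∫ s : ℝ, ((P.κ : ℂ) * (s * (conj (P.phi i s) * g s))
          + P.η * (conj (P.phi i s) * g' s)) := by
        refine integral_congr_ae (Eventually.of_forall fun s => ?_)
        simp only [lower_eq, (hg s).deriv]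
        push_cast
        ring
    _ = ∫ s : ℝ, ((P.κ : ℂ) * (s * (conj (P.phi i s) * g s))
          - P.η * (conj (deriv (P.phi i) s) * g s)) := by
        rw [integral_sub (i1.const_mul _) (i3.const_mul _),
          integral_add (i1.const_mul _) (i2.const_mul _), integral_const_mul (P.η : ℂ),
          integral_const_mul (P.η : ℂ), h]
        ring
    _ = _ := by
        refine integral_congr_ae (Eventually.of_forall fun s => ?_)
        simp only [raise_eq, map_sub, map_mul, Complex.conj_ofReal]
        push_cast
        ring

/-- The matrix elements of the Weyl operators. -/
noncomputable def weylMatrix (α : ℂ) (i j : ℕ) : ℂ := braket (P.phi i) (P.weyl α (P.phi j))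

theorem displacementMatrix_eq (α : ℂ) (i j : ℕ) :
    P.displacementMatrix α i j = P.weylMatrix α i j := by
  rw [displacementMatrix, displacement_phi, weylMatrix]

theorem memLp_deriv_weyl_phi (α : ℂ) (j : ℕ) :
    MemLp (fun s => Complex.I * P.modFreq α * P.weyl α (P.phi j) s
      + P.weyl α (deriv (P.phi j)) s) 2 :=
  ((P.memLp_weyl α (P.memLp_phi j)).const_mul _).add (P.memLp_weyl α (P.memLp_deriv_phi j))

/-- One of two evaluations of this bracket, by moving `b†` through `D(α)` to the right. Moving it to
the left instead, as `b` acting on `φ_i`, and comparing gives the recursions below. -/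
theorem braket_raise_weyl_phi (α : ℂ) (i j : ℕ) :
    braket (P.phi i) (P.raise (P.weyl α (P.phi j))) =
      (Real.sqrt (j + 1) : ℂ) * P.weylMatrix α i (j + 1) + conj α * P.weylMatrix α i j := by
  have h1 : P.raise (P.phi j) = fun s => (Real.sqrt (j + 1) : ℂ) * P.phi (j + 1) s :=
    funext (P.raise_phi j)
  have h2 : P.raise (P.weyl α (P.phi j)) = fun s => (Real.sqrt (j + 1) : ℂ)
      * P.weyl α (P.phi (j + 1)) s + conj α * P.weyl α (P.phi j) s := by
    ext s
    rw [raise_weyl P α (P.differentiable_phi j), h1, weyl, weylShift_const_mul]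
    rfl
  have i1 := MemLp.integrable_conj_mul (P.memLp_phi i) (P.memLp_weyl α (P.memLp_phi (j + 1)))
  have i2 := MemLp.integrable_conj_mul (P.memLp_phi i) (P.memLp_weyl α (P.memLp_phi j))
  rw [h2, weylMatrix, weylMatrix, braket, braket, braket, ← integral_const_mul,
    ← integral_const_mul, ← integral_add (i1.const_mul _) (i2.const_mul _)]
  congr 1
  ext s
  ring

theorem weylMatrix_zero_succ (α : ℂ) (j : ℕ) :
    (Real.sqrt (j + 1) : ℂ) * P.weylMatrix α 0 (j + 1) = -conj α * P.weylMatrix α 0 j := by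
  have h := P.braket_raise_weyl_phi α 0 j
  rw [P.braket_raise 0 (P.hasDerivAt_weyl α (P.differentiable_phi j))
    (P.memLp_weyl α (P.memLp_phi j)) (P.memLp_deriv_weyl_phi α j),
    show P.lower (P.phi 0) = fun _ => 0 from funext P.lower_phi_zero] at h
  simp only [braket, map_zero, zero_mul, integral_zero] at h
  linear_combination -h

theorem weylMatrix_succ_succ (α : ℂ) (i j : ℕ) :
    (Real.sqrt (j + 1) : ℂ) * P.weylMatrix α (i + 1) (j + 1)
      = (Real.sqrt (i + 1) : ℂ) * P.weylMatrix α i j - conj α * P.weylMatrix α (i + 1) j := by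
  have h := P.braket_raise_weyl_phi α (i + 1) j
  rw [P.braket_raise (i + 1) (P.hasDerivAt_weyl α (P.differentiable_phi j))
    (P.memLp_weyl α (P.memLp_phi j)) (P.memLp_deriv_weyl_phi α j),
    show P.lower (P.phi (i + 1)) = fun s => (Real.sqrt (i + 1) : ℂ) * P.phi i s from
      funext (P.lower_phi_succ i)] at h
  have h2 : braket (fun s => (Real.sqrt (i + 1) : ℂ) * P.phi i s) (P.weyl α (P.phi j))
      = (Real.sqrt (i + 1) : ℂ) * P.weylMatrix α i j := by
    rw [weylMatrix, braket, braket, ← integral_const_mul]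
    congr 1
    ext s
    rw [map_mul, Complex.conj_ofReal, mul_assoc]
  rw [h2] at h
  linear_combination -h

/-- `D(α) φ_0` is a coherent state, an eigenvector of `b` with eigenvalue `α`. -/
theorem weylMatrix_succ_zero (α : ℂ) (i : ℕ) :
    (Real.sqrt (i + 1) : ℂ) * P.weylMatrix α (i + 1) 0 = α * P.weylMatrix α i 0 := by
  have h := P.braket_lower i (P.hasDerivAt_weyl α (P.differentiable_phi 0))
    (P.memLp_weyl α (P.memLp_phi 0)) (P.memLp_deriv_weyl_phi α 0)
  rw [show P.raise (P.phi i) = fun s => (Real.sqrt (i + 1) : ℂ) * P.phi (i + 1) s from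
      funext (P.raise_phi i)] at h
  have h1 : P.lower (P.weyl α (P.phi 0)) = fun s => α * P.weyl α (P.phi 0) s := by
    ext s
    rw [lower_weyl P α (P.differentiable_phi 0),
      show P.lower (P.phi 0) = fun _ => 0 from funext P.lower_phi_zero]
    simp [weyl, weylShift]
  have h2 : braket (fun s => (Real.sqrt (i + 1) : ℂ) * P.phi (i + 1) s) (P.weyl α (P.phi 0))
      = (Real.sqrt (i + 1) : ℂ) * P.weylMatrix α (i + 1) 0 := by
    rw [weylMatrix, braket, braket, ← integral_const_mul]
    congr 1
    ext s
    rw [map_mul, Complex.conj_ofReal, mul_assoc]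
  have h3 : braket (P.phi i) (fun s => α * P.weyl α (P.phi 0) s) = α * P.weylMatrix α i 0 := by
    rw [weylMatrix, braket, braket, ← integral_const_mul]
    congr 1
    ext s
    ring
  rw [← h2, ← h, h1, h3]

theorem phi_zero (s : ℝ) : P.phi 0 s = (P.hermiteNorm : ℂ) * Complex.exp (-((P.κ : ℂ) ^ 2 * s ^ 2)) := by
  rw [phi_eq_polyGauss, polyGauss, phiPoly]
  simp

/-- The fourth power removes the real exponent `1/4`; its value is what cancels the Gaussian
integral in `weylMatrix_zero_zero`. -/
theorem hermiteNorm_sq_sq : (P.hermiteNorm ^ 2) ^ 2 = 2 * P.κ ^ 2 / Real.pi := by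
  have h1 := P.hbar_pos
  have h2 := mul_pos P.μ_pos P.Ω_pos
  have h3 := Real.pi_pos
  rw [hermiteNorm, ← pow_mul, ← Real.rpow_natCast, ← Real.rpow_mul (by positivity), κ_sq]
  norm_num
  field_simp

theorem weylMatrix_zero_zero (α : ℂ) :
    P.weylMatrix α 0 0 = (Real.exp (-(‖α‖ ^ 2) / 2) : ℂ) := by
  have hκ := P.κ_pos
  have hη := P.η_pos
  have hb : ((-2 * P.κ ^ 2 : ℝ) : ℂ).re < 0 := by
    rw [Complex.ofReal_re]
    nlinarith [P.κ_sq_pos]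
  -- The quadratic exponent collects `-κ² s²`, the Weyl phase and `-κ² (s - c)²`, with `c` the shift
  -- length.
  have h := integral_cexp_quadratic hb
    (2 * (P.κ : ℂ) ^ 2 * P.shiftLen α + Complex.I * P.modFreq α)
    (-(P.κ : ℂ) ^ 2 * P.shiftLen α ^ 2 - Complex.I * P.modFreq α * P.shiftLen α / 2)
  have h1 : P.weylMatrix α 0 0 = (P.hermiteNorm : ℂ) ^ 2 * ∫ x : ℝ, Complex.exp
      (((-2 * P.κ ^ 2 : ℝ) : ℂ) * x ^ 2
        + (2 * (P.κ : ℂ) ^ 2 * P.shiftLen α + Complex.I * P.modFreq α) * x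
        + (-(P.κ : ℂ) ^ 2 * P.shiftLen α ^ 2
          - Complex.I * P.modFreq α * P.shiftLen α / 2)) := by
    rw [weylMatrix, braket, ← integral_const_mul]
    congr 1
    ext s
    rw [conj_phi, weyl, weylShift, phi_zero, phi_zero]
    rw [show ((P.hermiteNorm : ℂ) * Complex.exp (-((P.κ : ℂ) ^ 2 * s ^ 2))) *
      (Complex.exp (Complex.I * ((P.modFreq α * s - P.modFreq α * P.shiftLen α / 2 : ℝ) : ℂ))
        * ((P.hermiteNorm : ℂ) * Complex.exp (-((P.κ : ℂ) ^ 2 * ((s - P.shiftLen α : ℝ) : ℂ) ^ 2))))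
      = (P.hermiteNorm : ℂ) ^ 2 * (Complex.exp (-((P.κ : ℂ) ^ 2 * s ^ 2)) *
        Complex.exp (Complex.I * ((P.modFreq α * s - P.modFreq α * P.shiftLen α / 2 : ℝ) : ℂ)) *
        Complex.exp (-((P.κ : ℂ) ^ 2 * ((s - P.shiftLen α : ℝ) : ℂ) ^ 2))) by ring]
    rw [← Complex.exp_add, ← Complex.exp_add]
    congr 2
    push_cast
    ring
  have h2 : (P.hermiteNorm : ℂ) ^ 2 * ((Real.pi : ℂ) / -((-2 * P.κ ^ 2 : ℝ) : ℂ)) ^ (1 / 2 : ℂ)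
      = 1 := by
    have hp : (Real.pi : ℂ) / -((-2 * P.κ ^ 2 : ℝ) : ℂ) = ((Real.pi / (2 * P.κ ^ 2) : ℝ) : ℂ) := by
      push_cast
      ring
    have hq : ((1 : ℂ) / 2) = ((1 / 2 : ℝ) : ℂ) := by push_cast; ring
    rw [hp, hq, ← Complex.ofReal_cpow (by positivity), ← Real.sqrt_eq_rpow, ← Complex.ofReal_pow,
      ← Complex.ofReal_mul, Complex.ofReal_eq_one]
    have hs : (P.hermiteNorm ^ 2 * Real.sqrt (Real.pi / (2 * P.κ ^ 2))) ^ 2 = 1 ^ 2 := by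
      rw [mul_pow, hermiteNorm_sq_sq, Real.sq_sqrt (by positivity)]
      have := Real.pi_pos
      field_simp
    exact (pow_left_inj₀ (by positivity) (by norm_num) two_ne_zero).1 hs
  rw [h1, h, ← mul_assoc, h2, one_mul, Complex.ofReal_exp]
  congr 1
  rw [Complex.sq_norm, Complex.normSq_apply]
  have hk := P.κ_mul_η_complex
  have hk0 : (P.κ : ℂ) ≠ 0 := by exact_mod_cast hκ.ne'
  simp only [shiftLen, modFreq]
  push_cast
  have hI := Complex.I_sq
  have hη2 : (P.η : ℂ) = 1 / (2 * P.κ) := by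
    field_simp
    linear_combination 2 * hk
  rw [hη2]
  field_simp
  ring_nf
  rw [hI]
  ring

end Params

/-- The polynomial part of the matrix elements of the displacement operator. -/
noncomputable def weylSum (α : ℂ) (i j : ℕ) : ℂ :=
  ∑ k ∈ Finset.range (j + 1),
    (i.choose k : ℂ) * (j.choose k : ℂ) * (k.factorial : ℂ) * α ^ (i - k) * (-conj α) ^ (j - k)

theorem weylSum_zero_right (α : ℂ) (i : ℕ) : weylSum α i 0 = α ^ i := by
  simp [weylSum]

theorem weylSum_zero_left (α : ℂ) (j : ℕ) : weylSum α 0 j = (-conj α) ^ j := by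
  rw [weylSum, Finset.sum_eq_single 0]
  · simp
  · intro k _ hk
    simp [Nat.choose_eq_zero_of_lt (Nat.pos_of_ne_zero hk)]
  · simp

/-- The recursion of `weylMatrix_succ_succ` without its square roots. Pascal's rule splits the
binomial in `j`; the first part is rewritten by the absorption identity `(k + 1) C(i + 1, k + 1) =
(i + 1) C(i, k)`, the second gives the term with `conj α`. -/
theorem weylSum_succ_succ (α : ℂ) (i j : ℕ) :
    weylSum α (i + 1) (j + 1) = (i + 1) * weylSum α i j - conj α * weylSum α (i + 1) j := by
  have h1 : weylSum α (i + 1) j = ∑ k ∈ Finset.range (j + 1 + 1),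
      ((i + 1).choose k : ℂ) * (j.choose k : ℂ) * (k.factorial : ℂ) * α ^ (i + 1 - k)
        * (-conj α) ^ (j - k) := by
    rw [Finset.sum_range_succ, Nat.choose_eq_zero_of_lt (Nat.lt_succ_self j), weylSum]
    simp
  rw [h1, Finset.sum_range_succ', weylSum, Finset.sum_range_succ', weylSum, mul_add,
    Finset.mul_sum, Finset.mul_sum, ← sub_sub, ← Finset.sum_sub_distrib]
  simp only [Nat.choose_zero_right, Nat.sub_zero, Nat.factorial_zero]
  have h0 : (-conj α) ^ (j + 1) = -conj α * (-conj α) ^ j := pow_succ' _ _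
  rw [h0, sub_eq_add_neg]
  congr 1
  · refine Finset.sum_congr rfl fun k hk => ?_
    have hk' : k ≤ j := Nat.lt_succ_iff.1 (Finset.mem_range.1 hk)
    have e1 : ((i + 1).choose (k + 1) : ℂ) * ((k + 1).factorial : ℂ)
        = (i + 1) * (i.choose k : ℂ) * (k.factorial : ℂ) := by
      have := Nat.add_one_mul_choose_eq i k
      rw [Nat.factorial_succ]
      have h : ((i : ℂ) + 1) * (i.choose k : ℂ) = ((i + 1).choose (k + 1) : ℂ) * (k + 1) := by
        exact_mod_cast this
      push_cast
      linear_combination (-(k.factorial : ℂ)) * h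
    have e2 : ((j + 1).choose (k + 1) : ℂ) = (j.choose k : ℂ) + (j.choose (k + 1) : ℂ) := by
      rw [Nat.choose_succ_succ]
      push_cast
      rfl
    have e3 : (j.choose (k + 1) : ℂ) * (-conj α) ^ (j - k)
        = -conj α * ((j.choose (k + 1) : ℂ) * (-conj α) ^ (j - (k + 1))) := by
      rcases hk'.eq_or_lt with rfl | hlt
      · simp
      · rw [show j - k = j - (k + 1) + 1 by omega, pow_succ]
        ring
    rw [Nat.add_sub_add_right, Nat.add_sub_add_right, e2]
    linear_combination (α ^ (i - k) * (-conj α) ^ (j - k) * (j.choose k : ℂ)) * e1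
      + ((i + 1).choose (k + 1) : ℂ) * ((k + 1).factorial : ℂ) * α ^ (i - k) * e3
  · ring

namespace Params

variable (P : Params)

theorem sqrt_factorial_succ (j : ℕ) : (Real.sqrt ((j + 1).factorial : ℝ) : ℂ)
    = (Real.sqrt (j + 1) : ℂ) * (Real.sqrt (j.factorial : ℝ) : ℂ) := by
  rw [← Complex.ofReal_mul, ← Real.sqrt_mul (by positivity), Nat.factorial_succ]
  push_cast
  rfl

/-- Multiplying by `√(i! j!)` clears the roots from the recursions; both sides then obey the same
recursions from the same value at `(0, 0)`. -/
theorem weylMatrix_eq (α : ℂ) (i j : ℕ) :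
    (Real.sqrt (i.factorial : ℝ) : ℂ) * (Real.sqrt (j.factorial : ℝ) : ℂ) * P.weylMatrix α i j
      = (Real.exp (-(‖α‖ ^ 2) / 2) : ℂ) * weylSum α i j := by
  have hsq : ∀ n : ℕ, (Real.sqrt ((n : ℝ) + 1) : ℂ) * (Real.sqrt ((n : ℝ) + 1) : ℂ) = n + 1 := by
    intro n
    rw [← Complex.ofReal_mul, Real.mul_self_sqrt (by positivity)]
    push_cast
    rfl
  induction j generalizing i with
  | zero =>
    induction i with
    | zero => simp [weylSum_zero_right, weylMatrix_zero_zero]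
    | succ i ih =>
      have h := P.weylMatrix_succ_zero α i
      rw [weylSum_zero_right] at ih ⊢
      rw [sqrt_factorial_succ, pow_succ α]
      linear_combination α * ih + (Real.sqrt (i.factorial : ℝ) : ℂ)
        * (Real.sqrt ((0 : ℕ).factorial : ℝ) : ℂ) * h
  | succ j ih =>
    cases i with
    | zero =>
      have h := P.weylMatrix_zero_succ α j
      have h' := ih 0
      rw [weylSum_zero_left] at h' ⊢
      rw [sqrt_factorial_succ, pow_succ (-conj α)]
      linear_combination -conj α * h' + (Real.sqrt ((0 : ℕ).factorial : ℝ) : ℂ)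
        * (Real.sqrt (j.factorial : ℝ) : ℂ) * h
    | succ i =>
      have h := P.weylMatrix_succ_succ α i j
      have h1 := ih i
      have h2 := ih (i + 1)
      have h3 := hsq i
      rw [sqrt_factorial_succ] at h2
      rw [weylSum_succ_succ, sqrt_factorial_succ, sqrt_factorial_succ]
      linear_combination ((Real.sqrt (i + 1) : ℂ) * (Real.sqrt (i.factorial : ℝ) : ℂ)
        * (Real.sqrt (j.factorial : ℝ) : ℂ)) * h + ((i : ℂ) + 1) * h1 - conj α * h2
        + ((Real.sqrt (i.factorial : ℝ) : ℂ)
        * (Real.sqrt (j.factorial : ℝ) : ℂ) * P.weylMatrix α i j) * h3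

theorem sqrt_factorial_ne_zero (j : ℕ) : (Real.sqrt (j.factorial : ℝ) : ℂ) ≠ 0 := by
  have : 0 < Real.sqrt (j.factorial : ℝ) := Real.sqrt_pos.2 (by positivity)
  exact_mod_cast this.ne'

end Params

/-- Reversing the summation by `k = j - r` pairs the powers as `α^{i-j} (α conj α)^r (-1)^r`, and
`C(j,k) k! = j! / r!`. -/
theorem weylSum_eq_laguerre (α : ℂ) {i j : ℕ} (h : j ≤ i) :
    weylSum α i j = (j.factorial : ℂ) * α ^ (i - j) * (laguerre j (i - j) (‖α‖ ^ 2) : ℂ) := by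
  rw [weylSum, laguerre, ← Finset.sum_range_reflect]
  push_cast
  rw [Finset.mul_sum]
  refine Finset.sum_congr rfl fun r hr => ?_
  have hr' : r ≤ j := Nat.lt_succ_iff.1 (Finset.mem_range.1 hr)
  rw [Nat.sub_sub_self hr', Nat.choose_symm hr',
    show i - (j - r) = (i - j) + r by omega, show j + (i - j) = i by omega]
  have h1 : (j.choose r : ℂ) * ((j - r).factorial : ℂ) * (r.factorial : ℂ) = j.factorial := by
    rw [mul_right_comm]
    exact_mod_cast Nat.choose_mul_factorial_mul_factorial hr'
  have h2 : (‖α‖ : ℂ) ^ 2 = α * conj α := (Complex.mul_conj' α).symm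
  have h3 : (r.factorial : ℂ) ≠ 0 := by exact_mod_cast r.factorial_ne_zero
  rw [h2, ← h1, pow_add, neg_pow, mul_pow]
  field_simp

/-- Exchanging `i` and `j` exchanges `α` and `-conj α` in the sum, once the terms with `k > i`,
which vanish, are dropped. -/
theorem weylSum_eq_conj (α : ℂ) {i j : ℕ} (h : i < j) :
    weylSum α i j = (-1) ^ (j - i) * conj (weylSum α j i) := by
  have h1 : weylSum α i j = ∑ k ∈ Finset.range (i + 1),
      (i.choose k : ℂ) * (j.choose k : ℂ) * (k.factorial : ℂ) * α ^ (i - k)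
        * (-conj α) ^ (j - k) := by
    rw [weylSum]
    symm
    refine Finset.sum_subset (Finset.range_subset_range.2 (by omega)) fun k _ hk => ?_
    rw [Nat.choose_eq_zero_of_lt (by simpa using hk)]
    simp
  rw [h1, weylSum, map_sum, Finset.mul_sum]
  refine Finset.sum_congr rfl fun k hk => ?_
  have hk' : k ≤ i := Nat.lt_succ_iff.1 (Finset.mem_range.1 hk)
  simp only [map_mul, map_pow, map_neg, Complex.conj_conj, Complex.conj_natCast]
  rw [neg_pow (conj α), neg_pow α, show j - k = (j - i) + (i - k) by omega, pow_add (-1 : ℂ)]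
  have h4 : ((-1 : ℂ) ^ (i - k)) * (-1) ^ (i - k) = 1 := by
    rw [← mul_pow]
    simp
  ring

namespace Params

variable (P : Params)

theorem displacementMatrix_of_le (α : ℂ) (i j : ℕ) (h : j ≤ i) :
    P.displacementMatrix α i j =
        (Real.sqrt ((j.factorial : ℝ) / (i.factorial : ℝ)) : ℂ) * α ^ (i - j) *
          (Real.exp (-(‖α‖ ^ 2) / 2) : ℂ) * (laguerre j (i - j) (‖α‖ ^ 2) : ℂ) := by
  have h1 := P.weylMatrix_eq α i j
  have hi := sqrt_factorial_ne_zero i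
  have hj := sqrt_factorial_ne_zero j
  have hj2 : (Real.sqrt (j.factorial : ℝ) : ℂ) * (Real.sqrt (j.factorial : ℝ) : ℂ)
      = j.factorial := by
    rw [← Complex.ofReal_mul, Real.mul_self_sqrt (by positivity)]
    push_cast
    rfl
  rw [weylSum_eq_laguerre α h, ← hj2] at h1
  rw [displacementMatrix_eq, Real.sqrt_div (by positivity)]
  generalize ((Real.exp (-‖α‖ ^ 2 / 2) : ℝ) : ℂ) = x at h1 ⊢
  push_cast at h1 ⊢
  field_simp
  apply mul_left_cancel₀ hj
  linear_combination h1

theorem displacementMatrix_of_lt (α : ℂ) (i j : ℕ) (h : i < j) :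
    P.displacementMatrix α i j = (-1) ^ (j - i) * conj (P.displacementMatrix α j i) := by
  have h1 := P.weylMatrix_eq α i j
  have h2 := congrArg conj (P.weylMatrix_eq α j i)
  rw [weylSum_eq_conj α h] at h1
  simp only [map_mul, Complex.conj_ofReal] at h2
  rw [displacementMatrix_eq, displacementMatrix_eq]
  apply mul_left_cancel₀ (mul_ne_zero (sqrt_factorial_ne_zero i) (sqrt_factorial_ne_zero j))
  linear_combination h1 - (-1) ^ (j - i) * h2

theorem weyl_zero (f : ℝ → ℂ) : P.weyl 0 f = f := by
  ext s
  simp [weyl, weylShift, modFreq, shiftLen]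

/-- Orthonormality is the case `α = 0` of the formula for the matrix elements: `D(0) = 1`, and a
term of the sum survives only for `k = i = j`. -/
theorem braket_phi (i j : ℕ) : braket (P.phi i) (P.phi j) = if i = j then 1 else 0 := by
  have h := P.weylMatrix_eq 0 i j
  rw [weylMatrix, weyl_zero] at h
  have hi := sqrt_factorial_ne_zero i
  have hj := sqrt_factorial_ne_zero j
  apply mul_left_cancel₀ (mul_ne_zero hi hj)
  rw [h]
  have hs : weylSum 0 i j = if i = j then (i.factorial : ℂ) else 0 := by
    rw [weylSum]
    split_ifs with hij
    · subst hij
      rw [Finset.sum_eq_single i]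
      · simp
      · intro k hk hki
        have : i - k ≠ 0 := by
          have := Finset.mem_range.1 hk
          omega
        simp [this]
      · simp
    · refine Finset.sum_eq_zero fun k _ => ?_
      rcases lt_or_ge i k with h1 | h1
      · simp [Nat.choose_eq_zero_of_lt h1]
      rcases lt_or_ge j k with h2 | h2
      · simp [Nat.choose_eq_zero_of_lt h2]
      rcases h1.eq_or_lt with rfl | h3
      · have : j - k ≠ 0 := by omega
        simp [this]
      · have : i - k ≠ 0 := by omega
        simp [this]
  rw [hs]
  split_ifs with hij
  · subst hij
    rw [← Complex.ofReal_mul, Real.mul_self_sqrt (by positivity)]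
    simp
  · simp

end Params

/-! ### Completeness in `L²` and products of complete families. -/

section L2

variable {X Y : Type*} [MeasurableSpace X] [MeasurableSpace Y]

theorem inner_toLp {μ : Measure X} {f g : X → ℂ} (hf : MemLp f 2 μ) (hg : MemLp g 2 μ) :
    inner ℂ (hf.toLp f) (hg.toLp g) = ∫ x, conj (f x) * g x ∂μ := by
  rw [L2.inner_def]
  refine integral_congr_ae ?_
  filter_upwards [hf.coeFn_toLp, hg.coeFn_toLp] with x h1 h2
  rw [h1, h2, RCLike.inner_apply, mul_comm]

theorem norm_toLp_sq {μ : Measure X} {f : X → ℂ} (hf : MemLp f 2 μ) :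
    ‖hf.toLp f‖ ^ 2 = ∫ x, ‖f x‖ ^ 2 ∂μ := by
  have h := inner_toLp hf hf
  rw [inner_self_eq_norm_sq_to_K] at h
  have h2 : ∫ x, conj (f x) * f x ∂μ = ((∫ x, ‖f x‖ ^ 2 ∂μ : ℝ) : ℂ) := by
    rw [← integral_complex_ofReal]
    refine integral_congr_ae (Eventually.of_forall fun x => ?_)
    simp only [Complex.conj_mul']
    push_cast
    rfl
  rw [h2, RCLike.ofReal_eq_complex_ofReal] at h
  exact_mod_cast h

theorem norm_integral_conj_mul_sq_le {μ : Measure X} {f g : X → ℂ} (hf : MemLp f 2 μ)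
    (hg : MemLp g 2 μ) :
    ‖∫ x, conj (f x) * g x ∂μ‖ ^ 2 ≤ (∫ x, ‖f x‖ ^ 2 ∂μ) * ∫ x, ‖g x‖ ^ 2 ∂μ := by
  rw [← inner_toLp hf hg, ← norm_toLp_sq hf, ← norm_toLp_sq hg, ← mul_pow]
  gcongr
  exact norm_inner_le_norm _ _

theorem memLp_two_mul_prod {μ : Measure Y} {ν : Measure X} [SFinite μ] [SFinite ν]
    {g : Y → ℂ} {f : X → ℂ} (hg : MemLp g 2 μ) (hf : MemLp f 2 ν) :
    MemLp (fun z : Y × X => g z.1 * f z.2) 2 (μ.prod ν) := by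
  have hm : AEStronglyMeasurable (fun z : Y × X => g z.1 * f z.2) (μ.prod ν) :=
    (hg.1.comp_quasiMeasurePreserving Measure.quasiMeasurePreserving_fst).mul
      (hf.1.comp_quasiMeasurePreserving Measure.quasiMeasurePreserving_snd)
  rw [memLp_two_iff_integrable_sq_norm hm]
  have h1 := (memLp_two_iff_integrable_sq_norm hg.1).1 hg
  have h2 := (memLp_two_iff_integrable_sq_norm hf.1).1 hf
  refine (h1.mul_prod h2).congr (Eventually.of_forall fun z => ?_)
  simp only [norm_mul, mul_pow]

/-- A family of functions separates `L²` if only the zero class is orthogonal to all of them. -/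
def SeparatesL2 {ι : Type*} (μ : Measure X) (f : ι → X → ℂ) : Prop :=
  ∀ h : X → ℂ, MemLp h 2 μ → (∀ a, ∫ x, conj (f a x) * h x ∂μ = 0) → h =ᵐ[μ] 0

/-- The second family may depend on the index `a` of the first, as the oscillator shift depends on
the plane wave. For fixed `a`, the function `y ↦ ⟨f_a, h(y, ·)⟩` is in `L²` by Cauchy–Schwarz and
orthogonal to all `g_{a,b}`, so it vanishes almost everywhere. Countability of `ι` gives one null
set for all `a`, outside of which `h(y, ·) = 0`. -/
theorem SeparatesL2.prod {ι β : Type*} [Countable ι] {μ : Measure Y} {ν : Measure X}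
    [SFinite μ] [SFinite ν] {f : ι → X → ℂ} {g : ι → β → Y → ℂ}
    (hf : ∀ a, MemLp (f a) 2 ν) (hg : ∀ a b, MemLp (g a b) 2 μ)
    (hsf : SeparatesL2 ν f) (hsg : ∀ a, SeparatesL2 μ (g a)) :
    SeparatesL2 (μ.prod ν) (fun (c : ι × β) (z : Y × X) => g c.1 c.2 z.1 * f c.1 z.2) := by
  intro h hh horth
  have hsq := (memLp_two_iff_integrable_sq_norm hh.1).1 hh
  have hsec : ∀ᵐ y ∂μ, MemLp (fun x => h (y, x)) 2 ν := by
    filter_upwards [hsq.prod_right_ae, hh.1.prodMk_left] with y h1 h2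
    exact (memLp_two_iff_integrable_sq_norm h2).2 h1
  have hH : ∀ a, MemLp (fun y => ∫ x, conj (f a x) * h (y, x) ∂ν) 2 μ := by
    intro a
    have hm : AEStronglyMeasurable (fun z : Y × X => conj (f a z.2) * h z) (μ.prod ν) :=
      ((hf a).1.star.comp_quasiMeasurePreserving Measure.quasiMeasurePreserving_snd).mul hh.1
    have hm2 : AEStronglyMeasurable (fun y => ∫ x, conj (f a x) * h (y, x) ∂ν) μ :=
      hm.integral_prod_right'
    rw [memLp_two_iff_integrable_sq_norm hm2]
    refine (hsq.integral_prod_left.const_mul (∫ x, ‖f a x‖ ^ 2 ∂ν)).mono' (hm2.norm.pow 2) ?_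
    filter_upwards [hsec] with y hy
    rw [Real.norm_of_nonneg (by positivity)]
    exact norm_integral_conj_mul_sq_le (hf a) hy
  have hz : ∀ᵐ y ∂μ, ∀ a, ∫ x, conj (f a x) * h (y, x) ∂ν = 0 := by
    rw [ae_all_iff]
    intro a
    refine hsg a _ (hH a) fun b => ?_
    rw [← horth (a, b)]
    have hint := MemLp.integrable_conj_mul (memLp_two_mul_prod (hg a b) (hf a)) hh
    rw [integral_prod _ hint]
    refine integral_congr_ae (Eventually.of_forall fun y => ?_)
    simp only [map_mul, mul_assoc]
    exact (integral_const_mul _ _).symm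
  have h0 : ∫ z, ‖h z‖ ^ 2 ∂(μ.prod ν) = 0 := by
    rw [integral_prod _ hsq]
    refine integral_eq_zero_of_ae ?_
    filter_upwards [hsec, hz] with y h1 h2
    refine integral_eq_zero_of_ae ?_
    filter_upwards [hsf _ h1 h2] with x hx
    simp [hx]
  have h1 := (integral_eq_zero_iff_of_nonneg (fun z => by positivity) hsq).1 h0
  filter_upwards [h1] with z hz
  simpa using hz

end L2

/-! ### Completeness of the exponentials and of the Hermite functions. -/

section Fourier

open FourierTransform

/-- Injectivity of the Fourier transform on integrable functions. -/
theorem ae_eq_zero_of_fourier_eq_zero {F : ℝ → ℂ} (hF : Integrable F)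
    (h : ∀ t : ℝ, ∫ s : ℝ, Complex.exp (Complex.I * ((t * s : ℝ) : ℂ)) * F s = 0) :
    F =ᵐ[volume] 0 := by
  have h0 : 𝓕 F = 0 := by
    ext t
    rw [Real.fourier_eq', Pi.zero_apply, ← h (-2 * Real.pi * t)]
    refine integral_congr_ae (Eventually.of_forall fun s => ?_)
    simp only [smul_eq_mul]
    congr 2
    simp
    ring
  refine ae_eq_zero_of_integral_contDiff_smul_eq_zero hF.locallyIntegrable fun g hg hgc => ?_
  have hg₁ : HasCompactSupport (Complex.ofRealCLM ∘ g) := hgc.comp_left rfl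
  have hg₂ : ContDiff ℝ ∞ (Complex.ofRealCLM ∘ g) := by fun_prop
  set G : SchwartzMap ℝ ℂ := hg₁.toSchwartzMap hg₂ with hG
  have h1 : 𝓕 (𝓕⁻ G) = G := fourier_fourierInv_eq G
  -- Every test function is the Fourier transform of a Schwartz function, and the transform may be
  -- moved from that function onto `F`, where it vanishes.
  have h2 := VectorFourier.integral_fourierIntegral_smul_eq_flip (L := innerₗ ℝ)
      Real.continuous_fourierChar continuous_inner (𝓕⁻ G).integrable hF (μ := volume) (ν := volume)
  have h3 : VectorFourier.fourierIntegral Real.fourierChar volume (innerₗ ℝ).flip F = 𝓕 F := by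
    rw [flip_innerₗ]
    rfl
  have h4 : VectorFourier.fourierIntegral Real.fourierChar volume (innerₗ ℝ) (𝓕⁻ G : SchwartzMap ℝ ℂ)
      = G := by
    conv_rhs => rw [← h1]
    rfl
  rw [h3, h4, h0] at h2
  simpa [hG] using h2

/-- Parseval's identity: if all Fourier coefficients vanish, so does the `L²` norm. -/
theorem fourierExp_separatesL2 :
    SeparatesL2 (volume.restrict (Set.Ico (0 : ℝ) 1))
      (fun (n : ℤ) (t : ℝ) => Complex.exp (Complex.I * ((2 * Real.pi * (n * t) : ℝ) : ℂ))) := by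
  intro h hh horth
  rw [restrict_Ico_eq_restrict_Ioc] at hh horth ⊢
  have h1 := hasSum_sq_fourierCoeffOn (zero_lt_one' ℝ) hh
  have h2 : ∀ n : ℤ, fourierCoeffOn (zero_lt_one' ℝ) h n = 0 := by
    intro n
    rw [fourierCoeffOn_eq_integral, intervalIntegral.integral_of_le zero_le_one]
    rw [← smul_zero (A := ℂ) (1 / (1 - 0 : ℝ)), ← horth n]
    congr 1
    refine integral_congr_ae (Eventually.of_forall fun t => ?_)
    simp only [smul_eq_mul]
    congr 1
    rw [fourier_coe_apply, ← Complex.exp_conj]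
    congr 1
    simp only [map_mul, Complex.conj_I, Complex.conj_ofReal]
    push_cast
    ring
  simp only [h2, norm_zero] at h1
  have h3 : ∫ x in Set.Ioc (0 : ℝ) 1, ‖h x‖ ^ 2 = 0 := by
    have := h1.unique (by simp : HasSum (fun _ : ℤ => (0 : ℝ) ^ 2) 0)
    rw [intervalIntegral.integral_of_le zero_le_one] at this
    simpa using this
  have h4 := (integral_eq_zero_iff_of_nonneg (fun z => by positivity)
    ((memLp_two_iff_integrable_sq_norm hh.1).1 hh)).1 h3
  filter_upwards [h4] with z hz
  simpa using hz

end Fourier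

namespace Params

variable (P : Params)

theorem degree_phiPoly (j : ℕ) : (P.phiPoly j).degree = j := by
  have hκ : ((2 * P.κ : ℝ) : ℂ) ≠ 0 := by
    have := P.κ_pos
    exact_mod_cast (by positivity : (2 * P.κ) ≠ 0)
  have hN : 0 < P.hermiteNorm :=
    Real.rpow_pos_of_pos (div_pos (mul_pos P.μ_pos P.Ω_pos) (mul_pos Real.pi_pos P.hbar_pos)) _
  have hc : ((P.hermiteNorm / Real.sqrt (j.factorial : ℝ) : ℝ) : ℂ) ≠ 0 := by
    have : 0 < Real.sqrt (j.factorial : ℝ) := Real.sqrt_pos.2 (by positivity)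
    exact_mod_cast (by positivity : P.hermiteNorm / Real.sqrt (j.factorial : ℝ) ≠ 0)
  rw [phiPoly, Polynomial.degree_C_mul hc, Polynomial.degree_eq_natDegree, Polynomial.natDegree_comp,
    Polynomial.natDegree_C_mul_X _ hκ, mul_one,
    (Polynomial.hermite_monic j).natDegree_map, Polynomial.natDegree_hermite]
  intro h0
  have h1 := Polynomial.comp_eq_zero_iff.1 h0
  rcases h1 with h1 | ⟨-, h1⟩
  · exact ((Polynomial.hermite_monic j).map (Int.castRingHom ℂ)).ne_zero h1
  · have h2 := congrArg (fun p => Polynomial.coeff p 1) h1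
    simp at h2
    exact P.κ_pos.ne' h2

/-- The polynomial factors of the `φ_j` contain exactly one polynomial of each degree, hence span
all polynomials. -/
theorem integral_polyGauss_mul_eq_zero {h : ℝ → ℂ} (hh : MemLp h 2)
    (horth : ∀ j, ∫ s, conj (P.phi j s) * h s = 0) (p : Polynomial ℂ) :
    ∫ s : ℝ, polyGauss (P.κ ^ 2) p s * h s = 0 := by
  have hi : ∀ q : Polynomial ℂ, Integrable (fun s : ℝ => polyGauss (P.κ ^ 2) q s * h s) :=
    fun q => (memLp_polyGauss P.κ_sq_pos q).integrable_mul hh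
  let S : Polynomial.Sequence ℂ := ⟨P.phiPoly, P.degree_phiPoly⟩
  have hS := S.span fun i => (Polynomial.leadingCoeff_ne_zero.2 (S.ne_zero i)).isUnit
  have hp : p ∈ Submodule.span ℂ (Set.range S) := by rw [hS]; trivial
  induction hp using Submodule.span_induction with
  | mem x hx =>
    obtain ⟨j, rfl⟩ := hx
    rw [← horth j]
    refine integral_congr_ae (Eventually.of_forall fun s => ?_)
    simp only [conj_phi]
    rw [phi_eq_polyGauss]
  | zero => simp [polyGauss]
  | add x y _ _ hx hy =>
    rw [← add_zero (0 : ℂ)]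
    nth_rewrite 1 [← hx]
    rw [← hy, ← integral_add (hi x) (hi y)]
    congr 1
    ext s
    simp only [polyGauss, Polynomial.eval_add]
    ring
  | smul a x _ hx =>
    rw [← mul_zero a, ← hx, ← integral_const_mul]
    congr 1
    ext s
    simp only [polyGauss, Polynomial.eval_smul, smul_eq_mul]
    ring

/-- Completeness of the Hermite functions. -/
theorem phi_separatesL2 : SeparatesL2 volume P.phi := by
  intro h hh horth
  set G : ℝ → ℂ := fun s => polyGauss (P.κ ^ 2) 1 s * h s with hG
  have hGi : Integrable G := (memLp_polyGauss P.κ_sq_pos 1).integrable_mul hh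
  have hz : G =ᵐ[volume] 0 := by
    refine ae_eq_zero_of_fourier_eq_zero hGi fun t => ?_
    -- The Fourier transform of `G` is expanded in moments, all of which vanish. The exchange is
    -- dominated by `exp(|t s|) ‖G s‖`, integrable because the Gaussian beats the exponential.
    have hs : HasSum (fun n : ℕ => ∫ s : ℝ, (Complex.I * ((t * s : ℝ) : ℂ)) ^ n / n.factorial * G s)
        (∫ s : ℝ, Complex.exp (Complex.I * ((t * s : ℝ) : ℂ)) * G s) := by
      have hb : ∀ s : ℝ, HasSum (fun n : ℕ => |t * s| ^ n / n.factorial * ‖G s‖)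
          (Real.exp |t * s| * ‖G s‖) := by
        intro s
        have := NormedSpace.expSeries_div_hasSum_exp (|t * s| : ℝ)
        rw [← Real.exp_eq_exp_ℝ] at this
        exact this.mul_right _
      refine hasSum_integral_of_dominated_convergence
        (fun n s => |t * s| ^ n / n.factorial * ‖G s‖) (fun n => ?_)
        (fun n => Eventually.of_forall fun s => ?_)
        (Eventually.of_forall fun s => (hb s).summable) ?_ (Eventually.of_forall fun s => ?_)
      · refine AEStronglyMeasurable.mul ?_ hGi.1
        exact Continuous.aestronglyMeasurable (by fun_prop)
      · rw [norm_mul, norm_div, norm_pow, norm_mul, Complex.norm_I, one_mul, Complex.norm_real,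
          Real.norm_eq_abs, Complex.norm_natCast]
      · simp only [fun s => (hb s).tsum_eq]
        obtain ⟨C, hC, hb⟩ := exists_norm_polyGauss_le P.κ_sq_pos 1 0 |t|
        have hm : MemLp (fun s : ℝ => (Real.exp (|t| * |s|) : ℂ) * polyGauss (P.κ ^ 2) 1 s) 2 := by
          refine memLp_of_norm_le_gaussian (C := C) (Continuous.aestronglyMeasurable ?_)
            (half_pos P.κ_sq_pos) fun s => ?_
          · exact (by fun_prop : Continuous fun s : ℝ => (Real.exp (|t| * |s|) : ℂ)).mul
              ((continuous_polyGauss _ _).comp Complex.continuous_ofReal)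
          · rw [norm_mul, Complex.norm_real, Real.norm_of_nonneg (by positivity)]
            simpa using hb s 0 (by simp)
        refine (hm.integrable_mul hh).norm.congr (Eventually.of_forall fun s => ?_)
        simp only [hG, Pi.mul_apply, norm_mul, Complex.norm_real, Real.norm_eq_abs, Real.abs_exp, abs_mul]
        ring
      · have := NormedSpace.expSeries_div_hasSum_exp (Complex.I * ((t * s : ℝ) : ℂ))
        rw [← Complex.exp_eq_exp_ℂ] at this
        exact this.mul_right _
    have hn : ∀ n : ℕ,
        ∫ s : ℝ, (Complex.I * ((t * s : ℝ) : ℂ)) ^ n / n.factorial * G s = 0 := by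
      intro n
      have := P.integral_polyGauss_mul_eq_zero hh horth (Polynomial.X ^ n)
      rw [← mul_zero ((Complex.I * (t : ℂ)) ^ n / n.factorial), ← this, ← integral_const_mul]
      congr 1
      ext s
      simp only [hG, polyGauss, Polynomial.eval_pow, Polynomial.eval_X, Polynomial.eval_one]
      push_cast
      ring
    simp only [hn] at hs
    exact hs.unique hasSum_zero
  filter_upwards [hz] with s hs
  simpa [hG, polyGauss, Complex.exp_ne_zero] using hs

end Params

/-! ### Partial derivatives and the passage to polaritonic coordinates. -/

section Partial

/-- The standard basis vectors of configuration space. -/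
def e1 : Config := (1, 0, 0, 0)
/-- The second standard basis vector. -/
def e2 : Config := (0, 1, 0, 0)
/-- The third standard basis vector. -/
def e3 : Config := (0, 0, 1, 0)
/-- The fourth standard basis vector. -/
def e4 : Config := (0, 0, 0, 1)

theorem hasDerivAt_line {f : Config → ℂ} {p : Config} (hf : DifferentiableAt ℝ f p)
    {c : ℝ → Config} {e : Config} {t : ℝ} (hc : HasDerivAt c e t) (hp : c t = p) :
    deriv (fun s => f (c s)) t = fderiv ℝ f p e := by
  subst hp
  exact (hf.hasFDerivAt.comp_hasDerivAt t hc).deriv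

theorem partial1_eq_fderiv {f : Config → ℂ} {p : Config} (hf : DifferentiableAt ℝ f p) :
    partial1 f p = fderiv ℝ f p e1 :=
  hasDerivAt_line hf (c := fun t : ℝ => ((t, p.2.1, p.2.2.1, p.2.2.2) : Config))
    ((hasDerivAt_id _).prodMk ((hasDerivAt_const _ _).prodMk
      ((hasDerivAt_const _ _).prodMk (hasDerivAt_const _ _)))) rfl

theorem partial2_eq_fderiv {f : Config → ℂ} {p : Config} (hf : DifferentiableAt ℝ f p) :
    partial2 f p = fderiv ℝ f p e2 :=
  hasDerivAt_line hf (c := fun t : ℝ => ((p.1, t, p.2.2.1, p.2.2.2) : Config))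
    ((hasDerivAt_const _ _).prodMk ((hasDerivAt_id _).prodMk
      ((hasDerivAt_const _ _).prodMk (hasDerivAt_const _ _)))) rfl

theorem partial3_eq_fderiv {f : Config → ℂ} {p : Config} (hf : DifferentiableAt ℝ f p) :
    partial3 f p = fderiv ℝ f p e3 :=
  hasDerivAt_line hf (c := fun t : ℝ => ((p.1, p.2.1, t, p.2.2.2) : Config))
    ((hasDerivAt_const _ _).prodMk ((hasDerivAt_const _ _).prodMk
      ((hasDerivAt_id _).prodMk (hasDerivAt_const _ _)))) rfl

theorem partial4_eq_fderiv {f : Config → ℂ} {p : Config} (hf : DifferentiableAt ℝ f p) :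
    partial4 f p = fderiv ℝ f p e4 :=
  hasDerivAt_line hf (c := fun t : ℝ => ((p.1, p.2.1, p.2.2.1, t) : Config))
    ((hasDerivAt_const _ _).prodMk ((hasDerivAt_const _ _).prodMk
      ((hasDerivAt_const _ _).prodMk (hasDerivAt_id _)))) rfl

theorem contDiff_fderiv_apply {f : Config → ℂ} {m n : WithTop ℕ∞} (hf : ContDiff ℝ n f)
    (h : m + 1 ≤ n) (e : Config) : ContDiff ℝ m (fun p => fderiv ℝ f p e) :=
  (hf.fderiv_right h).clm_apply contDiff_const

variable {f : Config → ℂ} {m n : WithTop ℕ∞}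

theorem differentiable_of_succ_le (hf : ContDiff ℝ n f) (h : m + 1 ≤ n) : Differentiable ℝ f :=
  hf.differentiable (by
    rintro rfl
    simp at h)

theorem partial1_eq (hf : Differentiable ℝ f) : partial1 f = fun p => fderiv ℝ f p e1 :=
  funext fun p => partial1_eq_fderiv (hf p)

theorem partial2_eq (hf : Differentiable ℝ f) : partial2 f = fun p => fderiv ℝ f p e2 :=
  funext fun p => partial2_eq_fderiv (hf p)

theorem partial3_eq (hf : Differentiable ℝ f) : partial3 f = fun p => fderiv ℝ f p e3 :=
  funext fun p => partial3_eq_fderiv (hf p)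

theorem partial4_eq (hf : Differentiable ℝ f) : partial4 f = fun p => fderiv ℝ f p e4 :=
  funext fun p => partial4_eq_fderiv (hf p)

theorem contDiff_partial1 (hf : ContDiff ℝ n f) (h : m + 1 ≤ n) : ContDiff ℝ m (partial1 f) := by
  rw [partial1_eq (differentiable_of_succ_le hf h)]
  exact contDiff_fderiv_apply hf h e1

theorem contDiff_partial2 (hf : ContDiff ℝ n f) (h : m + 1 ≤ n) : ContDiff ℝ m (partial2 f) := by
  rw [partial2_eq (differentiable_of_succ_le hf h)]
  exact contDiff_fderiv_apply hf h e2

theorem contDiff_partial3 (hf : ContDiff ℝ n f) (h : m + 1 ≤ n) : ContDiff ℝ m (partial3 f) := by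
  rw [partial3_eq (differentiable_of_succ_le hf h)]
  exact contDiff_fderiv_apply hf h e3

theorem contDiff_partial4 (hf : ContDiff ℝ n f) (h : m + 1 ≤ n) : ContDiff ℝ m (partial4 f) := by
  rw [partial4_eq (differentiable_of_succ_le hf h)]
  exact contDiff_fderiv_apply hf h e4

theorem fderiv_comp_equiv {F : Config → ℂ} (L : Config ≃L[ℝ] Config) (hF : Differentiable ℝ F)
    (p e : Config) : fderiv ℝ (F ∘ L) p e = fderiv ℝ F (L p) (L e) := by
  rw [fderiv_comp p (hF _) L.differentiableAt, ContinuousLinearMap.comp_apply,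
    ContinuousLinearEquiv.fderiv, ContinuousLinearEquiv.coe_coe]

end Partial

namespace Params

variable (P : Params)

/-- The scale `√(ℏ ωₚ / mₑ)` of the photon coordinate. -/
noncomputable def uScale : ℝ := Real.sqrt (P.hbar * P.ωp / P.me)

theorem uScale_pos : 0 < P.uScale :=
  Real.sqrt_pos.2 (div_pos (mul_pos P.hbar_pos P.ωp_pos) P.me_pos)

theorem uScale_sq : P.uScale ^ 2 = P.hbar * P.ωp / P.me :=
  Real.sq_sqrt (div_pos (mul_pos P.hbar_pos P.ωp_pos) P.me_pos).le

theorem sqrt_two_ne : Real.sqrt 2 ≠ 0 := by positivity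

/-- The change of coordinates as a linear equivalence. -/
noncomputable def polLinear : Config ≃ₗ[ℝ] Config where
  toFun := P.toPolaritonic
  map_add' p q := by
    simp only [toPolaritonic, uTilde, yTilde, Prod.fst_add, Prod.snd_add, Prod.mk_add_mk]
    ext <;> simp only <;> ring
  map_smul' c p := by
    simp only [toPolaritonic, uTilde, yTilde, Prod.smul_fst, Prod.smul_snd, smul_eq_mul,
      RingHom.id_apply, Prod.smul_mk]
    ext <;> simp only <;> ring
  invFun q := (q.1, q.2.1 / (Real.sqrt 2 * P.ωc) - P.mp * q.2.2.2 / (Real.sqrt 2 * P.M * P.ωc),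
    q.2.2.1, (q.2.1 / Real.sqrt 2 + P.mc * q.2.2.2 / (Real.sqrt 2 * P.M)) / P.uScale)
  left_inv p := by
    have h1 := P.uScale_pos.ne'
    have h2 := P.ωc_pos.ne'
    have h3 := P.M_pos.ne'
    have h4 := sqrt_two_ne
    have h5 : P.mp + P.mc = 2 * P.M := by rw [M]; ring
    have hs : Real.sqrt 2 ^ 2 = 2 := Real.sq_sqrt (by norm_num)
    simp only [toPolaritonic, uTilde, yTilde]
    rw [← uScale]
    refine Prod.ext rfl (Prod.ext ?_ (Prod.ext rfl ?_))
    · simp only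
      field_simp
      rw [hs]
      linear_combination (p.2.1 * P.ωc) * h5
    · simp only
      field_simp
      rw [hs]
      linear_combination (p.2.2.2 * P.uScale) * h5
  right_inv q := by
    have h1 := P.uScale_pos.ne'
    have h2 := P.ωc_pos.ne'
    have h3 := P.M_pos.ne'
    have h4 := sqrt_two_ne
    have h5 : P.mp + P.mc = 2 * P.M := by rw [M]; ring
    have hs : Real.sqrt 2 ^ 2 = 2 := Real.sq_sqrt (by norm_num)
    simp only [toPolaritonic, uTilde, yTilde]
    rw [← uScale]
    refine Prod.ext rfl (Prod.ext ?_ (Prod.ext rfl ?_))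
    · simp only
      field_simp
      rw [hs]
      linear_combination (q.2.1 * P.M) * h5
    · simp only
      field_simp
      rw [hs]
      linear_combination (q.2.2.2) * h5

/-- The change of coordinates as a continuous linear equivalence. -/
noncomputable def polEquiv : Config ≃L[ℝ] Config := P.polLinear.toContinuousLinearEquiv

theorem coe_polEquiv : ⇑P.polEquiv = P.toPolaritonic := rfl

theorem toPolaritonic_bijective : Function.Bijective P.toPolaritonic := P.polEquiv.bijective

theorem positionOf_toPolaritonic (p : Config) :
    P.positionOf (P.toPolaritonic p) = (p.1, p.2.1, p.2.2.1) := by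
  have h := P.polLinear.left_inv p
  have h2 : (P.polLinear.invFun (P.polLinear.toFun p)).2.1 = p.2.1 := by rw [h]
  exact Prod.ext rfl (Prod.ext h2 rfl)

/-- The photon shift is chosen so that `ũ` and `ỹ` move by the same amount. Hence `v` stays fixed,
and `m_p + m_c = 2 M` gives the factor `√2` along `w`. -/
theorem toPolaritonic_translate (n : LatticeIndex) (p : Config) :
    P.toPolaritonic (P.translate n p) = P.polTranslate n (P.toPolaritonic p) := by
  have h3 := P.M_pos.ne'
  have h4 := sqrt_two_ne
  have h5 : P.mp + P.mc = 2 * P.M := by rw [M]; ring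
  have hs : Real.sqrt 2 ^ 2 = 2 := Real.sq_sqrt (by norm_num)
  have hu : Real.sqrt (P.me / (P.hbar * P.ωp)) * Real.sqrt (P.hbar * P.ωp / P.me) = 1 := by
    have := P.hbar_pos
    have := P.ωp_pos
    have := P.me_pos
    rw [← Real.sqrt_mul (by positivity)]
    rw [show P.me / (P.hbar * P.ωp) * (P.hbar * P.ωp / P.me) = 1 by field_simp, Real.sqrt_one]
  simp only [toPolaritonic, translate, polTranslate, uTilde, yTilde, bravais, latticeComb,
    polLatticeComb]
  refine Prod.ext rfl (Prod.ext ?_ (Prod.ext rfl ?_))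
  · simp only
    field_simp
    rw [hs]
    linear_combination (P.ωc * n.2.1 * P.a₂ * Real.sin P.θ) * h5
      + (P.mp * P.ωc * n.2.1 * P.a₂ * Real.sin P.θ) * hu
  · simp only
    field_simp
    linear_combination (P.ωc * n.2.1 * P.a₂ * Real.sin P.θ) * hu

/-- The square expands like a commutative one, because `v` and `∂ₓ` act on different coordinates. -/
theorem shiftOp_shiftOp {F : Config → ℂ} (hF : ContDiff ℝ 2 F) (q : Config) :
    P.shiftOp (P.shiftOp F) q = (q.2.2.2 : ℂ) ^ 2 * F q
      + 2 * Complex.I * ((P.hbar / (Real.sqrt 2 * P.me) : ℝ) : ℂ) * q.2.2.2 * partial1 F q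
      - ((P.hbar / (Real.sqrt 2 * P.me) : ℝ) : ℂ) ^ 2 * partial1 (partial1 F) q := by
  have hone : (1 : WithTop ℕ∞) + 1 ≤ 2 := by norm_num
  have hd : Differentiable ℝ F := differentiable_of_succ_le hF hone
  have h1 : Differentiable ℝ (partial1 F) := (contDiff_partial1 hF hone).differentiable one_ne_zero
  have hp1 : partial1 (P.shiftOp F) q = (q.2.2.2 : ℂ) * partial1 F q
      + Complex.I * ((P.hbar / (Real.sqrt 2 * P.me) : ℝ) : ℂ) * partial1 (partial1 F) q := by
    have l1 : DifferentiableAt ℝ (fun t : ℝ => F (t, q.2.1, q.2.2.1, q.2.2.2)) q.1 := by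
      refine (hd _).comp q.1 ?_
      exact differentiableAt_id.prodMk (differentiableAt_const _)
    have l2 : DifferentiableAt ℝ (fun t : ℝ => partial1 F (t, q.2.1, q.2.2.1, q.2.2.2)) q.1 := by
      refine (h1 _).comp q.1 ?_
      exact differentiableAt_id.prodMk (differentiableAt_const _)
    rw [partial1]
    simp only [shiftOp]
    rw [deriv_fun_add (l1.const_mul _) (l2.const_mul _), deriv_const_mul _ l1,
      deriv_const_mul _ l2]
    rfl
  rw [shiftOp, hp1, shiftOp]
  have hI := Complex.I_sq
  linear_combination (((P.hbar / (Real.sqrt 2 * P.me) : ℝ) : ℂ) ^ 2 * partial1 (partial1 F) q) * hI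

/-- The Hamiltonian in polaritonic coordinates. -/
theorem Heff_comp_toPolaritonic (vext : Space → ℝ) {F : Config → ℂ} (hF : ContDiff ℝ 2 F)
    (p : Config) : P.Heff vext (F ∘ P.toPolaritonic) p = P.Hpol vext F (P.toPolaritonic p) := by
  have hone : (1 : WithTop ℕ∞) + 1 ≤ 2 := by norm_num
  have hd : Differentiable ℝ F := differentiable_of_succ_le hF hone
  have h1 : Differentiable ℝ (partial1 F) := (contDiff_partial1 hF hone).differentiable one_ne_zero
  have h2 : Differentiable ℝ (partial2 F) := (contDiff_partial2 hF hone).differentiable one_ne_zero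
  have h3 : Differentiable ℝ (partial3 F) := (contDiff_partial3 hF hone).differentiable one_ne_zero
  have h4 : Differentiable ℝ (partial4 F) := (contDiff_partial4 hF hone).differentiable one_ne_zero
  -- Entries of the Jacobian: `∂_y = a ∂_w + b ∂_v` and `∂_u = c ∂_w + d ∂_v`.
  set a : ℝ := P.mc * P.ωc / (Real.sqrt 2 * P.M) with ha
  set b : ℝ := -(P.ωc / Real.sqrt 2) with hb
  set c : ℝ := P.mp * P.uScale / (Real.sqrt 2 * P.M) with hc
  set d : ℝ := P.uScale / Real.sqrt 2 with hd'
  have t1 : P.toPolaritonic e1 = e1 := by simp [toPolaritonic, e1, uTilde, yTilde]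
  have t2 : P.toPolaritonic e2 = a • e2 + b • e4 := by
    simp [toPolaritonic, e2, e4, uTilde, yTilde, ha, hb]
    ring
  have t3 : P.toPolaritonic e3 = e3 := by simp [toPolaritonic, e3, uTilde, yTilde]
  have t4 : P.toPolaritonic e4 = c • e2 + d • e4 := by
    simp [toPolaritonic, e2, e4, uTilde, yTilde, hc, hd', uScale]
  have hcomp : ∀ {G : Config → ℂ}, Differentiable ℝ G → Differentiable ℝ (G ∘ P.toPolaritonic) :=
    fun hG => hG.comp P.polEquiv.differentiable
  have k1 : ∀ {G : Config → ℂ}, Differentiable ℝ G →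
      partial1 (G ∘ P.toPolaritonic) = partial1 G ∘ P.toPolaritonic := by
    intro G hG
    ext p
    rw [partial1_eq_fderiv (hcomp hG p), ← coe_polEquiv, fderiv_comp_equiv _ hG, Function.comp,
      partial1_eq hG, coe_polEquiv, t1]
  have k3 : ∀ {G : Config → ℂ}, Differentiable ℝ G →
      partial3 (G ∘ P.toPolaritonic) = partial3 G ∘ P.toPolaritonic := by
    intro G hG
    ext p
    rw [partial3_eq_fderiv (hcomp hG p), ← coe_polEquiv, fderiv_comp_equiv _ hG, Function.comp,
      partial3_eq hG, coe_polEquiv, t3]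
  have k2 : ∀ {G : Config → ℂ}, Differentiable ℝ G →
      partial2 (G ∘ P.toPolaritonic)
        = (fun q => (a : ℂ) * partial2 G q + (b : ℂ) * partial4 G q) ∘ P.toPolaritonic := by
    intro G hG
    ext p
    rw [partial2_eq_fderiv (hcomp hG p), ← coe_polEquiv, fderiv_comp_equiv _ hG, Function.comp,
      partial2_eq hG, partial4_eq hG, coe_polEquiv, t2]
    simp
  have k4 : ∀ {G : Config → ℂ}, Differentiable ℝ G →
      partial4 (G ∘ P.toPolaritonic)
        = (fun q => (c : ℂ) * partial2 G q + (d : ℂ) * partial4 G q) ∘ P.toPolaritonic := by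
    intro G hG
    ext p
    rw [partial4_eq_fderiv (hcomp hG p), ← coe_polEquiv, fderiv_comp_equiv _ hG, Function.comp,
      partial2_eq hG, partial4_eq hG, coe_polEquiv, t4]
    simp
  have lin2 : ∀ (x y : ℂ) (q : Config), partial2 (fun q => x * partial2 F q + y * partial4 F q) q
      = x * partial2 (partial2 F) q + y * partial2 (partial4 F) q := by
    intro x y q
    rw [partial2_eq_fderiv (((h2 q).const_mul x).fun_add ((h4 q).const_mul y)),
      fderiv_fun_add ((h2 q).const_mul x) ((h4 q).const_mul y), fderiv_const_mul (h2 q),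
      fderiv_const_mul (h4 q), partial2_eq_fderiv (h2 q), partial2_eq_fderiv (h4 q)]
    simp
  have lin4 : ∀ (x y : ℂ) (q : Config), partial4 (fun q => x * partial2 F q + y * partial4 F q) q
      = x * partial4 (partial2 F) q + y * partial4 (partial4 F) q := by
    intro x y q
    rw [partial4_eq_fderiv (((h2 q).const_mul x).fun_add ((h4 q).const_mul y)),
      fderiv_fun_add ((h2 q).const_mul x) ((h4 q).const_mul y), fderiv_const_mul (h2 q),
      fderiv_const_mul (h4 q), partial4_eq_fderiv (h2 q), partial4_eq_fderiv (h4 q)]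
    simp
  have symm : ∀ q, partial2 (partial4 F) q = partial4 (partial2 F) q := by
    intro q
    have hs : IsSymmSndFDerivAt ℝ F q := by
      refine ContDiffAt.isSymmSndFDerivAt (n := 2) hF.contDiffAt ?_
      simp
    have hfd : Differentiable ℝ (fderiv ℝ F) :=
      (hF.fderiv_right hone).differentiable one_ne_zero
    rw [partial2_eq_fderiv (h4 q), partial4_eq_fderiv (h2 q), partial4_eq hd, partial2_eq hd]
    rw [fderiv_clm_apply (hfd q) (differentiableAt_const _),
      fderiv_clm_apply (hfd q) (differentiableAt_const _)]
    simpa using hs e2 e4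
  have hlin : Differentiable ℝ (fun q => (a : ℂ) * partial2 F q + (b : ℂ) * partial4 F q) :=
    (h2.const_mul _).add (h4.const_mul _)
  have hlin' : Differentiable ℝ (fun q => (c : ℂ) * partial2 F q + (d : ℂ) * partial4 F q) :=
    (h2.const_mul _).add (h4.const_mul _)
  set q := P.toPolaritonic p with hq
  have hxx := P.shiftOp_shiftOp hF q
  have hv : p.2.2.2 * Real.sqrt (P.hbar * P.ωp / P.me) - p.2.1 * P.ωc
      = Real.sqrt 2 * q.2.2.2 := by
    have := sqrt_two_ne
    simp only [hq, toPolaritonic, uTilde, yTilde]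
    field_simp
  have hpos : P.positionOf q = (p.1, p.2.1, p.2.2.1) := P.positionOf_toPolaritonic p
  rw [Heff, Hpol, hpos, hv, hxx, k1 hd, k1 h1, k3 hd, k3 h3, k2 hd, k2 hlin, k4 hd, k4 hlin']
  simp only [Function.comp, ← hq, lin2, lin4, symm]
  have hs : Real.sqrt 2 ^ 2 = 2 := Real.sq_sqrt (by norm_num)
  have hs0 := sqrt_two_ne
  have hme := P.me_pos.ne'
  have hM := P.M_pos.ne'
  have hμ := P.μ_pos.ne'
  have hωp := P.ωp_pos.ne'
  have hωc := P.ωc_pos.ne'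
  have hu2 := P.uScale_sq
  have hΩ : P.μ * P.Ω ^ 2 / 2 = P.me := by
    rw [Ω_sq]
    field_simp
  have hmp : P.mp * P.ωp ^ 2 = P.me := by rw [mp]; field_simp
  have hmc : P.mc * P.ωc ^ 2 = P.me := by rw [mc]; field_simp
  have hMsum : P.mp + P.mc = 2 * P.M := by rw [M]; ring
  have hμM : P.μ * P.M = P.mp * P.mc := by rw [μ]; field_simp
  have r22 : P.hbar ^ 2 / (2 * P.me) * a ^ 2 + P.hbar * P.ωp / 2 * c ^ 2
      = P.hbar ^ 2 / (2 * P.M) := by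
    rw [ha, hc]
    simp only [div_pow, mul_pow, hs, hu2]
    field_simp
    linear_combination P.hbar ^ 2 * (P.mc * hmc + P.mp * hmp + P.me * hMsum)
  -- The mixed derivative drops out because `m_p ω_p² = m_c ω_c² = m_e`.
  have r24 : P.hbar ^ 2 / (2 * P.me) * (a * b) + P.hbar * P.ωp / 2 * (c * d) = 0 := by
    have e1 : a * b = -(P.mc * P.ωc ^ 2 / (2 * P.M)) := by
      rw [ha, hb]
      field_simp
      rw [hs]
    have e2 : c * d = P.mp * P.uScale ^ 2 / (2 * P.M) := by
      rw [hc, hd']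
      field_simp
      rw [hs]
    rw [e1, e2, hmc, hu2]
    field_simp
    linear_combination P.hbar ^ 2 * hmp
  have r44 : P.hbar ^ 2 / (2 * P.me) * b ^ 2 + P.hbar * P.ωp / 2 * d ^ 2
      = P.hbar ^ 2 / (2 * P.μ) := by
    have e1 : b ^ 2 = P.ωc ^ 2 / 2 := by rw [hb, neg_sq, div_pow, hs]
    have e2 : d ^ 2 = P.hbar * P.ωp / P.me / 2 := by rw [hd', div_pow, hs, hu2]
    have e3 := P.Ω_sq_eq_add
    rw [Ω_sq] at e3
    rw [e1, e2]
    field_simp at e3 ⊢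
    linear_combination -P.hbar ^ 2 * e3
  have rx : P.hbar * Real.sqrt 2 = P.me * (2 * (P.hbar / (Real.sqrt 2 * P.me))) := by
    field_simp
    rw [hs]
  have rxx : P.hbar ^ 2 / (2 * P.me) = P.me * (P.hbar / (Real.sqrt 2 * P.me)) ^ 2 := by
    rw [div_pow, mul_pow, hs]
    field_simp
  have rv : P.me / 2 * (Real.sqrt 2 * q.2.2.2) ^ 2 = P.me * q.2.2.2 ^ 2 := by
    rw [mul_pow, hs]
    ring
  rw [hΩ, rv]
  have R22 := congrArg (Complex.ofReal) r22
  have R24 := congrArg (Complex.ofReal) r24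
  have R44 := congrArg (Complex.ofReal) r44
  have RX := congrArg (Complex.ofReal) rx
  have RXX := congrArg (Complex.ofReal) rxx
  rw [← r22, ← r44]
  simp only [Complex.ofReal_add, Complex.ofReal_mul, Complex.ofReal_pow, Complex.ofReal_zero,
    Complex.ofReal_ofNat] at R24 RX RXX ⊢
  linear_combination (-2 * partial4 (partial2 F) q) * R24
    + (Complex.I * q.2.2.2 * partial1 F q) * RX - (partial1 (partial1 F) q) * RXX

end Params

/-! ### The Hamiltonian on plane waves in `r_w`, and its translation invariance. -/

/-- The function `exp(i b · r_w) f(v)`. -/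
noncomputable def modeWave (b : Space) (f : ℝ → ℂ) (q : Config) : ℂ :=
  Complex.exp (Complex.I * ((b.1 * q.1 + b.2.1 * q.2.1 + b.2.2 * q.2.2.1 : ℝ) : ℂ)) * f q.2.2.2

theorem deriv_exp_affine_mul (b c t : ℝ) (x : ℂ) :
    deriv (fun t : ℝ => Complex.exp (Complex.I * ((b * t + c : ℝ) : ℂ)) * x) t
      = Complex.I * b * (Complex.exp (Complex.I * ((b * t + c : ℝ) : ℂ)) * x) := by
  have h0 : HasDerivAt (fun t : ℝ => b * t + c) b t := by
    simpa using ((hasDerivAt_id t).const_mul b).add_const c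
  rw [((h0.ofReal_comp.const_mul Complex.I).cexp.mul_const x).deriv]
  ring

theorem partial1_modeWave (b : Space) (f : ℝ → ℂ) :
    partial1 (modeWave b f) = fun q => Complex.I * b.1 * modeWave b f q := by
  ext q
  have h := deriv_exp_affine_mul b.1 (b.2.1 * q.2.1 + b.2.2 * q.2.2.1) q.1 (f q.2.2.2)
  simpa only [partial1, modeWave, add_assoc] using h

theorem partial2_modeWave (b : Space) (f : ℝ → ℂ) :
    partial2 (modeWave b f) = fun q => Complex.I * b.2.1 * modeWave b f q := by
  ext q
  have h := deriv_exp_affine_mul b.2.1 (b.1 * q.1 + b.2.2 * q.2.2.1) q.2.1 (f q.2.2.2)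
  have e : ∀ t : ℝ, b.1 * q.1 + b.2.1 * t + b.2.2 * q.2.2.1
      = b.2.1 * t + (b.1 * q.1 + b.2.2 * q.2.2.1) := fun t => by ring
  simpa only [partial2, modeWave, e] using h

theorem partial3_modeWave (b : Space) (f : ℝ → ℂ) :
    partial3 (modeWave b f) = fun q => Complex.I * b.2.2 * modeWave b f q := by
  ext q
  have h := deriv_exp_affine_mul b.2.2 (b.1 * q.1 + b.2.1 * q.2.1) q.2.2.1 (f q.2.2.2)
  have e : ∀ t : ℝ, b.1 * q.1 + b.2.1 * q.2.1 + b.2.2 * t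
      = b.2.2 * t + (b.1 * q.1 + b.2.1 * q.2.1) := fun t => by ring
  simpa only [partial3, modeWave, e] using h

theorem partial4_modeWave (b : Space) (f : ℝ → ℂ) :
    partial4 (modeWave b f) = modeWave b (deriv f) := by
  ext q
  simp only [partial4, modeWave, deriv_const_mul_field]

theorem partial2_const_mul (c : ℂ) (f : Config → ℂ) :
    partial2 (fun q => c * f q) = fun q => c * partial2 f q := by
  ext q
  simp only [partial2, deriv_const_mul_field]

theorem partial3_const_mul (c : ℂ) (f : Config → ℂ) :
    partial3 (fun q => c * f q) = fun q => c * partial3 f q := by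
  ext q
  simp only [partial3, deriv_const_mul_field]

theorem contDiff_modeWave (b : Space) {f : ℝ → ℂ} {n : WithTop ℕ∞} (hf : ContDiff ℝ n f) :
    ContDiff ℝ n (modeWave b f) := by
  unfold modeWave
  refine ContDiff.mul ?_ (hf.comp (by fun_prop))
  have h : ContDiff ℝ n (fun q : Config => b.1 * q.1 + b.2.1 * q.2.1 + b.2.2 * q.2.2.1) := by
    fun_prop
  exact (contDiff_const.mul (Complex.ofRealCLM.contDiff.comp h)).cexp

namespace Params

variable (P : Params)

/-- Apart from the potential, the coefficients depend only on `ũ - ỹ`, which the translation leaves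
fixed. -/
theorem Heff_comp_translate {vext : Space → ℝ} (hper : P.IsLatticePeriodic vext) (n : LatticeIndex)
    (f : Config → ℂ) (p : Config) :
    P.Heff vext (f ∘ P.translate n) p = P.Heff vext f (P.translate n p) := by
  have k1 : ∀ g : Config → ℂ, partial1 (g ∘ P.translate n) = partial1 g ∘ P.translate n := by
    intro g
    ext p
    exact deriv_comp_add_const (f := fun t => g (t, (P.translate n p).2.1,
      (P.translate n p).2.2.1, (P.translate n p).2.2.2)) _ _
  have k2 : ∀ g : Config → ℂ, partial2 (g ∘ P.translate n) = partial2 g ∘ P.translate n := by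
    intro g
    ext p
    exact deriv_comp_add_const (f := fun t => g ((P.translate n p).1, t,
      (P.translate n p).2.2.1, (P.translate n p).2.2.2)) _ _
  have k3 : ∀ g : Config → ℂ, partial3 (g ∘ P.translate n) = partial3 g ∘ P.translate n := by
    intro g
    ext p
    exact deriv_comp_add_const (f := fun t => g ((P.translate n p).1, (P.translate n p).2.1,
      t, (P.translate n p).2.2.2)) _ _
  have k4 : ∀ g : Config → ℂ, partial4 (g ∘ P.translate n) = partial4 g ∘ P.translate n := by
    intro g
    ext p
    exact deriv_comp_add_const (f := fun t => g ((P.translate n p).1, (P.translate n p).2.1,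
      (P.translate n p).2.2.1, t)) _ _
  have hu : Real.sqrt (P.me / (P.hbar * P.ωp)) * Real.sqrt (P.hbar * P.ωp / P.me) = 1 := by
    have := P.hbar_pos
    have := P.ωp_pos
    have := P.me_pos
    rw [← Real.sqrt_mul (by positivity)]
    rw [show P.me / (P.hbar * P.ωp) * (P.hbar * P.ωp / P.me) = 1 by field_simp, Real.sqrt_one]
  have hc : (P.translate n p).2.2.2 * Real.sqrt (P.hbar * P.ωp / P.me)
      - (P.translate n p).2.1 * P.ωc
      = p.2.2.2 * Real.sqrt (P.hbar * P.ωp / P.me) - p.2.1 * P.ωc := by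
    simp only [translate]
    linear_combination ((P.bravais n).2.1 * P.ωc) * hu
  have hv : vext ((P.translate n p).1, (P.translate n p).2.1, (P.translate n p).2.2.1)
      = vext (p.1, p.2.1, p.2.2.1) := hper n (p.1, p.2.1, p.2.2.1)
  rw [Heff, Heff, hc, hv, k1, k1, k2, k2, k3, k3, k4, k4]
  rfl

/-- The reciprocal lattice vector in polaritonic coordinates, shifted by `k`. -/
noncomputable def waveVec (k : Space) (n : LatticeIndex) : Space :=
  (k.1 + P.Gx n.1, k.2.1 + P.Gw n.2.1 n.1, k.2.2 + P.Gz n.2.2)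

theorem blochWave_planeWave (k : Space) (n : LatticeIndex) (f : ℝ → ℂ) :
    blochWave k (fun q => P.planeWave n q * f q.2.2.2) = modeWave (P.waveVec k n) f := by
  ext q
  rw [blochWave, planeWave, modeWave, ← mul_assoc, ← Complex.exp_add, waveVec]
  congr 2
  push_cast
  ring

theorem Hpol_modeWave (vext : Space → ℝ) (k : Space) (n : LatticeIndex) (f : ℝ → ℂ) (q : Config) :
    P.Hpol vext (modeWave (P.waveVec k n) f) q =
      ((P.kinetic k n + vext (P.positionOf q) : ℝ) : ℂ) * modeWave (P.waveVec k n) f q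
        + modeWave (P.waveVec k n) (P.shiftedOscillator (P.A k.1 n.1) f) q := by
  set b := P.waveVec k n with hb
  have hA : P.hbar / (Real.sqrt 2 * P.me) * b.1 = P.A k.1 n.1 := by
    rw [hb, waveVec, A]
    ring
  have hI := Complex.I_sq
  -- On a plane wave `∂ₓ` is multiplication by `i b₁`, so the first order operator becomes
  -- multiplication by `v - A`.
  have hshift : ∀ h : ℝ → ℂ, P.shiftOp (modeWave b h)
      = modeWave b (fun v => ((v - P.A k.1 n.1 : ℝ) : ℂ) * h v) := by
    intro h
    ext q
    rw [shiftOp, partial1_modeWave]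
    simp only [modeWave]
    rw [← hA]
    push_cast
    generalize Complex.exp _ = x
    linear_combination (P.hbar / (Real.sqrt 2 * P.me) * b.1 * x * h q.2.2.2) * hI
  rw [Hpol, hshift, hshift, partial3_modeWave, partial3_const_mul, partial3_modeWave,
    partial2_modeWave, partial2_const_mul, partial2_modeWave, partial4_modeWave, partial4_modeWave]
  have h2 : b.2.1 = k.2.1 + P.Gw n.2.1 n.1 := rfl
  have h3 : b.2.2 = k.2.2 + P.Gz n.2.2 := rfl
  simp only [modeWave, shiftedOscillator, kinetic, ← h2, ← h3]
  push_cast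
  generalize Complex.exp _ = x
  linear_combination (-(P.hbar ^ 2 / (2 * P.me)) * b.2.2 ^ 2 * x * f q.2.2.2
    - (P.hbar ^ 2 / (2 * P.M)) * b.2.1 ^ 2 * x * f q.2.2.2) * hI

theorem Hpol_blochWave (vext : Space → ℝ) (k : Space) (n : LatticeIndex) (f : ℝ → ℂ) (q : Config) :
    P.Hpol vext (blochWave k (fun q => P.planeWave n q * f q.2.2.2)) q =
        blochWave k (P.planeWave n) q *
          (((P.kinetic k n + vext (P.positionOf q) : ℝ) : ℂ) * f q.2.2.2
            + P.shiftedOscillator (P.A k.1 n.1) f q.2.2.2) := by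
  have h : blochWave k (P.planeWave n) q
      = Complex.exp (Complex.I * (((P.waveVec k n).1 * q.1 + (P.waveVec k n).2.1 * q.2.1
        + (P.waveVec k n).2.2 * q.2.2.1 : ℝ) : ℂ)) := by
    have := congrFun (P.blochWave_planeWave k n (fun _ => 1)) q
    simpa [modeWave] using this
  rw [blochWave_planeWave, Hpol_modeWave, h]
  simp only [modeWave]
  ring

/-- Separates the differential operator, which has smooth coefficients, from a potential that is
only locally square integrable. -/
theorem Hpol_eq_add (vext : Space → ℝ) (F : Config → ℂ) (q : Config) :
    P.Hpol vext F q = P.Hpol 0 F q + (vext (P.positionOf q) : ℂ) * F q := by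
  simp only [Hpol, Pi.zero_apply, Complex.ofReal_zero]
  ring

end Params

instance : Measure.IsAddHaarMeasure (volume : Measure Space) :=
  Measure.prod.instIsAddHaarMeasure _ _

instance : Measure.IsAddHaarMeasure (volume : Measure Config) :=
  Measure.prod.instIsAddHaarMeasure _ _

/-! ### Integration by parts and symmetry of the free Hamiltonian. -/

section IBP

theorem integral_conj_fderiv_mul {F g : Config → ℂ} (hF : ContDiff ℝ 1 F)
    (hc : HasCompactSupport F) (hg : ContDiff ℝ 1 g) (e : Config) :
    ∫ q, conj (fderiv ℝ F q e) * g q = -∫ q, conj (F q) * fderiv ℝ g q e := by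
  set F' : Config → ℂ := fun q => conj (F q) with hF'
  have hF1 : ContDiff ℝ 1 F' := Complex.conjCLE.contDiff.comp hF
  have hd : ∀ q, fderiv ℝ F' q e = conj (fderiv ℝ F q e) := by
    intro q
    have := (Complex.conjCLE.hasFDerivAt (x := F q)).comp q
      (hF.differentiable one_ne_zero q).hasFDerivAt
    have h2 : fderiv ℝ F' q = _ := HasFDerivAt.fderiv this
    rw [h2]
    rfl
  have hc' : HasCompactSupport F' := hc.comp_left (map_zero _)
  have hcf : Continuous fun q => fderiv ℝ F' q e :=
    (contDiff_fderiv_apply hF1 (zero_add 1).le e).continuous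
  have hcg : Continuous fun q => fderiv ℝ g q e :=
    (contDiff_fderiv_apply hg (zero_add 1).le e).continuous
  have h := integral_mul_fderiv_eq_neg_fderiv_mul_of_integrable (μ := (volume : Measure Config))
    (f := F') (g := g) (v := e)
    ((hcf.mul hg.continuous).integrable_of_hasCompactSupport
      ((hc'.fderiv_apply (𝕜 := ℝ) e).mul_right))
    ((hF1.continuous.mul hcg).integrable_of_hasCompactSupport hc'.mul_right)
    ((hF1.continuous.mul hg.continuous).integrable_of_hasCompactSupport hc'.mul_right)
    (fun q _ => hF1.differentiable one_ne_zero q) (fun q _ => hg.differentiable one_ne_zero q)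
  simp only [hd] at h
  rw [h, neg_neg]

theorem HasCompactSupport.fderiv_apply' {F : Config → ℂ} (hc : HasCompactSupport F) (e : Config) :
    HasCompactSupport (fun q => fderiv ℝ F q e) := hc.fderiv_apply (𝕜 := ℝ) e

/-- Integration by parts for second derivatives. -/
theorem integral_conj_fderiv_fderiv_mul {F g : Config → ℂ} (hF : ContDiff ℝ 2 F)
    (hc : HasCompactSupport F) (hg : ContDiff ℝ 2 g) (e : Config) :
    ∫ q, conj (fderiv ℝ (fun q => fderiv ℝ F q e) q e) * g q
      = ∫ q, conj (F q) * fderiv ℝ (fun q => fderiv ℝ g q e) q e := by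
  have hone : (1 : WithTop ℕ∞) + 1 ≤ 2 := by norm_num
  rw [integral_conj_fderiv_mul (contDiff_fderiv_apply hF hone e)
    (HasCompactSupport.fderiv_apply' hc e) (hg.of_le (by norm_num)),
    integral_conj_fderiv_mul (hF.of_le (by norm_num)) hc (contDiff_fderiv_apply hg hone e), neg_neg]

namespace Params

variable (P : Params)

/-- The kinetic coupling `ℏ / (√2 mₑ)`. -/
noncomputable def γ : ℝ := P.hbar / (Real.sqrt 2 * P.me)

theorem Hpol_zero_eq {F : Config → ℂ} (hF : ContDiff ℝ 2 F) (q : Config) :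
    P.Hpol 0 F q =
      -((P.hbar ^ 2 / (2 * P.me) : ℝ) : ℂ) * fderiv ℝ (fun q => fderiv ℝ F q e3) q e3
      - ((P.hbar ^ 2 / (2 * P.M) : ℝ) : ℂ) * fderiv ℝ (fun q => fderiv ℝ F q e2) q e2
      - ((P.hbar ^ 2 / (2 * P.μ) : ℝ) : ℂ) * fderiv ℝ (fun q => fderiv ℝ F q e4) q e4
      + ((P.μ * P.Ω ^ 2 / 2 : ℝ) : ℂ) * (((q.2.2.2 ^ 2 : ℝ) : ℂ) * F q
        + 2 * Complex.I * (P.γ : ℂ) * ((q.2.2.2 : ℂ) * fderiv ℝ F q e1)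
        - (P.γ : ℂ) ^ 2 * fderiv ℝ (fun q => fderiv ℝ F q e1) q e1) := by
  have hone : (1 : WithTop ℕ∞) + 1 ≤ 2 := by norm_num
  have hd : Differentiable ℝ F := differentiable_of_succ_le hF hone
  have hd' : ∀ e, Differentiable ℝ (fun q => fderiv ℝ F q e) := fun e =>
    (contDiff_fderiv_apply hF hone e).differentiable one_ne_zero
  rw [Hpol, shiftOp_shiftOp P hF, partial1_eq hd, partial2_eq hd, partial3_eq hd, partial4_eq hd,
    partial1_eq (hd' _), partial2_eq (hd' _), partial3_eq (hd' _), partial4_eq (hd' _), γ]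
  simp only [Pi.zero_apply]
  push_cast
  ring

theorem continuous_Hpol_zero {F : Config → ℂ} (hF : ContDiff ℝ 2 F) : Continuous (P.Hpol 0 F) := by
  have hone : (1 : WithTop ℕ∞) + 1 ≤ 2 := by norm_num
  have h1 : ∀ e, Continuous (fun q => fderiv ℝ F q e) := fun e =>
    (contDiff_fderiv_apply hF hone e).continuous
  have h2 : ∀ e, Continuous (fun q => fderiv ℝ (fun q => fderiv ℝ F q e) q e) := fun e =>
    (contDiff_fderiv_apply (contDiff_fderiv_apply hF hone e) (zero_add 1).le e).continuous
  have h3 := hF.continuous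
  rw [funext (P.Hpol_zero_eq hF)]
  have a1 := h1 e1
  have b1 := h2 e1
  have b2 := h2 e2
  have b3 := h2 e3
  have b4 := h2 e4
  fun_prop

theorem Hpol_zero_eq_zero_of_notMem {F : Config → ℂ} {q : Config} (hF : ContDiff ℝ 2 F)
    (hq : q ∉ tsupport F) : P.Hpol 0 F q = 0 := by
  have h0 : ∀ {G : Config → ℂ} (e : Config), q ∉ tsupport G → q ∉ tsupport (fun q => fderiv ℝ G q e) :=
    fun e h h' => h (tsupport_fderiv_apply_subset ℝ e h')
  rw [Hpol_zero_eq P hF, image_eq_zero_of_notMem_tsupport hq,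
    image_eq_zero_of_notMem_tsupport (h0 e1 hq), image_eq_zero_of_notMem_tsupport (h0 e1 (h0 e1 hq)),
    image_eq_zero_of_notMem_tsupport (h0 e2 (h0 e2 hq)),
    image_eq_zero_of_notMem_tsupport (h0 e3 (h0 e3 hq)),
    image_eq_zero_of_notMem_tsupport (h0 e4 (h0 e4 hq))]
  ring

theorem hasCompactSupport_Hpol_zero {F : Config → ℂ} (hF : ContDiff ℝ 2 F)
    (hc : HasCompactSupport F) : HasCompactSupport (P.Hpol 0 F) :=
  HasCompactSupport.intro hc fun _ hq => P.Hpol_zero_eq_zero_of_notMem hF hq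

/-- The free Hamiltonian is symmetric. -/
theorem integral_conj_Hpol_zero_mul {F g : Config → ℂ} (hF : ContDiff ℝ 2 F)
    (hc : HasCompactSupport F) (hg : ContDiff ℝ 2 g) :
    ∫ q, conj (P.Hpol 0 F q) * g q = ∫ q, conj (F q) * P.Hpol 0 g q := by
  have hone : (1 : WithTop ℕ∞) + 1 ≤ 2 := by norm_num
  have cF1 : ∀ e, Continuous (fun q => fderiv ℝ F q e) := fun e =>
    (contDiff_fderiv_apply hF hone e).continuous
  have cF2 : ∀ e, Continuous (fun q => fderiv ℝ (fun q => fderiv ℝ F q e) q e) := fun e =>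
    (contDiff_fderiv_apply (contDiff_fderiv_apply hF hone e) (zero_add 1).le e).continuous
  have cg1 : ∀ e, Continuous (fun q => fderiv ℝ g q e) := fun e =>
    (contDiff_fderiv_apply hg hone e).continuous
  have cg2 : ∀ e, Continuous (fun q => fderiv ℝ (fun q => fderiv ℝ g q e) q e) := fun e =>
    (contDiff_fderiv_apply (contDiff_fderiv_apply hg hone e) (zero_add 1).le e).continuous
  have sF1 : ∀ e, HasCompactSupport (fun q => fderiv ℝ F q e) :=
    HasCompactSupport.fderiv_apply' hc
  have sF2 : ∀ e, HasCompactSupport (fun q => fderiv ℝ (fun q => fderiv ℝ F q e) q e) := fun e =>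
    HasCompactSupport.fderiv_apply' (sF1 e) e
  have hint : ∀ {u w : Config → ℂ}, Continuous u → HasCompactSupport u → Continuous w →
      Integrable (fun q => conj (u q) * w q) := by
    intro u w hu hcu hw
    refine Continuous.integrable_of_hasCompactSupport
      ((Complex.continuous_conj.comp hu).mul hw) (HasCompactSupport.mul_right ?_)
    exact hcu.comp_left (map_zero _)
  have hcont := hg.continuous
  have hq4 : Continuous fun q : Config => ((q.2.2.2 : ℝ) : ℂ) := by fun_prop
  have L2 := fun e => integral_conj_fderiv_fderiv_mul hF hc hg e
  have hvg : ContDiff ℝ 1 (fun q : Config => (q.2.2.2 : ℂ) * g q) := by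
    refine ContDiff.mul (Complex.ofRealCLM.contDiff.comp (by fun_prop)) (hg.of_le (by norm_num))
  -- The derivative along `x` does not act on `v`. The minus sign compensates the conjugation of the
  -- factor `i` in the first order term.
  have L1 : ∫ q, conj (fderiv ℝ F q e1) * ((q.2.2.2 : ℂ) * g q)
      = -∫ q, conj (F q) * ((q.2.2.2 : ℂ) * fderiv ℝ g q e1) := by
    rw [integral_conj_fderiv_mul (hF.of_le (by norm_num)) hc hvg e1]
    congr 2
    ext q
    congr 1
    have hgd : Differentiable ℝ g := hg.differentiable (by norm_num)
    have hL : HasFDerivAt (fun q : Config => ((q.2.2.2 : ℝ) : ℂ))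
        (Complex.ofRealCLM.comp ((ContinuousLinearMap.snd ℝ ℝ ℝ).comp
          ((ContinuousLinearMap.snd ℝ ℝ (ℝ × ℝ)).comp
            (ContinuousLinearMap.snd ℝ ℝ (ℝ × ℝ × ℝ))))) q :=
      (Complex.ofRealCLM.comp ((ContinuousLinearMap.snd ℝ ℝ ℝ).comp
          ((ContinuousLinearMap.snd ℝ ℝ (ℝ × ℝ)).comp
            (ContinuousLinearMap.snd ℝ ℝ (ℝ × ℝ × ℝ))))).hasFDerivAt
    have hm : fderiv ℝ (fun q : Config => (q.2.2.2 : ℂ) * g q) q = _ :=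
      (hL.mul (hgd q).hasFDerivAt).fderiv
    rw [hm]
    simp [e1]
  simp only [funext (P.Hpol_zero_eq hF), funext (P.Hpol_zero_eq hg)]
  have iF : ∀ e, Integrable (fun q => conj (fderiv ℝ (fun q => fderiv ℝ F q e) q e) * g q) :=
    fun e => hint (cF2 e) (sF2 e) hcont
  have ig : ∀ e, Integrable (fun q => conj (F q) * fderiv ℝ (fun q => fderiv ℝ g q e) q e) :=
    fun e => hint hF.continuous hc (cg2 e)
  have iv : Integrable (fun q => conj (F q) * (((q.2.2.2 ^ 2 : ℝ) : ℂ) * g q)) :=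
    hint hF.continuous hc (by fun_prop)
  have iF1 : Integrable (fun q => conj (fderiv ℝ F q e1) * ((q.2.2.2 : ℂ) * g q)) :=
    hint (cF1 e1) (sF1 e1) (hq4.mul hcont)
  have ig1 : Integrable (fun q => conj (F q) * ((q.2.2.2 : ℂ) * fderiv ℝ g q e1)) :=
    hint hF.continuous hc (hq4.mul (cg1 e1))
  set c3 : ℂ := ((P.hbar ^ 2 / (2 * P.me) : ℝ) : ℂ) with hc3
  set c2 : ℂ := ((P.hbar ^ 2 / (2 * P.M) : ℝ) : ℂ) with hc2
  set c4 : ℂ := ((P.hbar ^ 2 / (2 * P.μ) : ℝ) : ℂ) with hc4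
  set c0 : ℂ := ((P.μ * P.Ω ^ 2 / 2 : ℝ) : ℂ) with hc0
  have cc3 : conj c3 = c3 := Complex.conj_ofReal _
  have cc2 : conj c2 = c2 := Complex.conj_ofReal _
  have cc4 : conj c4 = c4 := Complex.conj_ofReal _
  have cc0 : conj c0 = c0 := Complex.conj_ofReal _
  have lhs : ∀ q : Config, conj (-c3 * fderiv ℝ (fun q => fderiv ℝ F q e3) q e3
      - c2 * fderiv ℝ (fun q => fderiv ℝ F q e2) q e2
      - c4 * fderiv ℝ (fun q => fderiv ℝ F q e4) q e4
      + c0 * (((q.2.2.2 ^ 2 : ℝ) : ℂ) * F q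
        + 2 * Complex.I * (P.γ : ℂ) * ((q.2.2.2 : ℂ) * fderiv ℝ F q e1)
        - (P.γ : ℂ) ^ 2 * fderiv ℝ (fun q => fderiv ℝ F q e1) q e1)) * g q
      = (-c3) * (conj (fderiv ℝ (fun q => fderiv ℝ F q e3) q e3) * g q)
        + (-c2) * (conj (fderiv ℝ (fun q => fderiv ℝ F q e2) q e2) * g q)
        + (-c4) * (conj (fderiv ℝ (fun q => fderiv ℝ F q e4) q e4) * g q)
        + c0 * (conj (F q) * (((q.2.2.2 ^ 2 : ℝ) : ℂ) * g q))
        + (-(2 * Complex.I * P.γ * c0)) * (conj (fderiv ℝ F q e1) * ((q.2.2.2 : ℂ) * g q))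
        + (-(c0 * (P.γ : ℂ) ^ 2)) * (conj (fderiv ℝ (fun q => fderiv ℝ F q e1) q e1) * g q) := by
    intro q
    simp only [map_add, map_sub, map_mul, map_neg, map_pow, cc3, cc2, cc4, cc0, Complex.conj_ofReal,
      Complex.conj_I, map_ofNat]
    ring
  have rhs : ∀ q : Config, conj (F q) * (-c3 * fderiv ℝ (fun q => fderiv ℝ g q e3) q e3
      - c2 * fderiv ℝ (fun q => fderiv ℝ g q e2) q e2
      - c4 * fderiv ℝ (fun q => fderiv ℝ g q e4) q e4
      + c0 * (((q.2.2.2 ^ 2 : ℝ) : ℂ) * g q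
        + 2 * Complex.I * (P.γ : ℂ) * ((q.2.2.2 : ℂ) * fderiv ℝ g q e1)
        - (P.γ : ℂ) ^ 2 * fderiv ℝ (fun q => fderiv ℝ g q e1) q e1))
      = (-c3) * (conj (F q) * fderiv ℝ (fun q => fderiv ℝ g q e3) q e3)
        + (-c2) * (conj (F q) * fderiv ℝ (fun q => fderiv ℝ g q e2) q e2)
        + (-c4) * (conj (F q) * fderiv ℝ (fun q => fderiv ℝ g q e4) q e4)
        + c0 * (conj (F q) * (((q.2.2.2 ^ 2 : ℝ) : ℂ) * g q))
        + (2 * Complex.I * P.γ * c0) * (conj (F q) * ((q.2.2.2 : ℂ) * fderiv ℝ g q e1))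
        + (-(c0 * (P.γ : ℂ) ^ 2)) * (conj (F q) * fderiv ℝ (fun q => fderiv ℝ g q e1) q e1) := by
    intro q
    ring
  simp only [lhs, rhs]
  have split : ∀ {f1 f2 f3 f4 f5 f6 : Config → ℂ} (a1 a2 a3 a4 a5 a6 : ℂ),
      Integrable f1 → Integrable f2 → Integrable f3 → Integrable f4 → Integrable f5 →
      Integrable f6 →
      ∫ q, (a1 * f1 q + a2 * f2 q + a3 * f3 q + a4 * f4 q + a5 * f5 q + a6 * f6 q)
        = a1 * (∫ q, f1 q) + a2 * (∫ q, f2 q) + a3 * (∫ q, f3 q) + a4 * (∫ q, f4 q)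
          + a5 * (∫ q, f5 q) + a6 * ∫ q, f6 q := by
    intro f1 f2 f3 f4 f5 f6 a1 a2 a3 a4 a5 a6 i1 i2 i3 i4 i5 i6
    have j1 := i1.const_mul a1
    have j2 := j1.add (i2.const_mul a2)
    have j3 := j2.add (i3.const_mul a3)
    have j4 := j3.add (i4.const_mul a4)
    have j5 := j4.add (i5.const_mul a5)
    rw [← integral_const_mul, ← integral_const_mul, ← integral_const_mul, ← integral_const_mul,
      ← integral_const_mul, ← integral_const_mul, ← integral_add j1 (i2.const_mul a2)]
    erw [← integral_add j2 (i3.const_mul a3), ← integral_add j3 (i4.const_mul a4),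
      ← integral_add j4 (i5.const_mul a5), ← integral_add j5 (i6.const_mul a6)]
    rfl
  rw [split _ _ _ _ _ _ (iF e3) (iF e2) (iF e4) iv iF1 (iF e1),
    split _ _ _ _ _ _ (ig e3) (ig e2) (ig e4) iv ig1 (ig e1), L2 e1, L2 e2, L2 e3, L2 e4, L1]
  ring

end Params

end IBP

/-! ### Linear changes of variables. -/

theorem measurableEmbedding_clm {E : Type*} [NormedAddCommGroup E] [NormedSpace ℝ E]
    [MeasurableSpace E] [BorelSpace E] (L : E ≃L[ℝ] E) : MeasurableEmbedding L :=
  L.toHomeomorph.measurableEmbedding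

section LinearChange

variable {E : Type*} [NormedAddCommGroup E] [NormedSpace ℝ E] [FiniteDimensional ℝ E]
  [MeasurableSpace E] [BorelSpace E]

/-- By uniqueness of Haar measure. The value of the Jacobian is never needed, since it cancels in
every application; only its positivity matters. -/
theorem exists_map_restrict_eq_smul (μ : Measure E) [μ.IsAddHaarMeasure] (L : E ≃L[ℝ] E) :
    ∃ c : NNReal, 0 < c ∧
      ∀ s : Set E, (μ.restrict (L ⁻¹' s)).map L = (c : ENNReal) • μ.restrict s := by
  have : ProperSpace E := FiniteDimensional.proper ℝ E
  have := L.isAddHaarMeasure_map μ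
  refine ⟨(μ.map L).addHaarScalarFactor μ,
    Measure.addHaarScalarFactor_pos_of_isAddHaarMeasure _ _, fun s => ?_⟩
  have h := Measure.isAddLeftInvariant_eq_smul (μ.map L) μ
  have h2 := L.toHomeomorph.toMeasurableEquiv.restrict_map μ s
  calc (μ.restrict (L ⁻¹' s)).map L = (μ.map L).restrict s := h2.symm
    _ = ((μ.map L).addHaarScalarFactor μ • μ).restrict s := by rw [← h]
    _ = _ := Measure.restrict_smul _ _ _

theorem ae_restrict_comp_iff (μ : Measure E) [μ.IsAddHaarMeasure] (L : E ≃L[ℝ] E) (s : Set E)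
    {p : E → Prop} :
    (∀ᵐ x ∂μ.restrict (L ⁻¹' s), p (L x)) ↔ ∀ᵐ y ∂μ.restrict s, p y := by
  obtain ⟨c, hc, h⟩ := exists_map_restrict_eq_smul μ L
  rw [← (measurableEmbedding_clm L).ae_map_iff, h s,
    Measure.ae_ennreal_smul_measure_iff (by exact_mod_cast hc.ne')]

theorem ae_comp_iff (μ : Measure E) [μ.IsAddHaarMeasure] (L : E ≃L[ℝ] E) {p : E → Prop} :
    (∀ᵐ x ∂μ, p (L x)) ↔ ∀ᵐ y ∂μ, p y := by
  simpa using ae_restrict_comp_iff μ L Set.univ (p := p)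

theorem memLp_comp_iff (μ : Measure E) [μ.IsAddHaarMeasure] (L : E ≃L[ℝ] E) (s : Set E)
    {G : Type*} [NormedAddCommGroup G] {f : E → G} {p : ENNReal} :
    MemLp (fun x => f (L x)) p (μ.restrict (L ⁻¹' s)) ↔ MemLp f p (μ.restrict s) := by
  obtain ⟨c, hc, h⟩ := exists_map_restrict_eq_smul μ L
  have hc' : (c : ENNReal) ≠ 0 := by exact_mod_cast hc.ne'
  have h1 := (measurableEmbedding_clm L).memLp_map_measure_iff
    (μ := μ.restrict (L ⁻¹' s)) (g := f) (p := p)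
  rw [h s] at h1
  refine h1.symm.trans ⟨fun h2 => ?_, fun h2 => h2.smul_measure ENNReal.coe_ne_top⟩
  have h3 := h2.smul_measure (c := (c : ENNReal)⁻¹) (by simpa using hc')
  rwa [smul_smul, ENNReal.inv_mul_cancel hc' ENNReal.coe_ne_top, one_smul] at h3

theorem tendsto_eLpNorm_comp_iff (μ : Measure E) [μ.IsAddHaarMeasure] (L : E ≃L[ℝ] E) (s : Set E)
    {G ι : Type*} [NormedAddCommGroup G] {f : ι → E → G} {l : Filter ι} :
    Tendsto (fun i => eLpNorm (fun x => f i (L x)) 2 (μ.restrict (L ⁻¹' s))) l (𝓝 0) ↔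
      Tendsto (fun i => eLpNorm (f i) 2 (μ.restrict s)) l (𝓝 0) := by
  obtain ⟨c, hc, h⟩ := exists_map_restrict_eq_smul μ L
  have hc' : (c : ENNReal) ≠ 0 := by exact_mod_cast hc.ne'
  set d : ENNReal := (c : ENNReal) ^ (1 / (2 : ENNReal)).toReal with hd
  have hd0 : d ≠ 0 := by
    rw [hd, Ne, ENNReal.rpow_eq_zero_iff]
    simp [hc.ne']
  have hdt : d ≠ ⊤ := by
    rw [hd]
    exact ENNReal.rpow_ne_top_of_nonneg (by positivity) ENNReal.coe_ne_top
  have key : ∀ i, eLpNorm (fun x => f i (L x)) 2 (μ.restrict (L ⁻¹' s))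
      = d * eLpNorm (f i) 2 (μ.restrict s) := by
    intro i
    have h1 := (measurableEmbedding_clm L).eLpNorm_map_measure
      (μ := μ.restrict (L ⁻¹' s)) (g := f i) (p := 2)
    rw [h s, eLpNorm_smul_measure_of_ne_zero hc'] at h1
    exact h1.symm
  simp only [key]
  constructor
  · intro h1
    have h2 := ENNReal.Tendsto.const_mul (a := d⁻¹) h1 (Or.inr (by simpa using hd0))
    simpa only [← mul_assoc, ENNReal.inv_mul_cancel hd0 hdt, one_mul, mul_zero] using h2
  · intro h1
    simpa using ENNReal.Tendsto.const_mul (a := d) h1 (Or.inr hdt)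

theorem exists_setIntegral_comp_eq (μ : Measure E) [μ.IsAddHaarMeasure] (L : E ≃L[ℝ] E) :
    ∃ c : ℝ, 0 < c ∧ ∀ (s : Set E) (f : E → ℂ),
      ∫ x in L ⁻¹' s, f (L x) ∂μ = c * ∫ y in s, f y ∂μ := by
  obtain ⟨c, hc, h⟩ := exists_map_restrict_eq_smul μ L
  refine ⟨c, by exact_mod_cast hc, fun s f => ?_⟩
  have h1 := (measurableEmbedding_clm L).integral_map (μ := μ.restrict (L ⁻¹' s)) f
  rw [h s, integral_smul_measure] at h1
  rw [← h1]
  simp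

theorem exists_integral_comp_eq (μ : Measure E) [μ.IsAddHaarMeasure] (L : E ≃L[ℝ] E) :
    ∃ c : ℝ, 0 < c ∧ ∀ f : E → ℂ, ∫ x, f (L x) ∂μ = c * ∫ y, f y ∂μ := by
  obtain ⟨c, hc, h⟩ := exists_setIntegral_comp_eq μ L
  exact ⟨c, hc, fun f => by simpa using h Set.univ f⟩

end LinearChange

/-! ### The unit cube, its characters, and the strip with coordinates `(v, t)`. -/

/-- The half-open unit cube. -/
def cube : Set Space := Set.Ico 0 1 ×ˢ Set.Ico 0 1 ×ˢ Set.Ico 0 1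

/-- Lebesgue measure on the unit cube. -/
noncomputable def cubeMeasure : Measure Space := volume.restrict cube

/-- Lebesgue measure on the product of the real line and the unit cube. -/
noncomputable def stripMeasure : Measure Config := (volume : Measure ℝ).prod cubeMeasure

theorem cubeMeasure_eq_prod :
    cubeMeasure = ((volume : Measure ℝ).restrict (Set.Ico 0 1)).prod
      (((volume : Measure ℝ).restrict (Set.Ico 0 1)).prod
        ((volume : Measure ℝ).restrict (Set.Ico 0 1))) := by
  rw [Measure.prod_restrict, Measure.prod_restrict]
  rfl

theorem stripMeasure_eq_restrict : stripMeasure = volume.restrict (Set.univ ×ˢ cube) := by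
  rw [stripMeasure, cubeMeasure]
  conv_lhs => rw [← Measure.restrict_univ (μ := (volume : Measure ℝ))]
  rw [Measure.prod_restrict]
  rfl

instance : IsProbabilityMeasure ((volume : Measure ℝ).restrict (Set.Ico 0 1)) :=
  ⟨by simp⟩

instance : IsProbabilityMeasure cubeMeasure := by
  rw [cubeMeasure_eq_prod]
  infer_instance

theorem measurableSet_cube : MeasurableSet cube :=
  measurableSet_Ico.prod (measurableSet_Ico.prod measurableSet_Ico)

/-- The function `exp(2πi n · t)`. -/
noncomputable def torusExp (n : LatticeIndex) (t : Space) : ℂ :=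
  Complex.exp (Complex.I *
    ((2 * Real.pi * (n.1 * t.1 + n.2.1 * t.2.1 + n.2.2 * t.2.2) : ℝ) : ℂ))

theorem continuous_torusExp (n : LatticeIndex) : Continuous (torusExp n) := by
  unfold torusExp
  fun_prop

theorem norm_exp_I_mul_ofReal (x : ℝ) : ‖Complex.exp (Complex.I * (x : ℂ))‖ = 1 := by
  rw [mul_comm, Complex.norm_exp_ofReal_mul_I]

theorem norm_torusExp (n : LatticeIndex) (t : Space) : ‖torusExp n t‖ = 1 :=
  norm_exp_I_mul_ofReal _

theorem torusExp_sub (m n : LatticeIndex) (t : Space) :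
    torusExp (m - n) t = conj (torusExp n t) * torusExp m t := by
  rw [torusExp, torusExp, torusExp, ← Complex.exp_conj, ← Complex.exp_add]
  congr 1
  simp only [map_mul, Complex.conj_I, Complex.conj_ofReal, Prod.fst_sub, Prod.snd_sub]
  push_cast
  ring

/-- The embedding of lattice indices into space. -/
def intVec (n : LatticeIndex) : Space := (n.1, n.2.1, n.2.2)

theorem exp_I_two_pi_int (k : ℤ) : Complex.exp (Complex.I * ((2 * Real.pi * k : ℝ) : ℂ)) = 1 := by
  rw [Complex.exp_eq_one_iff]
  exact ⟨k, by push_cast; ring⟩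

theorem torusExp_add_intVec (n m : LatticeIndex) (t : Space) :
    torusExp n (t + intVec m) = torusExp n t := by
  rw [torusExp, torusExp]
  have e : (2 * Real.pi * (n.1 * (t + intVec m).1 + n.2.1 * (t + intVec m).2.1
      + n.2.2 * (t + intVec m).2.2) : ℝ)
      = 2 * Real.pi * (n.1 * t.1 + n.2.1 * t.2.1 + n.2.2 * t.2.2)
        + 2 * Real.pi * ((n.1 * m.1 + n.2.1 * m.2.1 + n.2.2 * m.2.2 : ℤ) : ℝ) := by
    simp only [intVec, Prod.fst_add, Prod.snd_add]
    push_cast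
    ring
  rw [e, Complex.ofReal_add, mul_add, Complex.exp_add, exp_I_two_pi_int, mul_one]

/-- The componentwise fractional part. -/
noncomputable def fractVec (t : Space) : Space := (Int.fract t.1, Int.fract t.2.1, Int.fract t.2.2)

/-- The componentwise integer part. -/
noncomputable def floorVec (t : Space) : LatticeIndex := (⌊t.1⌋, ⌊t.2.1⌋, ⌊t.2.2⌋)

theorem fractVec_add_floorVec (t : Space) : fractVec t + intVec (floorVec t) = t := by
  simp [fractVec, intVec, floorVec, Int.fract_add_floor]

theorem fractVec_mem_cube (t : Space) : fractVec t ∈ cube :=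
  ⟨⟨Int.fract_nonneg _, Int.fract_lt_one _⟩, ⟨Int.fract_nonneg _, Int.fract_lt_one _⟩,
    ⟨Int.fract_nonneg _, Int.fract_lt_one _⟩⟩

theorem measurable_fractVec : Measurable fractVec := by
  unfold fractVec
  fun_prop

theorem fractVec_of_mem {t : Space} (ht : t ∈ cube) : fractVec t = t := by
  obtain ⟨h1, h2, h3⟩ := ht
  refine Prod.ext (Int.fract_eq_self.2 h1) (Prod.ext (Int.fract_eq_self.2 h2)
    (Int.fract_eq_self.2 h3))

theorem fractVec_add_intVec (t : Space) (n : LatticeIndex) :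
    fractVec (t + intVec n) = fractVec t := by
  simp [fractVec, intVec]

theorem torusExp_fractVec (n : LatticeIndex) (t : Space) :
    torusExp n (fractVec t) = torusExp n t := by
  conv_rhs => rw [← fractVec_add_floorVec t, torusExp_add_intVec]

theorem ae_stripMeasure_mem : ∀ᵐ x ∂stripMeasure, x.2 ∈ cube := by
  rw [stripMeasure_eq_restrict]
  filter_upwards [ae_restrict_mem (MeasurableSet.univ.prod measurableSet_cube)] with x hx
  exact hx.2

/-! ### The Hilbert basis of the strip. -/

section Basis

theorem integral_conj_exp_mul_exp (m n : ℤ) :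
    ∫ t in Set.Ico (0 : ℝ) 1, conj (Complex.exp (Complex.I * ((2 * Real.pi * (m * t) : ℝ) : ℂ)))
      * Complex.exp (Complex.I * ((2 * Real.pi * (n * t) : ℝ) : ℂ)) = if m = n then 1 else 0 := by
  have h1 : ∀ t : ℝ, conj (Complex.exp (Complex.I * ((2 * Real.pi * (m * t) : ℝ) : ℂ)))
      * Complex.exp (Complex.I * ((2 * Real.pi * (n * t) : ℝ) : ℂ))
      = Complex.exp (2 * Real.pi * Complex.I * ((n - m : ℤ) : ℂ) * t) := by
    intro t
    rw [← Complex.exp_conj, ← Complex.exp_add]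
    congr 1
    simp only [map_mul, Complex.conj_I, Complex.conj_ofReal]
    push_cast
    ring
  simp only [h1]
  rw [restrict_Ico_eq_restrict_Ioc, ← intervalIntegral.integral_of_le zero_le_one]
  split_ifs with h
  · simp [h]
  · have h2 : (2 * Real.pi * Complex.I * ((n - m : ℤ) : ℂ)) ≠ 0 :=
      mul_ne_zero Complex.two_pi_I_ne_zero (by exact_mod_cast sub_ne_zero.2 (Ne.symm h))
    rw [integral_exp_mul_complex h2]
    have h3 : Complex.exp (2 * Real.pi * Complex.I * ((n - m : ℤ) : ℂ) * ((1 : ℝ) : ℂ)) = 1 :=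
      Complex.exp_eq_one_iff.2 ⟨n - m, by push_cast; ring⟩
    rw [h3]
    simp

theorem torusExp_eq_mul (n : LatticeIndex) (t : Space) :
    torusExp n t = Complex.exp (Complex.I * ((2 * Real.pi * (n.1 * t.1) : ℝ) : ℂ)) *
      (Complex.exp (Complex.I * ((2 * Real.pi * (n.2.1 * t.2.1) : ℝ) : ℂ)) *
        Complex.exp (Complex.I * ((2 * Real.pi * (n.2.2 * t.2.2) : ℝ) : ℂ))) := by
  rw [torusExp, ← Complex.exp_add, ← Complex.exp_add]
  congr 1
  push_cast
  ring

theorem integral_conj_torusExp_mul (m n : LatticeIndex) :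
    ∫ t, conj (torusExp m t) * torusExp n t ∂cubeMeasure = if m = n then 1 else 0 := by
  have h1 : ∀ t : Space, conj (torusExp m t) * torusExp n t
      = (conj (Complex.exp (Complex.I * ((2 * Real.pi * (m.1 * t.1) : ℝ) : ℂ)))
        * Complex.exp (Complex.I * ((2 * Real.pi * (n.1 * t.1) : ℝ) : ℂ))) *
      ((conj (Complex.exp (Complex.I * ((2 * Real.pi * (m.2.1 * t.2.1) : ℝ) : ℂ)))
        * Complex.exp (Complex.I * ((2 * Real.pi * (n.2.1 * t.2.1) : ℝ) : ℂ))) *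
      (conj (Complex.exp (Complex.I * ((2 * Real.pi * (m.2.2 * t.2.2) : ℝ) : ℂ)))
        * Complex.exp (Complex.I * ((2 * Real.pi * (n.2.2 * t.2.2) : ℝ) : ℂ)))) := by
    intro t
    rw [torusExp_eq_mul, torusExp_eq_mul]
    simp only [map_mul]
    ring
  simp only [h1]
  rw [cubeMeasure_eq_prod]
  rw [integral_prod_mul (fun t : ℝ =>
      conj (Complex.exp (Complex.I * ((2 * Real.pi * (m.1 * t) : ℝ) : ℂ)))
        * Complex.exp (Complex.I * ((2 * Real.pi * (n.1 * t) : ℝ) : ℂ)))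
    (fun t : ℝ × ℝ => (conj (Complex.exp (Complex.I * ((2 * Real.pi * (m.2.1 * t.1) : ℝ) : ℂ)))
        * Complex.exp (Complex.I * ((2 * Real.pi * (n.2.1 * t.1) : ℝ) : ℂ))) *
      (conj (Complex.exp (Complex.I * ((2 * Real.pi * (m.2.2 * t.2) : ℝ) : ℂ)))
        * Complex.exp (Complex.I * ((2 * Real.pi * (n.2.2 * t.2) : ℝ) : ℂ)))),
    integral_prod_mul (fun t : ℝ =>
      conj (Complex.exp (Complex.I * ((2 * Real.pi * (m.2.1 * t) : ℝ) : ℂ)))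
        * Complex.exp (Complex.I * ((2 * Real.pi * (n.2.1 * t) : ℝ) : ℂ)))
    (fun t : ℝ => conj (Complex.exp (Complex.I * ((2 * Real.pi * (m.2.2 * t) : ℝ) : ℂ)))
        * Complex.exp (Complex.I * ((2 * Real.pi * (n.2.2 * t) : ℝ) : ℂ))),
    integral_conj_exp_mul_exp, integral_conj_exp_mul_exp, integral_conj_exp_mul_exp]
  have e : m = n ↔ m.1 = n.1 ∧ m.2.1 = n.2.1 ∧ m.2.2 = n.2.2 := by
    simp only [Prod.ext_iff]
  simp only [e]
  split_ifs <;> simp_all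

theorem SeparatesL2.of_exists {X ι ι' : Type*} [MeasurableSpace X] {μ : Measure X}
    {f : ι → X → ℂ} {g : ι' → X → ℂ}
    (hf : SeparatesL2 μ f) (h : ∀ a, ∃ b, f a = g b) : SeparatesL2 μ g := by
  intro F hF horth
  refine hf F hF fun a => ?_
  obtain ⟨b, hb⟩ := h a
  rw [hb]
  exact horth b

theorem memLp_torusExp (n : LatticeIndex) (p : ENNReal) : MemLp (torusExp n) p cubeMeasure :=
  MemLp.of_bound (continuous_torusExp n).aestronglyMeasurable 1
    (Eventually.of_forall fun t => (norm_torusExp n t).le)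

theorem torusExp_separatesL2 : SeparatesL2 cubeMeasure torusExp := by
  have hm : ∀ n : ℤ, MemLp (fun t : ℝ => Complex.exp (Complex.I * ((2 * Real.pi * (n * t) : ℝ) : ℂ)))
      2 ((volume : Measure ℝ).restrict (Set.Ico 0 1)) := fun n =>
    MemLp.of_bound (by fun_prop) 1
      (Eventually.of_forall fun t => (norm_exp_I_mul_ofReal _).le)
  have h2 := SeparatesL2.prod (ι := ℤ) (β := ℤ) hm (fun _ n => hm n) fourierExp_separatesL2
    (fun _ => fourierExp_separatesL2)
  have h3 := SeparatesL2.prod (ι := ℤ × ℤ) (β := ℤ) (fun a => memLp_two_mul_prod (hm a.2) (hm a.1))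
    (fun _ n => hm n) h2 (fun _ => fourierExp_separatesL2)
  rw [cubeMeasure_eq_prod]
  -- `SeparatesL2.prod` puts the new variable in front and its index at the end, hence the reversal.
  refine h3.of_exists fun a => ⟨(a.2, a.1.2, a.1.1), ?_⟩
  ext t
  rw [torusExp_eq_mul]

namespace Params

variable (P : Params)

/-- The basis functions in the coordinates `(v, t)`. -/
noncomputable def cellMode (k : Space) (c : LatticeIndex × ℕ) (x : Config) : ℂ :=
  P.phi c.2 (x.1 - P.A k.1 c.1.1) * torusExp c.1 x.2

theorem memLp_phi_sub (j : ℕ) (a : ℝ) : MemLp (fun v => P.phi j (v - a)) 2 :=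
  (P.memLp_phi j).comp_measurePreserving (measurePreserving_sub_right volume a)

theorem phi_sub_separatesL2 (a : ℝ) : SeparatesL2 volume (fun j v => P.phi j (v - a)) := by
  intro h hh horth
  have h1 : MemLp (fun s => h (s + a)) 2 :=
    hh.comp_measurePreserving (measurePreserving_add_right volume a)
  have h2 := P.phi_separatesL2 _ h1 fun j => by
    rw [← horth j, ← integral_sub_right_eq_self (fun s => conj (P.phi j s) * h (s + a)) a]
    simp
  have h3 := (measurePreserving_sub_right (volume : Measure ℝ) a).quasiMeasurePreserving.ae h2
  filter_upwards [h3] with x hx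
  simpa using hx

theorem memLp_cellMode (k : Space) (c : LatticeIndex × ℕ) :
    MemLp (P.cellMode k c) 2 stripMeasure :=
  memLp_two_mul_prod (P.memLp_phi_sub c.2 _) (memLp_torusExp c.1 2)

/-- The dependent form of the product lemma is used here: for each `n` the oscillator functions are
complete about their own centre `A_n`. -/
theorem cellMode_separatesL2 (k : Space) : SeparatesL2 stripMeasure (P.cellMode k) :=
  SeparatesL2.prod (fun n => memLp_torusExp n 2) (fun n j => P.memLp_phi_sub j (P.A k.1 n.1))
    torusExp_separatesL2 (fun n => P.phi_sub_separatesL2 (P.A k.1 n.1))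

/-- Oscillator functions with different centres are not orthogonal, but they only meet for different
`n`, where the torus factor vanishes. -/
theorem integral_conj_cellMode_mul (k : Space) (c d : LatticeIndex × ℕ) :
    ∫ x, conj (P.cellMode k c x) * P.cellMode k d x ∂stripMeasure = if c = d then 1 else 0 := by
  have h1 : ∀ x : Config, conj (P.cellMode k c x) * P.cellMode k d x
      = (conj (P.phi c.2 (x.1 - P.A k.1 c.1.1)) * P.phi d.2 (x.1 - P.A k.1 d.1.1)) *
        (conj (torusExp c.1 x.2) * torusExp d.1 x.2) := by
    intro x
    simp only [cellMode, map_mul]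
    ring
  simp only [h1]
  rw [stripMeasure, integral_prod_mul
    (fun v : ℝ => conj (P.phi c.2 (v - P.A k.1 c.1.1)) * P.phi d.2 (v - P.A k.1 d.1.1))
    (fun t => conj (torusExp c.1 t) * torusExp d.1 t), integral_conj_torusExp_mul]
  by_cases h : c.1 = d.1
  · rw [h, integral_sub_right_eq_self (fun v => conj (P.phi c.2 v) * P.phi d.2 v)]
    have h2 := P.braket_phi c.2 d.2
    rw [braket] at h2
    rw [h2]
    have e : c = d ↔ c.2 = d.2 := by simp [Prod.ext_iff, h]
    simp [e]
  · rw [if_neg h, if_neg (fun e => h (by rw [e])), mul_zero]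

/-- The basis functions as a Hilbert basis. -/
noncomputable def modeBasis (k : Space) :
    HilbertBasis (LatticeIndex × ℕ) ℂ (Lp ℂ 2 stripMeasure) :=
  HilbertBasis.mkOfOrthogonalEqBot
    (v := fun c => (P.memLp_cellMode k c).toLp (P.cellMode k c))
    (by
      rw [orthonormal_iff_ite]
      intro c d
      rw [inner_toLp, P.integral_conj_cellMode_mul])
    (by
      rw [Submodule.eq_bot_iff]
      intro x hx
      have h1 := P.cellMode_separatesL2 k x (Lp.memLp x) fun c => by
        rw [← inner_toLp (P.memLp_cellMode k c) (Lp.memLp x), Lp.toLp_coeFn]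
        exact (Submodule.mem_orthogonal _ _).1 hx _ (Submodule.subset_span ⟨c, rfl⟩)
      exact (Lp.eq_zero_iff_ae_eq_zero).2 h1)

theorem modeBasis_apply (k : Space) (c : LatticeIndex × ℕ) :
    P.modeBasis k c = (P.memLp_cellMode k c).toLp (P.cellMode k c) := by
  rw [modeBasis, HilbertBasis.coe_mkOfOrthogonalEqBot]

/-- The coefficient of a function with respect to the basis function of index `c`. -/
noncomputable def modeCoeff (k : Space) (f : Config → ℂ) (c : LatticeIndex × ℕ) : ℂ :=
  ∫ x, conj (P.cellMode k c x) * f x ∂stripMeasure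

theorem modeBasis_repr_toLp (k : Space) {f : Config → ℂ} (hf : MemLp f 2 stripMeasure)
    (c : LatticeIndex × ℕ) : (P.modeBasis k).repr (hf.toLp f) c = P.modeCoeff k f c := by
  rw [HilbertBasis.repr_apply_apply, modeBasis_apply, inner_toLp, modeCoeff]

theorem summable_norm_sq_modeCoeff (k : Space) {f : Config → ℂ} (hf : MemLp f 2 stripMeasure) :
    Summable fun c => ‖P.modeCoeff k f c‖ ^ 2 := by
  have h := lp.memℓp ((P.modeBasis k).repr (hf.toLp f))
  have h2 := h.summable (by norm_num)
  simpa [modeBasis_repr_toLp] using h2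

theorem hasSum_inner_modeCoeff (k : Space) {f g : Config → ℂ} (hf : MemLp f 2 stripMeasure)
    (hg : MemLp g 2 stripMeasure) :
    HasSum (fun c => conj (P.modeCoeff k f c) * P.modeCoeff k g c)
      (∫ x, conj (f x) * g x ∂stripMeasure) := by
  have h := (P.modeBasis k).hasSum_inner_mul_inner (hf.toLp f) (hg.toLp g)
  rw [inner_toLp] at h
  convert! h using 2 with c
  rw [← inner_conj_symm, modeBasis_apply, inner_toLp, inner_toLp]
  rfl

end Params

end Basis

/-! ### Lattice coordinates and the expansion of Bloch amplitudes. -/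

namespace Params

variable (P : Params)

theorem sin_θ_pos : 0 < Real.sin P.θ := Real.sin_pos_of_pos_of_lt_pi P.θ_pos P.θ_lt_pi

/-- The linear map `(v, t) ↦ (x, w, z, v)` given by the primitive polaritonic lattice vectors. -/
noncomputable def latLinear : Config ≃ₗ[ℝ] Config where
  toFun x := ((P.polLatticeComb x.2.1 x.2.2.1 x.2.2.2).1,
    (P.polLatticeComb x.2.1 x.2.2.1 x.2.2.2).2.1, (P.polLatticeComb x.2.1 x.2.2.1 x.2.2.2).2.2, x.1)
  map_add' p q := by
    simp only [polLatticeComb, Prod.fst_add, Prod.snd_add, Prod.mk_add_mk]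
    ext <;> simp only <;> ring
  map_smul' c p := by
    simp only [polLatticeComb, Prod.smul_fst, Prod.smul_snd, smul_eq_mul,
      RingHom.id_apply, Prod.smul_mk]
    ext <;> simp only <;> ring
  invFun q := (q.2.2.2,
    (q.1 - q.2.1 / (Real.sqrt 2 * P.ωc) / (P.a₂ * Real.sin P.θ) * (P.a₂ * Real.cos P.θ)) / P.a₁,
    q.2.1 / (Real.sqrt 2 * P.ωc) / (P.a₂ * Real.sin P.θ), q.2.2.1 / P.a₃)
  left_inv p := by
    have h1 := P.a₁_pos.ne'
    have h2 := P.a₂_pos.ne'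
    have h3 := P.a₃_pos.ne'
    have h4 := P.ωc_pos.ne'
    have h5 := P.sin_θ_pos.ne'
    have h6 := sqrt_two_ne
    simp only [polLatticeComb]
    refine Prod.ext rfl (Prod.ext ?_ (Prod.ext ?_ ?_)) <;> simp only <;> field_simp <;> ring
  right_inv p := by
    have h1 := P.a₁_pos.ne'
    have h2 := P.a₂_pos.ne'
    have h3 := P.a₃_pos.ne'
    have h4 := P.ωc_pos.ne'
    have h5 := P.sin_θ_pos.ne'
    have h6 := sqrt_two_ne
    simp only [polLatticeComb]
    refine Prod.ext ?_ (Prod.ext ?_ (Prod.ext ?_ ?_)) <;> simp only <;> field_simp <;> ring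

/-- The map `(v, t) ↦ (x, w, z, v)` as a continuous linear equivalence. -/
noncomputable def latEquiv : Config ≃L[ℝ] Config := P.latLinear.toContinuousLinearEquiv

theorem latEquiv_apply (x : Config) :
    P.latEquiv x = (x.2.1 * P.a₁ + x.2.2.1 * (P.a₂ * Real.cos P.θ),
      Real.sqrt 2 * P.ωc * (x.2.2.1 * (P.a₂ * Real.sin P.θ)), x.2.2.2 * P.a₃, x.1) := rfl

theorem latEquiv_preimage_polCell : P.latEquiv ⁻¹' P.polCell = Set.univ ×ˢ cube := by
  ext x
  constructor
  · rintro ⟨t₁, h1, t₂, h2, t₃, h3, h⟩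
    have e : P.latEquiv x = P.latEquiv (x.1, t₁, t₂, t₃) := by
      simp only [latEquiv_apply]
      simp only [latEquiv_apply, polLatticeComb, Prod.mk.injEq] at h
      obtain ⟨e1, e2, e3⟩ := h
      rw [e1, e2, e3]
    have e2 := P.latEquiv.injective e
    refine ⟨trivial, ?_⟩
    rw [e2]
    exact ⟨h1, h2, h3⟩
  · rintro ⟨-, h1, h2, h3⟩
    exact ⟨_, h1, _, h2, _, h3, rfl⟩

/-- Duality of the lattice and the reciprocal lattice: `G^w_n · r_w = 2π n · t`. -/
theorem planeWave_latEquiv (n : LatticeIndex) (x : Config) :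
    P.planeWave n (P.latEquiv x) = torusExp n x.2 := by
  have h1 := P.a₁_pos.ne'
  have h2 := P.a₂_pos.ne'
  have h3 := P.a₃_pos.ne'
  have h4 := P.ωc_pos.ne'
  have h5 := P.sin_θ_pos.ne'
  have h6 := sqrt_two_ne
  rw [planeWave, torusExp, latEquiv_apply]
  congr 3
  simp only [Gx, Gw, Gmn, Gy, Gz]
  field_simp
  ring

theorem polTranslate_latEquiv (n : LatticeIndex) (x : Config) :
    P.polTranslate n (P.latEquiv x) = P.latEquiv (x.1, x.2 + intVec n) := by
  simp only [polTranslate, latEquiv_apply, polLatticeComb, intVec, Prod.fst_add, Prod.snd_add]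
  refine Prod.ext ?_ (Prod.ext ?_ (Prod.ext ?_ ?_)) <;> simp only <;> ring

theorem memLp_polCell_iff {u : Config → ℂ} :
    MemLp u 2 (volume.restrict P.polCell) ↔ MemLp (fun x => u (P.latEquiv x)) 2 stripMeasure := by
  rw [stripMeasure_eq_restrict, ← P.latEquiv_preimage_polCell]
  exact (memLp_comp_iff volume P.latEquiv P.polCell).symm

theorem ae_latEquiv_iff {p : Config → Prop} : (∀ᵐ x, p (P.latEquiv x)) ↔ ∀ᵐ q, p q :=
  ae_comp_iff volume P.latEquiv

theorem hasPolaritonExpansion_iff_hasSum {k : Space} {u : Config → ℂ} {U : LatticeIndex × ℕ → ℂ}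
    (hu : MemLp (fun x => u (P.latEquiv x)) 2 stripMeasure) :
    P.HasPolaritonExpansion k u U ↔
      HasSum (fun c => U c • P.modeBasis k c) (hu.toLp (fun x => u (P.latEquiv x))) := by
  rw [HasPolaritonExpansion, ← tendsto_eLpNorm_comp_iff volume P.latEquiv P.polCell,
    P.latEquiv_preimage_polCell, ← stripMeasure_eq_restrict]
  have hs : ∀ S : Finset (LatticeIndex × ℕ),
      MemLp (fun x => ∑ c ∈ S, U c * P.cellMode k c x) 2 stripMeasure := fun S =>
    memLp_finsetSum _ fun c _ => (P.memLp_cellMode k c).const_mul (U c)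
  have e : (fun S : Finset (LatticeIndex × ℕ) => ∑ c ∈ S, U c • P.modeBasis k c)
      = fun S => (hs S).toLp _ := by
    ext1 S
    refine Lp.ext ?_
    refine EventuallyEq.trans ?_ (hs S).coeFn_toLp.symm
    refine (Lp.coeFn_finsetSum _ _).trans ?_
    have h1 : ∀ c : LatticeIndex × ℕ, ((U c • P.modeBasis k c : Lp ℂ 2 stripMeasure) : Config → ℂ)
        =ᵐ[stripMeasure] fun x => U c * P.cellMode k c x := by
      intro c
      rw [modeBasis_apply]
      filter_upwards [Lp.coeFn_smul (U c) ((P.memLp_cellMode k c).toLp _),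
        (P.memLp_cellMode k c).coeFn_toLp] with x h2 h3
      rw [h2, Pi.smul_apply, h3, smul_eq_mul]
    filter_upwards [ae_all_iff.2 h1] with x hx
    simp only [Finset.sum_apply, hx]
  rw [HasSum, SummationFilter.unconditional_filter, e, Lp.tendsto_Lp_iff_tendsto_eLpNorm'' _ hs]
  refine tendsto_congr fun S => ?_
  rw [← eLpNorm_neg]
  refine eLpNorm_congr_ae (Eventually.of_forall fun x => ?_)
  simp only [Pi.neg_apply, Pi.sub_apply, neg_sub, P.planeWave_latEquiv]
  have h2 : ∀ c ∈ S, U c * (torusExp c.1 x.2 * P.phi c.2 ((P.latEquiv x).2.2.2 - P.A k.1 c.1.1))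
      = U c * P.cellMode k c x := fun c _ => by
    rw [cellMode, latEquiv_apply]
    ring
  rw [Finset.sum_congr rfl h2]

/-- The `L²` sum in the definition is an unconditional Hilbert basis expansion on the strip, so its
coefficients are forced to be the inner products. -/
theorem hasPolaritonExpansion_iff {k : Space} {u : Config → ℂ} {U : LatticeIndex × ℕ → ℂ}
    (hu : P.IsBlochAmplitude u) :
    P.HasPolaritonExpansion k u U ↔ U = P.modeCoeff k (fun x => u (P.latEquiv x)) := by
  have hu' := P.memLp_polCell_iff.1 hu.2
  rw [P.hasPolaritonExpansion_iff_hasSum hu']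
  constructor
  · intro h
    ext c
    rw [← P.modeBasis_repr_toLp k hu', HilbertBasis.repr_apply_apply]
    have h1 := h.mapL (innerSL ℂ (P.modeBasis k c))
    have h2 := hasSum_single (f := fun d => innerSL ℂ (P.modeBasis k c) (U d • P.modeBasis k d)) c
      fun d hd => by
        have h3 := (orthonormal_iff_ite.1 (P.modeBasis k).orthonormal) c d
        simp [h3, hd.symm]
    have h4 := h1.unique h2
    have h3 := (orthonormal_iff_ite.1 (P.modeBasis k).orthonormal) c c
    simp only [innerSL_apply_apply, inner_smul_right, h3] at h4
    simpa using h4.symm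
  · rintro rfl
    have h := (P.modeBasis k).hasSum_repr (hu'.toLp _)
    simpa only [modeBasis_repr_toLp] using h

theorem existsUnique_hasPolaritonExpansion (k : Space) {u : Config → ℂ}
    (hu : P.IsBlochAmplitude u) : ∃! U, P.HasPolaritonExpansion k u U := by
  simp only [P.hasPolaritonExpansion_iff hu]
  exact existsUnique_eq

theorem exists_isBlochAmplitude_iff (k : Space) (U : LatticeIndex × ℕ → ℂ) :
    (∃ u, P.IsBlochAmplitude u ∧ P.HasPolaritonExpansion k u U) ↔
      Summable fun c => ‖U c‖ ^ 2 := by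
  constructor
  · rintro ⟨u, hu, hU⟩
    rw [P.hasPolaritonExpansion_iff hu] at hU
    rw [hU]
    exact P.summable_norm_sq_modeCoeff k (P.memLp_polCell_iff.1 hu.2)
  · intro h
    have hm : Memℓp U 2 := memℓp_gen (by simpa using h)
    set g : Lp ℂ 2 stripMeasure := (P.modeBasis k).repr.symm ⟨U, hm⟩ with hg
    -- The `L²` class on the strip is extended to all of space through fractional parts, which makes
    -- it periodic everywhere.
    set u : Config → ℂ := fun q =>
      g ((P.latEquiv.symm q).1, fractVec (P.latEquiv.symm q).2) with hu
    have e1 : (fun x => u (P.latEquiv x)) = fun x => g (x.1, fractVec x.2) := by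
      ext x
      simp [hu]
    have e2 : (fun x => u (P.latEquiv x)) =ᵐ[stripMeasure] g := by
      rw [e1]
      filter_upwards [ae_stripMeasure_mem] with x hx
      rw [fractVec_of_mem hx]
    have hu2 : MemLp (fun x => u (P.latEquiv x)) 2 stripMeasure := (memLp_congr_ae e2).2 (Lp.memLp g)
    have hB : P.IsBlochAmplitude u := by
      refine ⟨fun n => ?_, P.memLp_polCell_iff.2 hu2⟩
      rw [← P.ae_latEquiv_iff]
      refine Eventually.of_forall fun x => ?_
      rw [P.polTranslate_latEquiv, congrFun e1, congrFun e1, fractVec_add_intVec]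
    refine ⟨u, hB, (P.hasPolaritonExpansion_iff hB).2 ?_⟩
    ext c
    rw [← P.modeBasis_repr_toLp k hu2]
    have e3 : hu2.toLp _ = g := by
      refine Lp.ext ?_
      exact hu2.coeFn_toLp.trans e2
    rw [e3, hg, LinearIsometryEquiv.apply_symm_apply]

theorem ae_eq_zero_iff_modeCoeff (k : Space) {u : Config → ℂ} (hu : P.IsBlochAmplitude u) :
    (∀ᵐ q, u q = 0) ↔ P.modeCoeff k (fun x => u (P.latEquiv x)) = 0 := by
  have hu' := P.memLp_polCell_iff.1 hu.2
  have hac : stripMeasure ≪ volume := by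
    rw [stripMeasure_eq_restrict]
    exact Measure.absolutelyContinuous_of_le Measure.restrict_le_self
  constructor
  · intro h
    have h1 := hac.ae_le (P.ae_latEquiv_iff.2 h)
    ext c
    rw [modeCoeff, Pi.zero_apply]
    refine integral_eq_zero_of_ae ?_
    filter_upwards [h1] with x hx
    simp [hx]
  · intro h
    have h1 := P.cellMode_separatesL2 k _ hu' fun c => congrFun h c
    rw [← P.ae_latEquiv_iff]
    have h2 : ∀ᵐ x : Config, ∀ n : LatticeIndex,
        u (P.latEquiv (x.1, x.2 + intVec n)) = u (P.latEquiv x) := by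
      rw [ae_all_iff]
      intro n
      have := P.ae_latEquiv_iff.2 (hu.1 n)
      simpa only [P.polTranslate_latEquiv] using this
    rw [stripMeasure_eq_restrict, Filter.EventuallyEq,
      ae_restrict_iff' (MeasurableSet.univ.prod measurableSet_cube)] at h1
    -- One null set serves all integer translates. Almost every point may then be moved into the
    -- strip by its integer part, where `u` is already known to vanish.
    have h3 : ∀ᵐ x : Config, ∀ n : LatticeIndex, (x.1, x.2 + intVec n) ∈ Set.univ ×ˢ cube →
        u (P.latEquiv (x.1, x.2 + intVec n)) = 0 := by
      rw [ae_all_iff]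
      intro n
      have h4 := (measurePreserving_add_right (volume : Measure Config)
        (0, intVec n)).quasiMeasurePreserving.ae h1
      filter_upwards [h4] with x hx hx2
      have e : x + (0, intVec n) = (x.1, x.2 + intVec n) := by
        refine Prod.ext (by simp) (by simp)
      rw [e] at hx
      exact hx hx2
    filter_upwards [h2, h3] with x hx2 hx3
    rw [← hx2 (-floorVec x.2)]
    refine hx3 _ ⟨trivial, ?_⟩
    have e : x.2 + intVec (-floorVec x.2) = fractVec x.2 := by
      have e1 := fractVec_add_floorVec x.2
      have e2 : intVec (-floorVec x.2) = -intVec (floorVec x.2) := by simp [intVec]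
      rw [e2, ← sub_eq_add_neg, sub_eq_iff_eq_add, e1]
    rw [e]
    exact fractVec_mem_cube _

end Params

/-! ### The shear of the cell and the matrix elements of the potential. -/

theorem measurePreserving_fract_add (b : ℝ) :
    MeasurePreserving (fun t : ℝ => Int.fract (t + b)) (volume.restrict (Set.Ico (0 : ℝ) 1))
      (volume.restrict (Set.Ico (0 : ℝ) 1)) := by
  have hm : Measurable fun t : ℝ => Int.fract (t + b) := by fun_prop
  refine ⟨hm, ?_⟩
  ext s hs
  rw [Measure.map_apply hm hs, Measure.restrict_apply (hm hs), Measure.restrict_apply hs]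
  set A : Set ℝ := Int.fract ⁻¹' s with hA
  have hAm : MeasurableSet A := measurable_fract hs
  have hinv : ∀ g : AddSubgroup.zmultiples (1 : ℝ), (fun x => g +ᵥ x) ⁻¹' A = A := by
    rintro ⟨g, hg⟩
    obtain ⟨k, rfl⟩ := AddSubgroup.mem_zmultiples_iff.1 hg
    ext x
    simp only [hA, Set.mem_preimage, AddSubgroup.vadd_def, vadd_eq_add, zsmul_eq_mul, mul_one]
    rw [Int.fract_intCast_add]
  have h1 : ∀ a : ℝ, volume (A ∩ Set.Ico a (a + 1)) = volume (A ∩ Set.Ioc a (a + 1)) := fun a =>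
    measure_congr ((ae_eq_refl A).inter Ico_ae_eq_Ioc)
  -- `A` is invariant under integer translations, so it meets every fundamental domain of `ℤ` in the
  -- same measure.
  have h2 : volume (A ∩ Set.Ioc b (b + 1)) = volume (A ∩ Set.Ioc 0 (0 + 1)) :=
    IsAddFundamentalDomain.measure_set_eq (isAddFundamentalDomain_Ioc one_pos b)
      (isAddFundamentalDomain_Ioc one_pos 0) hAm hinv
  have e1 : (fun t : ℝ => Int.fract (t + b)) ⁻¹' s ∩ Set.Ico 0 1
      = (fun t : ℝ => t + b) ⁻¹' (A ∩ Set.Ico b (b + 1)) := by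
    ext t
    simp only [hA, Set.mem_inter_iff, Set.mem_preimage, Set.mem_Ico]
    refine and_congr Iff.rfl ⟨fun h => ⟨by linarith, by linarith⟩,
      fun h => ⟨by linarith, by linarith⟩⟩
  have e2 : s ∩ Set.Ico 0 1 = A ∩ Set.Ico 0 (0 + 1) := by
    ext t
    simp only [hA, Set.mem_inter_iff, Set.mem_preimage, zero_add]
    refine and_congr_left fun h => ?_
    rw [Int.fract_eq_self.2 h]
  rw [e1, e2, measure_preimage_add_right, h1, h2, h1]

theorem measurePreserving_fractVec_add (b : Space) :
    MeasurePreserving (fun t => fractVec (t + b)) cubeMeasure cubeMeasure := by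
  rw [cubeMeasure_eq_prod]
  exact (measurePreserving_fract_add b.1).prod
    ((measurePreserving_fract_add b.2.1).prod (measurePreserving_fract_add b.2.2))

/-- The shear `(v, t) ↦ (v, t - v σ)` of the cell, modulo integers. -/
noncomputable def shear (σ : Space) (x : Config) : Config := (x.1, fractVec (x.2 - x.1 • σ))

theorem measurePreserving_shear (σ : Space) :
    MeasurePreserving (shear σ) stripMeasure stripMeasure := by
  refine MeasurePreserving.skew_product (f := id) (g := fun v t => fractVec (t - v • σ))
    (MeasurePreserving.id _) ?_ ?_
  · refine measurable_fractVec.comp ?_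
    exact (by fun_prop : Continuous fun x : ℝ × Space => x.2 - x.1 • σ).measurable
  · refine Eventually.of_forall fun v => ?_
    have h := (measurePreserving_fractVec_add (-(v • σ))).map_eq
    simpa only [sub_eq_add_neg] using h

/-- The shear is a rotation of the torus for each fixed `v`, so it can be undone under the integral
and the variables separate. This is how a potential depending jointly on `w` and `v` is handled. -/
theorem integral_mul_comp_shear (σ : Space) {g : ℝ → ℂ} {f : Space → ℂ}
    (hg : AEStronglyMeasurable g) (hf : AEStronglyMeasurable f cubeMeasure) :
    ∫ x, g x.1 * f (fractVec (x.2 - x.1 • σ)) ∂stripMeasure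
      = (∫ v, g v) * ∫ t, f t ∂cubeMeasure := by
  have hH : AEStronglyMeasurable (fun z : ℝ × Space => g z.1 * f z.2) stripMeasure :=
    (hg.comp_quasiMeasurePreserving Measure.quasiMeasurePreserving_fst).mul
      (hf.comp_quasiMeasurePreserving Measure.quasiMeasurePreserving_snd)
  rw [← integral_prod_mul]
  have h := (measurePreserving_shear σ).map_eq
  change _ = ∫ z, g z.1 * f z.2 ∂stripMeasure
  rw [← h] at hH
  conv_rhs => rw [← h]
  rw [integral_map (measurePreserving_shear σ).measurable.aemeasurable hH]
  rfl

theorem memLp_mul_comp_shear (σ : Space) {g : ℝ → ℂ} {f : Space → ℂ}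
    (hg : MemLp g 2) (hf : MemLp f 2 cubeMeasure) :
    MemLp (fun x : Config => g x.1 * f (fractVec (x.2 - x.1 • σ))) 2 stripMeasure :=
  (memLp_two_mul_prod hg hf).comp_measurePreserving (measurePreserving_shear σ)

namespace Params

variable (P : Params)

/-- The linear map `t ↦ t₁ a₁ + t₂ a₂ + t₃ a₃`. -/
noncomputable def cellLinear : Space ≃ₗ[ℝ] Space where
  toFun t := P.latticeComb t.1 t.2.1 t.2.2
  map_add' p q := by
    simp only [latticeComb, Prod.fst_add, Prod.snd_add, Prod.mk_add_mk]
    ext <;> simp only <;> ring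
  map_smul' c p := by
    simp only [latticeComb, Prod.smul_fst, Prod.smul_snd, smul_eq_mul,
      RingHom.id_apply, Prod.smul_mk]
    ext <;> simp only <;> ring
  invFun r := ((r.1 - r.2.1 / (P.a₂ * Real.sin P.θ) * (P.a₂ * Real.cos P.θ)) / P.a₁,
    r.2.1 / (P.a₂ * Real.sin P.θ), r.2.2 / P.a₃)
  left_inv p := by
    have h1 := P.a₁_pos.ne'
    have h2 := P.a₂_pos.ne'
    have h3 := P.a₃_pos.ne'
    have h5 := P.sin_θ_pos.ne'
    simp only [latticeComb]
    refine Prod.ext ?_ (Prod.ext ?_ ?_) <;> simp only <;> field_simp <;> ring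
  right_inv p := by
    have h1 := P.a₁_pos.ne'
    have h2 := P.a₂_pos.ne'
    have h3 := P.a₃_pos.ne'
    have h5 := P.sin_θ_pos.ne'
    simp only [latticeComb]
    refine Prod.ext ?_ (Prod.ext ?_ ?_) <;> simp only <;> field_simp <;> ring

/-- The map `t ↦ t₁ a₁ + t₂ a₂ + t₃ a₃` as a continuous linear equivalence. -/
noncomputable def cellEquiv : Space ≃L[ℝ] Space := P.cellLinear.toContinuousLinearEquiv

theorem cellEquiv_apply (t : Space) : P.cellEquiv t = P.latticeComb t.1 t.2.1 t.2.2 := rfl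

theorem cellEquiv_preimage_unitCell : P.cellEquiv ⁻¹' P.unitCell = cube := by
  ext t
  constructor
  · rintro ⟨t₁, h1, t₂, h2, t₃, h3, h⟩
    have e2 := P.cellEquiv.injective (h.trans (P.cellEquiv_apply (t₁, t₂, t₃)).symm)
    rw [e2]
    exact ⟨h1, h2, h3⟩
  · rintro ⟨h1, h2, h3⟩
    exact ⟨_, h1, _, h2, _, h3, rfl⟩

/-- The potential in lattice coordinates. -/
noncomputable def cellPot (vext : Space → ℝ) (t : Space) : ℂ := (vext (P.cellEquiv t) : ℂ)

theorem memLp_cellPot {vext : Space → ℝ} (hL2 : MemLp vext 2 (volume.restrict P.unitCell)) :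
    MemLp (P.cellPot vext) 2 cubeMeasure := by
  have h := (memLp_comp_iff volume P.cellEquiv P.unitCell).2 hL2
  rw [P.cellEquiv_preimage_unitCell] at h
  exact h.ofReal

theorem cellPot_add_intVec {vext : Space → ℝ} (hper : P.IsLatticePeriodic vext)
    (t : Space) (n : LatticeIndex) :
    P.cellPot vext (t + intVec n) = P.cellPot vext t := by
  rw [cellPot, map_add]
  exact congrArg _ (hper n _)

theorem cellPot_fractVec {vext : Space → ℝ} (hper : P.IsLatticePeriodic vext) (t : Space) :
    P.cellPot vext (fractVec t) = P.cellPot vext t := by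
  conv_rhs => rw [← fractVec_add_floorVec t, P.cellPot_add_intVec hper]

theorem fourierCoeff_eq (vext : Space → ℝ) (n : LatticeIndex) :
    P.fourierCoeff vext n = ∫ t, conj (torusExp n t) * P.cellPot vext t ∂cubeMeasure := by
  obtain ⟨c, hc, h⟩ := exists_setIntegral_comp_eq (volume : Measure Space) P.cellEquiv
  -- The constant function identifies the Jacobian with the inverse volume of the cell, which turns
  -- the mean into an integral over the cube.
  have h1 := h P.unitCell (fun _ => 1)
  rw [P.cellEquiv_preimage_unitCell] at h1
  have h1' : ((volume.real P.unitCell : ℝ) : ℂ) = (c : ℂ)⁻¹ := by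
    have e : ∫ _ in cube, (1 : ℂ) = 1 := by
      change ∫ _, (1 : ℂ) ∂cubeMeasure = 1
      simp
    rw [e] at h1
    have e2 : ∫ _ in P.unitCell, (1 : ℂ) = ((volume.real P.unitCell : ℝ) : ℂ) := by
      simp
    rw [e2] at h1
    exact eq_inv_of_mul_eq_one_right h1.symm
  rw [fourierCoeff, setAverage_eq, Complex.real_smul, Complex.ofReal_inv, h1', inv_inv, ← h,
    P.cellEquiv_preimage_unitCell]
  refine integral_congr_ae (Eventually.of_forall fun t => ?_)
  simp only
  rw [mul_comm, cellPot]
  congr 1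
  rw [torusExp, ← Complex.exp_conj]
  simp only [map_mul, Complex.conj_I, Complex.conj_ofReal]
  congr 3
  have h1 := P.a₁_pos.ne'
  have h2 := P.a₂_pos.ne'
  have h3 := P.a₃_pos.ne'
  have h5 := P.sin_θ_pos.ne'
  simp only [cellEquiv_apply, latticeComb, Gx, Gmn, Gy, Gz]
  field_simp
  ring

/-- The vector by which the argument of the potential moves with the oscillator coordinate, in
lattice coordinates. -/
noncomputable def shearVec : Space :=
  (-(P.mp * Real.cos P.θ / (Real.sqrt 2 * P.M * P.ωc * P.a₁ * Real.sin P.θ)),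
    P.mp / (Real.sqrt 2 * P.M * P.ωc * P.a₂ * Real.sin P.θ), 0)

/-- For fixed `w`, the position `y` moves linearly with `v`; in lattice coordinates this is a
displacement by a multiple of `shearVec`. -/
theorem positionOf_latEquiv (x : Config) :
    P.positionOf (P.latEquiv x) = P.cellEquiv (x.2 - x.1 • P.shearVec) := by
  have h1 := P.a₁_pos.ne'
  have h2 := P.a₂_pos.ne'
  have h3 := P.a₃_pos.ne'
  have h4 := P.ωc_pos.ne'
  have h5 := P.sin_θ_pos.ne'
  have h6 := sqrt_two_ne
  have h7 := P.M_pos.ne'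
  rw [cellEquiv_apply, latEquiv_apply]
  simp only [positionOf, latticeComb, shearVec, Prod.fst_sub, Prod.snd_sub, Prod.smul_fst,
    Prod.smul_snd, smul_eq_mul]
  refine Prod.ext ?_ (Prod.ext ?_ ?_) <;> simp only <;> field_simp <;> ring

/-- The origin of `G^v`: it is the phase that a plane wave of the crystal picks up along the
displacement by `v`. -/
theorem torusExp_smul_shearVec (n : LatticeIndex) (v : ℝ) :
    torusExp n (v • P.shearVec)
      = Complex.exp (Complex.I * ((P.Gv n.2.1 n.1 * v : ℝ) : ℂ)) := by
  have h1 := P.a₁_pos.ne'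
  have h2 := P.a₂_pos.ne'
  have h4 := P.ωc_pos.ne'
  have h5 := P.sin_θ_pos.ne'
  have h6 := sqrt_two_ne
  have h7 := P.M_pos.ne'
  rw [torusExp]
  congr 3
  simp only [shearVec, Prod.smul_fst, Prod.smul_snd, smul_eq_mul, Gv, Gmn, Gx, Gy]
  field_simp
  ring

/-- The potential in the coordinates `(v, t)`. -/
noncomputable def stripPot (vext : Space → ℝ) (x : Config) : ℂ :=
  (vext (P.positionOf (P.latEquiv x)) : ℂ)

theorem conj_stripPot (vext : Space → ℝ) (x : Config) :
    conj (P.stripPot vext x) = P.stripPot vext x := Complex.conj_ofReal _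

theorem stripPot_eq {vext : Space → ℝ} (hper : P.IsLatticePeriodic vext) (x : Config) :
    P.stripPot vext x = P.cellPot vext (fractVec (x.2 - x.1 • P.shearVec)) := by
  rw [P.cellPot_fractVec hper, stripPot, positionOf_latEquiv, cellPot]

theorem stripPot_add_intVec {vext : Space → ℝ} (hper : P.IsLatticePeriodic vext) (x : Config)
    (n : LatticeIndex) : P.stripPot vext (x.1, x.2 + intVec n) = P.stripPot vext x := by
  rw [P.stripPot_eq hper, P.stripPot_eq hper, add_sub_right_comm, fractVec_add_intVec]

variable {vext : Space → ℝ}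

theorem memLp_mul_stripPot (hper : P.IsLatticePeriodic vext)
    (hL2 : MemLp vext 2 (volume.restrict P.unitCell)) {g : ℝ → ℂ} (hg : MemLp g 2) :
    MemLp (fun x => g x.1 * P.stripPot vext x) 2 stripMeasure := by
  simp only [P.stripPot_eq hper]
  exact memLp_mul_comp_shear P.shearVec hg (P.memLp_cellPot hL2)

theorem memLp_torusExp_mul {f : Config → ℂ} (hf : MemLp f 2 stripMeasure) (n : LatticeIndex) :
    MemLp (fun x => torusExp n x.2 * f x) 2 stripMeasure := by
  refine hf.of_le (AEStronglyMeasurable.mul ?_ hf.1) (Eventually.of_forall fun x => ?_)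
  · exact ((continuous_torusExp n).comp continuous_snd).aestronglyMeasurable
  · rw [norm_mul, norm_torusExp, one_mul]

theorem memLp_stripPot_mul_cellMode (hper : P.IsLatticePeriodic vext)
    (hL2 : MemLp vext 2 (volume.restrict P.unitCell)) (k : Space) (c : LatticeIndex × ℕ) :
    MemLp (fun x => P.stripPot vext x * P.cellMode k c x) 2 stripMeasure := by
  convert! memLp_torusExp_mul (P.memLp_mul_stripPot hper hL2 (P.memLp_phi_sub c.2 (P.A k.1 c.1.1)))
    c.1 using 2 with x
  rw [cellMode]
  ring

/-- The torus factor has modulus one and `φ_j` has norm one, so after the shear only the norm of the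
potential remains. Independence of `c` is what makes the series in
`hasSum_conj_modeCoeff_mul_potCoeff` converge. -/
theorem integral_norm_sq_stripPot_mul_cellMode (hper : P.IsLatticePeriodic vext)
    (hL2 : MemLp vext 2 (volume.restrict P.unitCell)) (k : Space) (c : LatticeIndex × ℕ) :
    ∫ x, ‖P.stripPot vext x * P.cellMode k c x‖ ^ 2 ∂stripMeasure
      = ∫ t, ‖P.cellPot vext t‖ ^ 2 ∂cubeMeasure := by
  have h1 := (P.memLp_phi_sub c.2 (P.A k.1 c.1.1)).1
  have h2 := (P.memLp_cellPot hL2).1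
  have h := integral_mul_comp_shear P.shearVec
    (g := fun v => conj (P.phi c.2 (v - P.A k.1 c.1.1)) * P.phi c.2 (v - P.A k.1 c.1.1))
    (f := fun t => ((‖P.cellPot vext t‖ ^ 2 : ℝ) : ℂ))
    ((Complex.continuous_conj.comp_aestronglyMeasurable h1).mul h1)
    (Complex.continuous_ofReal.comp_aestronglyMeasurable (h2.norm.pow 2))
  have h3 := P.braket_phi c.2 c.2
  rw [integral_sub_right_eq_self (fun v => conj (P.phi c.2 v) * P.phi c.2 v)] at h
  rw [braket, if_pos rfl] at h3
  rw [h3, one_mul, integral_complex_ofReal] at h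
  apply Complex.ofReal_injective
  rw [← h, ← integral_complex_ofReal]
  refine integral_congr_ae (Eventually.of_forall fun x => ?_)
  simp only
  rw [← P.stripPot_eq hper, norm_mul, cellMode, norm_mul, norm_torusExp, mul_one, mul_pow,
    ← Complex.normSq_eq_conj_mul_self, Complex.normSq_eq_norm_sq]
  push_cast
  ring

/-- Writing the character at `t` as its value at `t - v σ` times `exp(i G^v v)` separates the
integral: the first factor yields a Fourier coefficient, the second a plane wave in `v` between
shifted Hermite functions. -/
theorem integral_conj_cellMode_stripPot_cellMode (hper : P.IsLatticePeriodic vext)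
    (hL2 : MemLp vext 2 (volume.restrict P.unitCell)) (k : Space) (c d : LatticeIndex × ℕ) :
    ∫ x, conj (P.stripPot vext x * P.cellMode k c x) * P.cellMode k d x ∂stripMeasure
      = P.fourierCoeff vext (c.1 - d.1) *
        (Complex.exp (-Complex.I *
        ((P.Gv ((c.1.2.1 : ℝ) - d.1.2.1) ((c.1.1 : ℝ) - d.1.1)
          * P.A k.1 (((c.1.1 : ℝ) + d.1.1) / 2) : ℝ) : ℂ)) *
        P.displacementMatrix (P.alpha ((c.1.1 : ℝ) - d.1.1) ((c.1.2.1 : ℝ) - d.1.2.1)) c.2 d.2) := by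
  have h1 := (P.memLp_phi_sub c.2 (P.A k.1 c.1.1)).1
  have h1' := (P.memLp_phi_sub d.2 (P.A k.1 d.1.1)).1
  have h2 := (P.memLp_cellPot hL2).1
  rw [← P.braket_planeWave, braket, P.fourierCoeff_eq, mul_comm, ← integral_mul_comp_shear P.shearVec]
  · refine integral_congr_ae (Eventually.of_forall fun x => ?_)
    simp only
    rw [← P.stripPot_eq hper, map_mul, conj_stripPot, torusExp_fractVec]
    have e1 : torusExp (c.1 - d.1) x.2
        = torusExp (c.1 - d.1) (x.2 - x.1 • P.shearVec)
          * torusExp (c.1 - d.1) (x.1 • P.shearVec) := by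
      rw [torusExp, torusExp, torusExp, ← Complex.exp_add]
      congr 1
      simp only [Prod.fst_sub, Prod.snd_sub]
      push_cast
      ring
    rw [P.torusExp_smul_shearVec] at e1
    have e2 : conj (torusExp c.1 x.2) * torusExp d.1 x.2 = conj (torusExp (c.1 - d.1) x.2) := by
      rw [torusExp_sub]
      simp only [map_mul, Complex.conj_conj]
      ring
    have e3 : conj (Complex.exp (Complex.I *
          ((P.Gv ((c.1 - d.1).2.1) ((c.1 - d.1).1) * x.1 : ℝ) : ℂ)))
        = Complex.exp (-Complex.I *
          ((P.Gv ((c.1.2.1 : ℝ) - d.1.2.1) ((c.1.1 : ℝ) - d.1.1) * x.1 : ℝ) : ℂ)) := by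
      rw [← Complex.exp_conj]
      simp only [map_mul, Complex.conj_I, Complex.conj_ofReal, Prod.fst_sub, Prod.snd_sub,
        Int.cast_sub]
    rw [cellMode, cellMode, ← e3, map_mul]
    have e4 := congrArg conj e1
    rw [map_mul] at e4
    linear_combination (P.stripPot vext x * conj (P.phi c.2 (x.1 - P.A k.1 c.1.1))
      * P.phi d.2 (x.1 - P.A k.1 d.1.1)) * (e2 + e4)
  · exact (Complex.continuous_conj.comp_aestronglyMeasurable h1).mul
      (AEStronglyMeasurable.mul (by fun_prop) h1')
  · exact (Complex.continuous_conj.comp_aestronglyMeasurable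
      (continuous_torusExp _).aestronglyMeasurable).mul h2

/-- The matrix element of the potential between a basis function and `f`. -/
noncomputable def potCoeff (vext : Space → ℝ) (k : Space) (f : Config → ℂ)
    (c : LatticeIndex × ℕ) : ℂ :=
  ∫ x, conj (P.stripPot vext x * P.cellMode k c x) * f x ∂stripMeasure

/-- Parseval for `f` and the potential times the basis function of index `c`, both in `L²`. The
potential need not map `f` into `L²`. -/
theorem hasSum_couplingTerm (hper : P.IsLatticePeriodic vext)
    (hL2 : MemLp vext 2 (volume.restrict P.unitCell)) (k : Space) {f : Config → ℂ}
    (hf : MemLp f 2 stripMeasure) (c : LatticeIndex × ℕ) :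
    HasSum (P.couplingTerm vext k (P.modeCoeff k f) c.1 c.2) (P.potCoeff vext k f c) := by
  have h := P.hasSum_inner_modeCoeff k (P.memLp_stripPot_mul_cellMode hper hL2 k c) hf
  convert! h using 2 with d
  have e : conj (P.modeCoeff k (fun x => P.stripPot vext x * P.cellMode k c x) d)
      = ∫ x, conj (P.stripPot vext x * P.cellMode k c x) * P.cellMode k d x ∂stripMeasure := by
    rw [modeCoeff, ← integral_conj]
    refine integral_congr_ae (Eventually.of_forall fun x => ?_)
    simp only [map_mul, Complex.conj_conj]
    ring
  rw [e, P.integral_conj_cellMode_stripPot_cellMode hper hL2, couplingTerm]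
  ring

theorem centralEquation_iff (hper : P.IsLatticePeriodic vext)
    (hL2 : MemLp vext 2 (volume.restrict P.unitCell)) (k : Space) (E : ℝ) {f : Config → ℂ}
    (hf : MemLp f 2 stripMeasure) :
    P.CentralEquation vext k E (P.modeCoeff k f) ↔ ∀ c : LatticeIndex × ℕ,
      P.modeCoeff k f c * ((P.kinetic k c.1 + P.energy c.2 - E : ℝ) : ℂ)
        + P.potCoeff vext k f c = 0 := by
  have h := fun c => P.hasSum_couplingTerm hper hL2 k hf c
  constructor
  · intro hC c
    rw [← (h c).tsum_eq]
    exact (hC c.1 c.2).2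
  · intro hC n i
    refine ⟨(h (n, i)).summable, ?_⟩
    rw [(h (n, i)).tsum_eq]
    exact hC (n, i)

end Params

/-! ### Unfolding integrals over configuration space. -/

/-- The translation of the lattice coordinates by integers. -/
def cellShift (n : LatticeIndex) (x : Config) : Config := (x.1, x.2 + intVec n)

theorem measurePreserving_cellShift (n : LatticeIndex) :
    MeasurePreserving (cellShift n) volume volume := by
  have h := measurePreserving_add_right (volume : Measure Config) (0, intVec n)
  have e : (fun x : Config => x + (0, intVec n)) = cellShift n := by
    ext1 x
    exact Prod.ext (by simp [cellShift]) (by simp [cellShift])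
  rwa [e] at h

theorem measurableEmbedding_cellShift (n : LatticeIndex) : MeasurableEmbedding (cellShift n) := by
  have h := measurableEmbedding_addRight ((0, intVec n) : Config)
  have e : (fun x : Config => x + (0, intVec n)) = cellShift n := by
    ext1 x
    exact Prod.ext (by simp [cellShift]) (by simp [cellShift])
  rwa [e] at h

theorem continuous_cellShift (n : LatticeIndex) : Continuous (cellShift n) := by
  unfold cellShift
  fun_prop

theorem floorVec_add_intVec (t : Space) (n : LatticeIndex) :
    floorVec (t + intVec n) = floorVec t + n := by
  simp only [floorVec, intVec, Prod.fst_add, Prod.snd_add, Int.floor_add_intCast]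
  rfl

theorem floorVec_eq_zero_iff {t : Space} : floorVec t = 0 ↔ t ∈ cube := by
  simp [floorVec, cube, Prod.ext_iff, Int.floor_eq_zero_iff]

theorem measurable_floorVec : Measurable floorVec := by
  unfold floorVec
  fun_prop

theorem cellShift_preimage_floorVec (n : LatticeIndex) :
    cellShift n ⁻¹' {x | floorVec x.2 = n} = Set.univ ×ˢ cube := by
  ext x
  simp only [Set.mem_preimage, Set.mem_ofPred_eq, cellShift, floorVec_add_intVec,
    add_eq_right, floorVec_eq_zero_iff, Set.mem_prod, Set.mem_univ, true_and]

/-- The cells `floorVec = n` partition configuration space, and `cellShift n` carries the strip onto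
the cell of index `n`. -/
theorem integral_eq_sum_cellShift {G : Config → ℂ} {B : Finset LatticeIndex}
    (hB : ∀ x, floorVec x.2 ∉ B → G x = 0)
    (hi : ∀ n ∈ B, Integrable (fun x => G (cellShift n x)) stripMeasure) :
    Integrable G ∧ ∫ x, G x = ∑ n ∈ B, ∫ x, G (cellShift n x) ∂stripMeasure := by
  set S : LatticeIndex → Set Config := fun n => {x | floorVec x.2 = n} with hS
  have hSm : ∀ n, MeasurableSet (S n) := fun n =>
    (measurable_floorVec.comp measurable_snd) (measurableSet_singleton n)
  have hiS : ∀ n ∈ B, IntegrableOn G (S n) := by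
    intro n hn
    rw [← (measurePreserving_cellShift n).integrableOn_comp_preimage
      (measurableEmbedding_cellShift n), cellShift_preimage_floorVec, IntegrableOn,
      ← stripMeasure_eq_restrict]
    exact hi n hn
  have hcompl : ∀ x, x ∉ ⋃ n ∈ B, S n → G x = 0 := by
    intro x hx
    refine hB x fun hmem => hx ?_
    simp only [Set.mem_iUnion]
    exact ⟨_, hmem, rfl⟩
  have hiU : IntegrableOn G (⋃ n ∈ B, S n) := integrableOn_finset_iUnion.2 hiS
  constructor
  · refine (integrableOn_iff_integrable_of_support_subset fun x hx => ?_).1 hiU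
    by_contra h
    exact hx (hcompl x h)
  · rw [← setIntegral_eq_integral_of_forall_compl_eq_zero hcompl,
      integral_biUnion_finset B (fun n _ => hSm n) ?_ hiS]
    · refine Finset.sum_congr rfl fun n _ => ?_
      rw [← (measurePreserving_cellShift n).setIntegral_preimage_emb
        (measurableEmbedding_cellShift n), cellShift_preimage_floorVec, ← stripMeasure_eq_restrict]
    · intro m _ n _ hmn
      refine Set.disjoint_left.2 fun x h1 h2 => hmn ?_
      exact Eq.trans (Eq.symm h1) h2

/-- The sum of all integer translates. -/
noncomputable def periodize (f : Config → ℂ) (x : Config) : ℂ :=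
  ∑' n : LatticeIndex, f (cellShift n x)

/-- Functions that vanish outside finitely many cells and are square integrable on each cell. -/
def IsCellFinite (f : Config → ℂ) : Prop :=
  (∃ B : Finset LatticeIndex, ∀ x, floorVec x.2 ∉ B → f x = 0) ∧
    ∀ n, MemLp (fun x => f (cellShift n x)) 2 stripMeasure

theorem floorVec_cellShift_of_mem {x : Config} (hx : x.2 ∈ cube) (n : LatticeIndex) :
    floorVec (cellShift n x).2 = n := by
  rw [cellShift, floorVec_add_intVec, floorVec_eq_zero_iff.2 hx, zero_add]

theorem periodize_eq_sum {f : Config → ℂ} {B : Finset LatticeIndex}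
    (hB : ∀ x, floorVec x.2 ∉ B → f x = 0) {x : Config} (hx : x.2 ∈ cube) :
    periodize f x = ∑ n ∈ B, f (cellShift n x) :=
  tsum_eq_sum fun n hn => hB _ (by rwa [floorVec_cellShift_of_mem hx])

theorem IsCellFinite.memLp_periodize {f : Config → ℂ} (hf : IsCellFinite f) :
    MemLp (periodize f) 2 stripMeasure := by
  obtain ⟨⟨B, hB⟩, h⟩ := hf
  refine (memLp_congr_ae ?_).2 (memLp_finsetSum B fun n _ => h n)
  filter_upwards [ae_stripMeasure_mem] with x hx
  exact periodize_eq_sum hB hx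

theorem ae_stripMeasure_of_ae {p : Config → Prop} (h : ∀ᵐ x, p x) : ∀ᵐ x ∂stripMeasure, p x := by
  rw [stripMeasure_eq_restrict]
  exact ae_restrict_of_ae h

/-- Unfolding: periodicity lets `g` be evaluated in the base cell, so that all translates of `f` are
summed against the same function. -/
theorem IsCellFinite.integral_conj_mul {f g : Config → ℂ} (hf : IsCellFinite f)
    (hg : MemLp g 2 stripMeasure) (hper : ∀ n, ∀ᵐ x, g (cellShift n x) = g x) :
    Integrable (fun x => conj (f x) * g x) ∧
      ∫ x, conj (f x) * g x = ∫ x, conj (periodize f x) * g x ∂stripMeasure := by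
  obtain ⟨⟨B, hB⟩, h⟩ := hf
  have h1 : ∀ n, (fun x => conj (f (cellShift n x)) * g (cellShift n x)) =ᵐ[stripMeasure]
      fun x => conj (f (cellShift n x)) * g x := by
    intro n
    filter_upwards [ae_stripMeasure_of_ae (hper n)] with x hx
    rw [hx]
  have h2 : ∀ n, Integrable (fun x => conj (f (cellShift n x)) * g x) stripMeasure := fun n =>
    MemLp.integrable_conj_mul (h n) hg
  obtain ⟨h3, h4⟩ := integral_eq_sum_cellShift (G := fun x => conj (f x) * g x) (B := B)
    (fun x hx => by simp only [hB x hx, map_zero, zero_mul])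
    (fun n _ => (integrable_congr (h1 n)).2 (h2 n))
  refine ⟨h3, ?_⟩
  rw [h4, Finset.sum_congr rfl fun n _ => integral_congr_ae (h1 n),
    ← integral_finsetSum _ fun n _ => h2 n]
  refine integral_congr_ae ?_
  filter_upwards [ae_stripMeasure_mem] with x hx
  rw [periodize_eq_sum hB hx, map_sum, Finset.sum_mul]

theorem exists_finset_floorVec {K : Set Config} (hK : IsCompact K) :
    ∃ B : Finset LatticeIndex, ∀ x ∈ K, floorVec x.2 ∈ B := by
  obtain ⟨R, hR⟩ := hK.isBounded.exists_norm_le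
  set N : ℤ := ⌈R⌉ + 1 with hN
  refine ⟨Finset.Icc (-N) N ×ˢ Finset.Icc (-N) N ×ˢ Finset.Icc (-N) N, fun x hx => ?_⟩
  have h0 := hR x hx
  have key : ∀ t : ℝ, |t| ≤ R → ⌊t⌋ ∈ Finset.Icc (-N) N := by
    intro t ht
    obtain ⟨h1, h2⟩ := abs_le.1 ht
    have h3 := Int.le_ceil R
    rw [Finset.mem_Icc]
    constructor
    · rw [Int.le_floor, hN]
      push_cast
      linarith
    · have : ⌊t⌋ ≤ ⌈R⌉ := by
        exact_mod_cast (Int.floor_le t).trans (h2.trans h3)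
      omega
  have h1 : ‖x.2‖ ≤ R := (norm_snd_le x).trans h0
  have h2 : ‖x.2.2‖ ≤ R := (norm_snd_le x.2).trans h1
  simp only [Finset.mem_product]
  exact ⟨key _ ((norm_fst_le x.2).trans h1), key _ ((norm_fst_le x.2.2).trans h2),
    key _ ((norm_snd_le x.2.2).trans h2)⟩

theorem exists_finset_floorVec_of_hasCompactSupport {f : Config → ℂ} (hs : HasCompactSupport f) :
    ∃ B : Finset LatticeIndex, ∀ x, floorVec x.2 ∉ B → f x = 0 := by
  obtain ⟨B, hB⟩ := exists_finset_floorVec hs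
  refine ⟨B, fun x hx => ?_⟩
  by_contra h
  exact hx (hB x (subset_tsupport f h))

theorem isCellFinite_of_hasCompactSupport {f : Config → ℂ} (hc : Continuous f)
    (hs : HasCompactSupport f) : IsCellFinite f := by
  refine ⟨exists_finset_floorVec_of_hasCompactSupport hs, fun n => ?_⟩
  have h := (hc.memLp_of_hasCompactSupport hs (p := 2) (μ := volume)).comp_measurePreserving
    (measurePreserving_cellShift n)
  rw [stripMeasure_eq_restrict]
  exact h.restrict _

/-- A majorant depending on `v` alone allows `memLp_mul_stripPot` to bound the product of the
potential with `f` on every cell. -/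
theorem exists_norm_le_indicator {f : Config → ℂ} (hc : Continuous f)
    (hs : HasCompactSupport f) : ∃ g : ℝ → ℂ, MemLp g 2 ∧ ∀ x, ‖f x‖ ≤ ‖g x.1‖ := by
  obtain ⟨C, hC⟩ := hs.exists_bound_of_continuous hc
  obtain ⟨R, hR⟩ := hs.isBounded.exists_norm_le
  refine ⟨(Set.Icc (-R) R).indicator fun _ => (C : ℂ),
    memLp_indicator_const 2 measurableSet_Icc _ (Or.inr (by simp)), fun x => ?_⟩
  by_cases hx : f x = 0
  · rw [hx, norm_zero]
    exact norm_nonneg _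
  · have h1 : x.1 ∈ Set.Icc (-R) R :=
      abs_le.1 ((norm_fst_le x).trans (hR x (subset_tsupport f hx)))
    rw [Set.indicator_of_mem h1, Complex.norm_real]
    exact (hC x).trans (le_abs_self _)

namespace Params

variable (P : Params) {vext : Space → ℝ}

theorem aestronglyMeasurable_stripPot (hper : P.IsLatticePeriodic vext)
    (hL2 : MemLp vext 2 (volume.restrict P.unitCell)) :
    AEStronglyMeasurable (P.stripPot vext) stripMeasure := by
  have h2 : AEStronglyMeasurable (fun z : ℝ × Space => P.cellPot vext z.2) stripMeasure :=
    (P.memLp_cellPot hL2).1.comp_quasiMeasurePreserving Measure.quasiMeasurePreserving_snd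
  have h3 := h2.comp_measurePreserving (measurePreserving_shear P.shearVec)
  convert! h3 using 1
  ext x
  exact P.stripPot_eq hper x

theorem isCellFinite_stripPot_mul (hper : P.IsLatticePeriodic vext)
    (hL2 : MemLp vext 2 (volume.restrict P.unitCell)) {f : Config → ℂ} (hc : Continuous f)
    (hs : HasCompactSupport f) : IsCellFinite fun x => P.stripPot vext x * f x := by
  obtain ⟨B, hB⟩ := exists_finset_floorVec_of_hasCompactSupport hs
  refine ⟨⟨B, fun x hx => by simp only [hB x hx, mul_zero]⟩, fun n => ?_⟩
  obtain ⟨g, hg, hle⟩ := exists_norm_le_indicator hc hs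
  have h0 := P.memLp_mul_stripPot hper hL2 hg
  have h1 := P.aestronglyMeasurable_stripPot hper hL2
  simp only [cellShift, P.stripPot_add_intVec hper]
  refine h0.of_le (h1.mul ?_) (Eventually.of_forall fun x => ?_)
  · exact (hc.comp (continuous_cellShift n)).aestronglyMeasurable
  · rw [norm_mul, norm_mul, mul_comm]
    exact mul_le_mul_of_nonneg_right (hle _) (norm_nonneg _)

theorem periodize_stripPot_mul (hper : P.IsLatticePeriodic vext) (f : Config → ℂ) (x : Config) :
    periodize (fun x => P.stripPot vext x * f x) x = P.stripPot vext x * periodize f x := by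
  rw [periodize, periodize, ← tsum_mul_left]
  refine tsum_congr fun n => ?_
  rw [cellShift, P.stripPot_add_intVec hper]

end Params

/-! ### The weak equation on the strip, and coefficients of test functions. -/

/-- The plane wave `exp(i k · r_w)`. -/
noncomputable def phase (k : Space) (q : Config) : ℂ :=
  Complex.exp (Complex.I * ((k.1 * q.1 + k.2.1 * q.2.1 + k.2.2 * q.2.2.1 : ℝ) : ℂ))

theorem contDiff_phase (k : Space) {n : WithTop ℕ∞} : ContDiff ℝ n (phase k) := by
  have h : ContDiff ℝ n (fun q : Config => k.1 * q.1 + k.2.1 * q.2.1 + k.2.2 * q.2.2.1) := by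
    fun_prop
  exact (contDiff_const.mul (Complex.ofRealCLM.contDiff.comp h)).cexp

theorem conj_phase_mul_phase (k : Space) (q : Config) : conj (phase k q) * phase k q = 1 := by
  rw [phase, ← Complex.exp_conj, ← Complex.exp_add]
  simp

theorem two_le_infty : (2 : WithTop ℕ∞) ≤ ∞ := WithTop.coe_le_coe.2 (le_top : (2 : ℕ∞) ≤ ⊤)

theorem fderiv_eq_sum {f : Config → ℂ} {q : Config} (hf : DifferentiableAt ℝ f q) (w : Config)
    (hw : w.2.2.2 = 0) :
    fderiv ℝ f q w = w.1 * partial1 f q + w.2.1 * partial2 f q + w.2.2.1 * partial3 f q := by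
  have e : w = w.1 • e1 + w.2.1 • e2 + w.2.2.1 • e3 := by
    refine Prod.ext ?_ (Prod.ext ?_ (Prod.ext ?_ ?_)) <;> simp [e1, e2, e3, hw]
  rw [partial1_eq_fderiv hf, partial2_eq_fderiv hf, partial3_eq_fderiv hf]
  conv_lhs => rw [e]
  simp

theorem integrable_conj_mul_of_hasCompactSupport {u w : Config → ℂ} (hu : Continuous u)
    (hs : HasCompactSupport u) (hw : Continuous w) : Integrable fun q => conj (w q) * u q :=
  Continuous.integrable_of_hasCompactSupport
    ((Complex.continuous_conj.comp hw).mul hu) hs.mul_left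

theorem integral_conj_mul_swap (f g : Config → ℂ) :
    ∫ q, conj (f q) * g q = conj (∫ q, conj (g q) * f q) := by
  rw [← integral_conj]
  refine integral_congr_ae (Eventually.of_forall fun q => ?_)
  simp only [map_mul, Complex.conj_conj]
  ring

namespace Params

variable (P : Params) {vext : Space → ℝ}

/-- The linear change of coordinates is a bijection of test functions, and its Jacobian multiplies
both sides alike. -/
theorem isWeakEigenfunction_comp_iff (vext : Space → ℝ) (E : ℝ) (ψ : Config → ℂ) :
    P.IsWeakEigenfunction vext E (ψ ∘ P.toPolaritonic) ↔
      ∀ F : Config → ℂ, ContDiff ℝ ∞ F → HasCompactSupport F →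
        ∫ q, conj (P.Hpol vext F q) * ψ q = (E : ℂ) * ∫ q, conj (F q) * ψ q := by
  obtain ⟨c, hc, h⟩ := exists_integral_comp_eq (volume : Measure Config) P.polEquiv
  have hc' : (c : ℂ) ≠ 0 := by exact_mod_cast hc.ne'
  have key : ∀ F : Config → ℂ, ContDiff ℝ ∞ F →
      ((∫ p, conj (P.Heff vext (F ∘ P.toPolaritonic) p) * (ψ ∘ P.toPolaritonic) p
        = (E : ℂ) * ∫ p, conj ((F ∘ P.toPolaritonic) p) * (ψ ∘ P.toPolaritonic) p) ↔
      ∫ q, conj (P.Hpol vext F q) * ψ q = (E : ℂ) * ∫ q, conj (F q) * ψ q) := by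
    intro F hF
    have h1 := h fun q => conj (P.Hpol vext F q) * ψ q
    have h2 := h fun q => conj (F q) * ψ q
    rw [coe_polEquiv] at h1 h2
    simp only [P.Heff_comp_toPolaritonic vext (hF.of_le two_le_infty),
      Function.comp_apply]
    rw [h1, h2, mul_left_comm]
    exact ⟨fun h => mul_left_cancel₀ hc' h, fun h => by rw [h]⟩
  constructor
  · intro hw F hF hs
    refine (key F hF).1 (hw _ (hF.comp P.polEquiv.contDiff) ?_)
    exact hs.comp_homeomorph P.polEquiv.toHomeomorph
  · intro hw χ hχ hs
    have h1 := (key (χ ∘ P.polEquiv.symm) (hχ.comp P.polEquiv.symm.contDiff)).2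
      (hw _ (hχ.comp P.polEquiv.symm.contDiff) (hs.comp_homeomorph P.polEquiv.symm.toHomeomorph))
    have e : (χ ∘ P.polEquiv.symm) ∘ P.toPolaritonic = χ := by
      ext p
      simp [← coe_polEquiv]
    rwa [e] at h1

/-- The function `exp(-i k · r_w) F` in the coordinates `(v, t)`. -/
noncomputable def twist (k : Space) (F : Config → ℂ) (x : Config) : ℂ :=
  conj (phase k (P.latEquiv x)) * F (P.latEquiv x)

theorem continuous_twist (k : Space) {F : Config → ℂ} (hF : Continuous F) :
    Continuous (P.twist k F) :=
  (Complex.continuous_conj.comp ((contDiff_phase k (n := 0)).continuous.comp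
    P.latEquiv.continuous)).mul (hF.comp P.latEquiv.continuous)

theorem hasCompactSupport_twist (k : Space) {F : Config → ℂ} (hF : HasCompactSupport F) :
    HasCompactSupport (P.twist k F) :=
  (hF.comp_homeomorph P.latEquiv.toHomeomorph).mul_left

theorem isCellFinite_twist (k : Space) {F : Config → ℂ} (hF : Continuous F)
    (hs : HasCompactSupport F) : IsCellFinite (P.twist k F) :=
  isCellFinite_of_hasCompactSupport (P.continuous_twist k hF) (P.hasCompactSupport_twist k hs)

theorem ae_cellShift_of_isBlochAmplitude {u : Config → ℂ} (hu : P.IsBlochAmplitude u)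
    (n : LatticeIndex) : ∀ᵐ x, u (P.latEquiv (cellShift n x)) = u (P.latEquiv x) := by
  have h := P.ae_latEquiv_iff.2 (hu.1 n)
  simp only [P.polTranslate_latEquiv] at h
  exact h

/-- The phase `exp(i k · r_w)` is moved from the Bloch wave onto the test function; what remains of
the wave is periodic and can be unfolded. -/
theorem isWeakEigenfunction_iff_strip (hper : P.IsLatticePeriodic vext)
    (hL2 : MemLp vext 2 (volume.restrict P.unitCell)) (k : Space) (E : ℝ) {u : Config → ℂ}
    (hu : P.IsBlochAmplitude u) :
    P.IsWeakEigenfunction vext E (blochWave k u ∘ P.toPolaritonic) ↔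
      ∀ F : Config → ℂ, ContDiff ℝ ∞ F → HasCompactSupport F →
        (∫ x, conj (periodize (P.twist k (P.Hpol 0 F)) x) * u (P.latEquiv x) ∂stripMeasure)
          + (∫ x, conj (P.stripPot vext x * periodize (P.twist k F) x) * u (P.latEquiv x)
              ∂stripMeasure)
          = (E : ℂ) * ∫ x, conj (periodize (P.twist k F) x) * u (P.latEquiv x) ∂stripMeasure := by
  rw [isWeakEigenfunction_comp_iff]
  obtain ⟨c, hc, h⟩ := exists_integral_comp_eq (volume : Measure Config) P.latEquiv
  have hc' : (c : ℂ) ≠ 0 := by exact_mod_cast hc.ne'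
  refine forall₃_congr fun F hF hs => ?_
  have hF2 : ContDiff ℝ 2 F := hF.of_le two_le_infty
  have hu2 := P.memLp_polCell_iff.1 hu.2
  have hup := P.ae_cellShift_of_isBlochAmplitude hu
  have hA := (P.isCellFinite_twist k (P.continuous_Hpol_zero hF2)
    (P.hasCompactSupport_Hpol_zero hF2 hs)).integral_conj_mul hu2 hup
  have hB := (P.isCellFinite_stripPot_mul hper hL2 (P.continuous_twist k hF.continuous)
    (P.hasCompactSupport_twist k hs)).integral_conj_mul hu2 hup
  have hC := (P.isCellFinite_twist k hF.continuous hs).integral_conj_mul hu2 hup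
  simp only [P.periodize_stripPot_mul hper] at hB
  rw [← hA.2, ← hB.2, ← hC.2, ← integral_add hA.1 hB.1]
  have h1 := h fun q => conj (P.Hpol vext F q) * blochWave k u q
  have h2 := h fun q => conj (F q) * blochWave k u q
  have e1 : ∀ x, conj (P.twist k (P.Hpol 0 F) x) * u (P.latEquiv x)
      + conj (P.stripPot vext x * P.twist k F x) * u (P.latEquiv x)
      = conj (P.Hpol vext F (P.latEquiv x)) * blochWave k u (P.latEquiv x) := by
    intro x
    rw [P.Hpol_eq_add, twist, twist, blochWave, ← phase, stripPot]
    simp only [map_mul, map_add, Complex.conj_conj]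
    ring
  have e2 : ∀ x, conj (P.twist k F x) * u (P.latEquiv x)
      = conj (F (P.latEquiv x)) * blochWave k u (P.latEquiv x) := by
    intro x
    rw [twist, blochWave, ← phase]
    simp only [map_mul, Complex.conj_conj]
    ring
  simp only [e1, e2]
  rw [h1, h2, mul_left_comm]
  exact ⟨fun h => by rw [h], fun h => mul_left_cancel₀ hc' h⟩

/-- The Bloch wave `exp(i (k + G_n) · r_w) φ_j(v - A_n)`. -/
noncomputable def polMode (k : Space) (c : LatticeIndex × ℕ) : Config → ℂ :=
  modeWave (P.waveVec k c.1) fun v => P.phi c.2 (v - P.A k.1 c.1.1)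

theorem contDiff_polMode (k : Space) (c : LatticeIndex × ℕ) : ContDiff ℝ ∞ (P.polMode k c) :=
  contDiff_modeWave _ ((P.contDiff_phi c.2).comp (contDiff_id.sub contDiff_const))

theorem polMode_latEquiv (k : Space) (c : LatticeIndex × ℕ) (x : Config) :
    P.polMode k c (P.latEquiv x) = phase k (P.latEquiv x) * P.cellMode k c x := by
  rw [polMode, ← blochWave_planeWave, blochWave, ← phase, planeWave_latEquiv, cellMode,
    mul_comm (P.phi _ _)]
  rfl

theorem Hpol_zero_polMode (k : Space) (c : LatticeIndex × ℕ) (q : Config) :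
    P.Hpol 0 (P.polMode k c) q
      = ((P.kinetic k c.1 + P.energy c.2 : ℝ) : ℂ) * P.polMode k c q := by
  rw [polMode, Hpol_modeWave]
  have h : P.shiftedOscillator (P.A k.1 c.1.1) (fun v => P.phi c.2 (v - P.A k.1 c.1.1))
      = fun v => (P.energy c.2 : ℂ) * P.phi c.2 (v - P.A k.1 c.1.1) :=
    funext fun v => P.shiftedOscillator_phi _ _ _
  rw [h]
  simp only [modeWave, Pi.zero_apply]
  push_cast
  ring

/-- The pairing of a function with a Bloch wave. -/
noncomputable def blochCoeff (k : Space) (F : Config → ℂ) (c : LatticeIndex × ℕ) : ℂ :=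
  ∫ q, conj (P.polMode k c q) * F q

theorem memLp_periodize_twist (k : Space) {F : Config → ℂ} (hF : Continuous F)
    (hs : HasCompactSupport F) : MemLp (periodize (P.twist k F)) 2 stripMeasure :=
  (P.isCellFinite_twist k hF hs).memLp_periodize

theorem cellMode_cellShift (k : Space) (c : LatticeIndex × ℕ) (n : LatticeIndex) (x : Config) :
    P.cellMode k c (cellShift n x) = P.cellMode k c x := by
  rw [cellMode, cellShift, torusExp_add_intVec, cellMode]

/-- Unfolding in reverse, with the periodic basis function: coefficients of a folded test function
are pairings with a smooth Bloch mode over all of space, where integration by parts meets no cell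
boundaries. -/
theorem exists_modeCoeff_periodize_twist : ∃ s : ℝ, 0 < s ∧
    ∀ (k : Space) (F : Config → ℂ), Continuous F → HasCompactSupport F → ∀ c,
      P.modeCoeff k (periodize (P.twist k F)) c = s * P.blochCoeff k F c := by
  obtain ⟨s, hs, h⟩ := exists_integral_comp_eq (volume : Measure Config) P.latEquiv
  refine ⟨s, hs, fun k F hF hFs c => ?_⟩
  have h1 := ((P.isCellFinite_twist k hF hFs).integral_conj_mul (P.memLp_cellMode k c)
    fun n => Eventually.of_forall fun x => P.cellMode_cellShift k c n x).2
  have h2 : P.modeCoeff k (periodize (P.twist k F)) c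
      = conj (∫ x, conj (periodize (P.twist k F) x) * P.cellMode k c x ∂stripMeasure) := by
    rw [modeCoeff, ← integral_conj]
    refine integral_congr_ae (Eventually.of_forall fun q => ?_)
    simp only [map_mul, Complex.conj_conj]
    ring
  rw [h2, ← h1, ← integral_conj, blochCoeff, ← h]
  refine integral_congr_ae (Eventually.of_forall fun x => ?_)
  simp only [map_mul, Complex.conj_conj, polMode_latEquiv, twist]
  ring

/-- The modes are smooth eigenfunctions of the free Hamiltonian, not square integrable over space;
compact support of `F` suffices to move the operator onto them. -/
theorem blochCoeff_Hpol_zero (k : Space) {F : Config → ℂ} (hF : ContDiff ℝ 2 F)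
    (hs : HasCompactSupport F) (c : LatticeIndex × ℕ) :
    P.blochCoeff k (P.Hpol 0 F) c
      = ((P.kinetic k c.1 + P.energy c.2 : ℝ) : ℂ) * P.blochCoeff k F c := by
  rw [blochCoeff, integral_conj_mul_swap, P.integral_conj_Hpol_zero_mul hF hs
    ((P.contDiff_polMode k c).of_le two_le_infty), blochCoeff,
    integral_conj_mul_swap _ F]
  simp only [Hpol_zero_polMode]
  simp only [mul_left_comm _ ((P.kinetic k c.1 + P.energy c.2 : ℝ) : ℂ)]
  rw [integral_const_mul, map_mul, Complex.conj_ofReal]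

/-- The scalar product of a wave vector with a displacement in `(x, w, z)`. -/
def dot (b : Space) (w : Config) : ℝ := b.1 * w.1 + b.2.1 * w.2.1 + b.2.2 * w.2.2.1

theorem fderiv_polMode (k : Space) (c : LatticeIndex × ℕ) (q w : Config) (hw : w.2.2.2 = 0) :
    fderiv ℝ (P.polMode k c) q w
      = Complex.I * (dot (P.waveVec k c.1) w : ℂ) * P.polMode k c q := by
  rw [fderiv_eq_sum ((P.contDiff_polMode k c).differentiable (by simp) q) w hw, polMode,
    partial1_modeWave, partial2_modeWave, partial3_modeWave, dot]
  push_cast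
  ring

theorem dot_waveVec (k : Space) (n : LatticeIndex) (t : Space) :
    dot (P.waveVec k n) (P.latEquiv (0, t)) = dot k (P.latEquiv (0, t))
      + 2 * Real.pi * (n.1 * t.1 + n.2.1 * t.2.1 + n.2.2 * t.2.2) := by
  have h1 := P.a₁_pos.ne'
  have h2 := P.a₂_pos.ne'
  have h3 := P.a₃_pos.ne'
  have h4 := P.ωc_pos.ne'
  have h5 := P.sin_θ_pos.ne'
  have h6 := sqrt_two_ne
  rw [dot, dot, latEquiv_apply, waveVec]
  simp only [Gx, Gw, Gmn, Gy, Gz]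
  field_simp
  ring

/-- The first order operator that multiplies the coefficients by `1 + 2πi n · t`. -/
noncomputable def dress (k t : Space) (F : Config → ℂ) (q : Config) : ℂ :=
  (1 - Complex.I * (dot k (P.latEquiv (0, t)) : ℂ)) * F q + fderiv ℝ F q (P.latEquiv (0, t))

theorem contDiff_dress (k t : Space) {F : Config → ℂ} (hF : ContDiff ℝ ∞ F) :
    ContDiff ℝ ∞ (P.dress k t F) :=
  (contDiff_const.mul hF).add (contDiff_fderiv_apply hF (by simp) _)

theorem hasCompactSupport_dress (k t : Space) {F : Config → ℂ} (hs : HasCompactSupport F) :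
    HasCompactSupport (P.dress k t F) :=
  hs.mul_left.add (HasCompactSupport.fderiv_apply' hs _)

/-- Integration by parts makes the directional derivative multiply by `i (k + G_n) · w`. Subtracting
`i k · w` leaves `2πi n · t`, and the added `1` keeps the factor away from zero. -/
theorem blochCoeff_dress (k t : Space) {F : Config → ℂ} (hF : ContDiff ℝ ∞ F)
    (hs : HasCompactSupport F) (c : LatticeIndex × ℕ) :
    P.blochCoeff k (P.dress k t F) c
      = (1 + Complex.I * ((2 * Real.pi * (c.1.1 * t.1 + c.1.2.1 * t.2.1 + c.1.2.2 * t.2.2) : ℝ) : ℂ))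
        * P.blochCoeff k F c := by
  set w := P.latEquiv (0, t) with hw
  have hw0 : w.2.2.2 = 0 := rfl
  have hm := P.contDiff_polMode k c
  have h1 : ∫ q, conj (P.polMode k c q) * fderiv ℝ F q w
      = Complex.I * (dot (P.waveVec k c.1) w : ℂ) * P.blochCoeff k F c := by
    rw [integral_conj_mul_swap, integral_conj_fderiv_mul (hF.of_le (by simp)) hs
      (hm.of_le (by simp)), blochCoeff, integral_conj_mul_swap _ F]
    simp only [P.fderiv_polMode k c _ w hw0]
    have e : ∀ q, conj (F q) * (Complex.I * (dot (P.waveVec k c.1) w : ℂ) * P.polMode k c q)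
        = (Complex.I * (dot (P.waveVec k c.1) w : ℂ)) * (conj (F q) * P.polMode k c q) := by
      intro q
      ring
    simp only [e]
    rw [integral_const_mul, map_neg, map_mul, map_mul, Complex.conj_I, Complex.conj_ofReal]
    ring
  have h2 : ∀ q, conj (P.polMode k c q) * P.dress k t F q
      = (1 - Complex.I * (dot k w : ℂ)) * (conj (P.polMode k c q) * F q)
        + conj (P.polMode k c q) * fderiv ℝ F q w := by
    intro q
    rw [dress, ← hw]
    ring
  have i1 := integrable_conj_mul_of_hasCompactSupport hF.continuous hs hm.continuous
  have i2 := integrable_conj_mul_of_hasCompactSupport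
    (contDiff_fderiv_apply hF (m := ∞) (by simp) w).continuous
    (HasCompactSupport.fderiv_apply' hs w) hm.continuous
  rw [blochCoeff]
  simp only [h2]
  rw [integral_add (i1.const_mul _) i2, integral_const_mul, h1, hw, P.dot_waveVec, ← hw, blochCoeff]
  push_cast
  ring

end Params

/-! ### Absolute summability, and the weak equation from the central equation. -/

theorem summable_one_add_sq_inv : Summable fun n : ℤ => (1 + (n : ℝ) ^ 2)⁻¹ := by
  have h1 : Summable fun n : ℤ => 1 / (n : ℝ) ^ 2 := Real.summable_one_div_int_pow.2 one_lt_two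
  have h2 : Summable fun n : ℤ => if n = 0 then (1 : ℝ) else 0 :=
    (hasSum_ite_eq 0 (1 : ℝ)).summable
  refine Summable.of_nonneg_of_le (fun n => by positivity) (fun n => ?_) (h1.add h2)
  by_cases hn : n = 0
  · simp [hn]
  · have hn' : 0 < (n : ℝ) ^ 2 := by positivity
    rw [if_neg hn, add_zero, one_div]
    exact inv_anti₀ hn' (by linarith)

theorem summable_prod_mul {ι ι' : Type*} {f : ι → ℝ} {g : ι' → ℝ} (hf : Summable f)
    (hg : Summable g) (hf0 : ∀ a, 0 ≤ f a) (hg0 : ∀ b, 0 ≤ g b) :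
    Summable fun x : ι × ι' => f x.1 * g x.2 :=
  hf.mul_of_nonneg hg hf0 hg0

/-- A summable weight on the index set of the expansion. -/
noncomputable def indexWeight (c : LatticeIndex × ℕ) : ℝ :=
  ((1 + (c.1.1 : ℝ) ^ 2)⁻¹ * ((1 + (c.1.2.1 : ℝ) ^ 2)⁻¹ * (1 + (c.1.2.2 : ℝ) ^ 2)⁻¹))
      * (((c.2 : ℝ) + 1) ^ 2)⁻¹

theorem summable_nat_add_one_sq_inv : Summable fun j : ℕ => (((j : ℝ) + 1) ^ 2)⁻¹ := by
  have h := (summable_nat_add_iff 1).2 (Real.summable_one_div_nat_pow.2 one_lt_two)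
  simpa using h

theorem summable_indexWeight : Summable indexWeight := by
  have hz : ∀ x : ℝ, 0 ≤ (1 + x ^ 2)⁻¹ := fun x => by positivity
  have hj : ∀ x : ℝ, 0 ≤ ((x + 1) ^ 2)⁻¹ := fun x => by positivity
  generalize hf : (fun n : ℤ => (1 + (n : ℝ) ^ 2)⁻¹) = f
  generalize hg : (fun j : ℕ => (((j : ℝ) + 1) ^ 2)⁻¹) = g
  have hf0 : ∀ n, 0 ≤ f n := fun n => hf ▸ hz n
  have hg0 : ∀ n, 0 ≤ g n := fun n => hg ▸ hj n
  have sf : Summable f := hf ▸ summable_one_add_sq_inv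
  have sg : Summable g := hg ▸ summable_nat_add_one_sq_inv
  have e : indexWeight = fun c => (f c.1.1 * (f c.1.2.1 * f c.1.2.2)) * g c.2 := by
    rw [← hf, ← hg]
    rfl
  rw [e]
  have h2 := summable_prod_mul sf sf hf0 hf0
  have h3 := summable_prod_mul sf h2 hf0 fun n => mul_nonneg (hf0 _) (hf0 _)
  exact summable_prod_mul h3 sg (fun n => mul_nonneg (hf0 _) (mul_nonneg (hf0 _) (hf0 _))) hg0

theorem norm_one_add_I_mul_sq (x : ℝ) : ‖(1 + Complex.I * (x : ℂ) : ℂ)‖ ^ 2 = 1 + x ^ 2 := by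
  rw [← Complex.normSq_eq_norm_sq, mul_comm]
  have h := Complex.normSq_add_mul_I 1 x
  simpa using h

theorem one_add_sq_le_norm_sq (n : ℤ) (x : ℝ) (hx : x = 2 * Real.pi * n) :
    1 + (n : ℝ) ^ 2 ≤ ‖(1 + Complex.I * (x : ℂ) : ℂ)‖ ^ 2 := by
  rw [norm_one_add_I_mul_sq, hx, mul_pow]
  have h1 : 1 ≤ (2 * Real.pi) ^ 2 := by nlinarith [Real.pi_gt_three]
  nlinarith [sq_nonneg (n : ℝ)]

namespace Params

variable (P : Params) {vext : Space → ℝ}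

theorem kinetic_nonneg (k : Space) (n : LatticeIndex) : 0 ≤ P.kinetic k n := by
  have h1 := P.me_pos
  have h2 := P.M_pos
  unfold kinetic
  positivity

theorem modeCoeff_periodize_Hpol_zero (k : Space) {F : Config → ℂ} (hF : ContDiff ℝ 2 F)
    (hs : HasCompactSupport F) (c : LatticeIndex × ℕ) :
    P.modeCoeff k (periodize (P.twist k (P.Hpol 0 F))) c
      = ((P.kinetic k c.1 + P.energy c.2 : ℝ) : ℂ) * P.modeCoeff k (periodize (P.twist k F)) c := by
  obtain ⟨s, -, h⟩ := P.exists_modeCoeff_periodize_twist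
  rw [h k _ (P.continuous_Hpol_zero hF) (P.hasCompactSupport_Hpol_zero hF hs),
    h k F hF.continuous hs, P.blochCoeff_Hpol_zero k hF hs]
  ring

theorem modeCoeff_periodize_dress (k t : Space) {F : Config → ℂ} (hF : ContDiff ℝ ∞ F)
    (hs : HasCompactSupport F) (c : LatticeIndex × ℕ) :
    P.modeCoeff k (periodize (P.twist k (P.dress k t F))) c
      = (1 + Complex.I * ((2 * Real.pi * (c.1.1 * t.1 + c.1.2.1 * t.2.1 + c.1.2.2 * t.2.2) : ℝ) : ℂ))
        * P.modeCoeff k (periodize (P.twist k F)) c := by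
  obtain ⟨s, -, h⟩ := P.exists_modeCoeff_periodize_twist
  rw [h k _ (P.contDiff_dress k t hF).continuous (P.hasCompactSupport_dress k t hs),
    h k F hF.continuous hs, P.blochCoeff_dress k t hF hs]
  ring

/-- Dressing along the three lattice directions and then applying the free Hamiltonian multiplies
the coefficients by factors growing like `|n|`, `|m|`, `|l|` and `j`, and leaves a square summable
family. The reciprocals of these factors are square summable too, so their product with that family
is summable. -/
theorem summable_norm_modeCoeff (k : Space) {F : Config → ℂ} (hF : ContDiff ℝ ∞ F)
    (hs : HasCompactSupport F) :
    Summable fun c => ‖P.modeCoeff k (periodize (P.twist k F)) c‖ := by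
  have c1 := P.contDiff_dress k (1, 0, 0) hF
  have s1 := P.hasCompactSupport_dress k (1, 0, 0) hs
  have c2 := P.contDiff_dress k (0, 1, 0) c1
  have s2 := P.hasCompactSupport_dress k (0, 1, 0) s1
  have c3 := P.contDiff_dress k (0, 0, 1) c2
  have s3 := P.hasCompactSupport_dress k (0, 0, 1) s2
  have c4 := c3.of_le two_le_infty
  have hsum := P.summable_norm_sq_modeCoeff k (P.memLp_periodize_twist k
    (P.continuous_Hpol_zero c4) (P.hasCompactSupport_Hpol_zero c4 s3))
  simp only [P.modeCoeff_periodize_Hpol_zero k c4 s3, P.modeCoeff_periodize_dress k _ c2 s2,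
    P.modeCoeff_periodize_dress k _ c1 s1, P.modeCoeff_periodize_dress k _ hF hs] at hsum
  -- `ℏΩ (j + 1/2) ≥ δ (j + 1)` for all `j`, including `j = 0`.
  set δ : ℝ := P.hbar * P.Ω / 2 with hδ
  have hδ0 : 0 < δ := by
    have := P.hbar_pos
    have := P.Ω_pos
    positivity
  refine Summable.of_nonneg_of_le (fun _ => norm_nonneg _) (fun c => ?_)
    (((summable_indexWeight.mul_left (δ ^ 2)⁻¹).add hsum).mul_left (1 / 2))
  simp only [norm_mul, mul_pow]
  set X := ‖P.modeCoeff k (periodize (P.twist k F)) c‖ with hX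
  have hX0 : 0 ≤ X := norm_nonneg _
  have b1 := one_add_sq_le_norm_sq c.1.1
    (2 * Real.pi * (c.1.1 * 1 + c.1.2.1 * 0 + c.1.2.2 * 0)) (by ring)
  have b2 := one_add_sq_le_norm_sq c.1.2.1
    (2 * Real.pi * (c.1.1 * 0 + c.1.2.1 * 1 + c.1.2.2 * 0)) (by ring)
  have b3 := one_add_sq_le_norm_sq c.1.2.2
    (2 * Real.pi * (c.1.1 * 0 + c.1.2.1 * 0 + c.1.2.2 * 1)) (by ring)
  have b0 : δ ^ 2 * ((c.2 : ℝ) + 1) ^ 2 ≤ ‖((P.kinetic k c.1 + P.energy c.2 : ℝ) : ℂ)‖ ^ 2 := by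
    rw [Complex.norm_real, Real.norm_eq_abs, sq_abs, ← mul_pow]
    have h1 := P.kinetic_nonneg k c.1
    have h2 : δ * ((c.2 : ℝ) + 1) ≤ P.energy c.2 := by
      rw [energy, hδ]
      have h3 := P.hbar_pos
      have h4 := P.Ω_pos
      have h5 : (0 : ℝ) ≤ c.2 := Nat.cast_nonneg _
      nlinarith [mul_nonneg (mul_pos h3 h4).le h5]
    gcongr
    linarith
  set y0 := ‖((P.kinetic k c.1 + P.energy c.2 : ℝ) : ℂ)‖ ^ 2
  set y1 := ‖(1 + Complex.I *
    ((2 * Real.pi * (c.1.1 * 1 + c.1.2.1 * 0 + c.1.2.2 * 0) : ℝ) : ℂ) : ℂ)‖ ^ 2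
  set y2 := ‖(1 + Complex.I *
    ((2 * Real.pi * (c.1.1 * 0 + c.1.2.1 * 1 + c.1.2.2 * 0) : ℝ) : ℂ) : ℂ)‖ ^ 2
  set y3 := ‖(1 + Complex.I *
    ((2 * Real.pi * (c.1.1 * 0 + c.1.2.1 * 0 + c.1.2.2 * 1) : ℝ) : ℂ) : ℂ)‖ ^ 2
  set p : ℝ := (δ ^ 2 * ((c.2 : ℝ) + 1) ^ 2) * ((1 + (c.1.2.2 : ℝ) ^ 2) *
    ((1 + (c.1.2.1 : ℝ) ^ 2) * (1 + (c.1.1 : ℝ) ^ 2))) with hp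
  have hp0 : 0 < p := by positivity
  have hle : p * X ^ 2 ≤ y0 * (y3 * (y2 * (y1 * X ^ 2))) := by
    have e : p * X ^ 2 = (δ ^ 2 * ((c.2 : ℝ) + 1) ^ 2) * ((1 + (c.1.2.2 : ℝ) ^ 2) *
      ((1 + (c.1.2.1 : ℝ) ^ 2) * ((1 + (c.1.1 : ℝ) ^ 2) * X ^ 2))) := by rw [hp]; ring
    rw [e]
    gcongr
  have e2 : (δ ^ 2)⁻¹ * indexWeight c = p⁻¹ := by
    rw [hp, indexWeight]
    simp only [mul_inv]
    ring
  rw [e2]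
  -- The inequality of arithmetic and geometric means for `p⁻¹` and `p X²`, both terms of summable
  -- families.
  have h3 : X ≤ 1 / 2 * (p⁻¹ + p * X ^ 2) := by
    have h4 : p⁻¹ * (p * X - 1) ^ 2 = p⁻¹ + p * X ^ 2 - 2 * X := by
      field_simp
      ring
    have h5 : 0 ≤ p⁻¹ * (p * X - 1) ^ 2 := by positivity
    linarith
  linarith

/-- `L²` convergence of the expansion of `f` does not survive multiplication by an unbounded
potential. But the products of the potential with the basis functions all have the same norm, so
absolutely summable coefficients make their series converge. Its sum is the potential times `f`,
since both have the same coefficients by Parseval. -/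
theorem hasSum_conj_modeCoeff_mul_potCoeff (hper : P.IsLatticePeriodic vext)
    (hL2 : MemLp vext 2 (volume.restrict P.unitCell)) (k : Space) {f g : Config → ℂ}
    (hf : MemLp f 2 stripMeasure)
    (hVf : MemLp (fun x => P.stripPot vext x * f x) 2 stripMeasure)
    (hg : MemLp g 2 stripMeasure) (hsum : Summable fun c => ‖P.modeCoeff k f c‖) :
    HasSum (fun c => conj (P.modeCoeff k f c) * P.potCoeff vext k g c)
      (∫ x, conj (P.stripPot vext x * f x) * g x ∂stripMeasure) := by
  have hb := P.memLp_stripPot_mul_cellMode hper hL2 k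
  set b : LatticeIndex × ℕ → Lp ℂ 2 stripMeasure := fun c => (hb c).toLp _ with hbdef
  set K : ℝ := ∫ t, ‖P.cellPot vext t‖ ^ 2 ∂cubeMeasure with hK
  have hnorm : ∀ c, ‖b c‖ = Real.sqrt K := by
    intro c
    rw [hK, ← P.integral_norm_sq_stripPot_mul_cellMode hper hL2 k c, ← norm_toLp_sq (hb c),
      Real.sqrt_sq (norm_nonneg _)]
  have hS : Summable fun c => P.modeCoeff k f c • b c := by
    refine Summable.of_norm ?_
    simp only [norm_smul, hnorm]
    exact hsum.mul_right _
  obtain ⟨S, hS⟩ := hS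
  have hSeq : S = hVf.toLp _ := by
    refine (P.modeBasis k).repr.injective ?_
    ext d
    rw [HilbertBasis.repr_apply_apply, modeBasis_repr_toLp]
    have h1 := hS.mapL (innerSL ℂ (P.modeBasis k d))
    have h2 := P.hasSum_inner_modeCoeff k (hb d) hf
    have e1 : ∀ c, innerSL ℂ (P.modeBasis k d) (P.modeCoeff k f c • b c)
        = conj (P.modeCoeff k (fun x => P.stripPot vext x * P.cellMode k d x) c)
          * P.modeCoeff k f c := by
      intro c
      rw [innerSL_apply_apply, inner_smul_right, modeBasis_apply, hbdef]
      simp only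
      rw [inner_toLp, modeCoeff, modeCoeff, ← integral_conj, mul_comm]
      congr 1
      refine integral_congr_ae (Eventually.of_forall fun x => ?_)
      simp only [map_mul, Complex.conj_conj, conj_stripPot]
      ring
    rw [funext e1] at h1
    have h3 := h1.unique h2
    rw [innerSL_apply_apply] at h3
    rw [h3, modeCoeff]
    refine integral_congr_ae (Eventually.of_forall fun x => ?_)
    simp only [map_mul, conj_stripPot]
    ring
  have h4 := (hS.mapL (innerSL ℂ (hg.toLp g))).star
  rw [innerSL_apply_apply, hSeq] at h4
  have e5 : star (inner ℂ (hg.toLp g) (hVf.toLp _))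
      = ∫ x, conj (P.stripPot vext x * f x) * g x ∂stripMeasure := by
    rw [← inner_toLp hVf hg]
    exact inner_conj_symm _ _
  rw [e5] at h4
  convert! h4 using 2 with c
  rw [innerSL_apply_apply, inner_smul_right, hbdef]
  simp only
  rw [potCoeff, ← inner_toLp (hb c) hg, ← inner_conj_symm (hg.toLp g), StarMul.star_mul, mul_comm]
  congr 1
  exact (Complex.conj_conj _).symm

theorem memLp_stripPot_mul_periodize_twist (hper : P.IsLatticePeriodic vext)
    (hL2 : MemLp vext 2 (volume.restrict P.unitCell)) (k : Space) {F : Config → ℂ}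
    (hF : Continuous F) (hs : HasCompactSupport F) :
    MemLp (fun x => P.stripPot vext x * periodize (P.twist k F) x) 2 stripMeasure := by
  have h := (P.isCellFinite_stripPot_mul hper hL2 (P.continuous_twist k hF)
    (P.hasCompactSupport_twist k hs)).memLp_periodize
  exact (memLp_congr_ae (Eventually.of_forall fun x =>
    P.periodize_stripPot_mul hper (P.twist k F) x)).1 h

/-- The weak formulation as a combination of the rows of the central equation. -/
theorem hasSum_rows (hper : P.IsLatticePeriodic vext)
    (hL2 : MemLp vext 2 (volume.restrict P.unitCell)) (k : Space) (E : ℝ) {g : Config → ℂ}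
    (hg : MemLp g 2 stripMeasure) {F : Config → ℂ} (hF : ContDiff ℝ ∞ F)
    (hs : HasCompactSupport F) :
    HasSum (fun c => conj (P.modeCoeff k (periodize (P.twist k F)) c) *
        (P.modeCoeff k g c * ((P.kinetic k c.1 + P.energy c.2 - E : ℝ) : ℂ)
          + P.potCoeff vext k g c))
      ((∫ x, conj (periodize (P.twist k (P.Hpol 0 F)) x) * g x ∂stripMeasure)
        + (∫ x, conj (P.stripPot vext x * periodize (P.twist k F) x) * g x ∂stripMeasure)
        - (E : ℂ) * ∫ x, conj (periodize (P.twist k F) x) * g x ∂stripMeasure) := by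
  have hF2 := hF.of_le two_le_infty
  have hm := P.memLp_periodize_twist k hF.continuous hs
  have hA := P.hasSum_inner_modeCoeff k (P.memLp_periodize_twist k (P.continuous_Hpol_zero hF2)
    (P.hasCompactSupport_Hpol_zero hF2 hs)) hg
  have hC := P.hasSum_inner_modeCoeff k hm hg
  have hB := P.hasSum_conj_modeCoeff_mul_potCoeff hper hL2 k hm
    (P.memLp_stripPot_mul_periodize_twist hper hL2 k hF.continuous hs) hg
    (P.summable_norm_modeCoeff k hF hs)
  convert! (hA.add hB).sub (hC.mul_left (E : ℂ)) using 2 with c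
  rw [P.modeCoeff_periodize_Hpol_zero k hF2 hs, map_mul, Complex.conj_ofReal]
  push_cast
  ring

/-- Every term of the combination in `hasSum_rows` contains a row of the central equation and
vanishes. -/
theorem isWeakEigenfunction_of_centralEquation (hper : P.IsLatticePeriodic vext)
    (hL2 : MemLp vext 2 (volume.restrict P.unitCell)) (k : Space) (E : ℝ) {u : Config → ℂ}
    (hu : P.IsBlochAmplitude u)
    (hC : P.CentralEquation vext k E (P.modeCoeff k fun x => u (P.latEquiv x))) :
    P.IsWeakEigenfunction vext E (blochWave k u ∘ P.toPolaritonic) := by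
  have hu2 := P.memLp_polCell_iff.1 hu.2
  rw [P.centralEquation_iff hper hL2 k E hu2] at hC
  rw [P.isWeakEigenfunction_iff_strip hper hL2 k E hu]
  intro F hF hs
  have h := P.hasSum_rows hper hL2 k E hu2 hF hs
  simp only [hC, mul_zero] at h
  exact sub_eq_zero.1 (h.unique hasSum_zero)

end Params

/-! ### Test functions with a single Fourier mode. -/

/-- A smooth function on the line whose integer translates sum to one. -/
noncomputable def hat (s : ℝ) : ℝ := Real.smoothTransition (s + 1) - Real.smoothTransition s

theorem contDiff_hat {n : ℕ∞} : ContDiff ℝ n hat :=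
  (Real.smoothTransition.contDiff.comp (contDiff_id.add contDiff_const)).sub
    Real.smoothTransition.contDiff

theorem hat_eq_zero_of_le {s : ℝ} (hs : s ≤ -1) : hat s = 0 := by
  rw [hat, Real.smoothTransition.zero_of_nonpos (by linarith),
    Real.smoothTransition.zero_of_nonpos (by linarith), sub_zero]

theorem hat_eq_zero_of_ge {s : ℝ} (hs : 1 ≤ s) : hat s = 0 := by
  rw [hat, Real.smoothTransition.one_of_one_le (by linarith),
    Real.smoothTransition.one_of_one_le (by linarith), sub_self]

/-- `hat` vanishes outside `(-1, 1)`, so for `s` in the unit interval only `s - 1` and `s` can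
contribute; their values telescope to one. -/
theorem hat_add_eq_zero {s : ℝ} (hs : s ∈ Set.Ico (0 : ℝ) 1) {n : ℤ}
    (hn : n ∉ ({-1, 0} : Finset ℤ)) : hat (s + n) = 0 := by
  have h : n ≤ -2 ∨ 1 ≤ n := by
    simp only [Finset.mem_insert, Finset.mem_singleton] at hn
    omega
  rcases h with h | h
  · have h' : (n : ℝ) ≤ -2 := by exact_mod_cast h
    exact hat_eq_zero_of_le (by linarith [hs.2])
  · have h' : (1 : ℝ) ≤ n := by exact_mod_cast h
    exact hat_eq_zero_of_ge (by linarith [hs.1])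

theorem sum_hat_add {s : ℝ} (hs : s ∈ Set.Ico (0 : ℝ) 1) :
    ∑ n ∈ ({-1, 0} : Finset ℤ), hat (s + n) = 1 := by
  rw [Finset.sum_pair (by norm_num)]
  simp only [hat, Int.cast_neg, Int.cast_one, Int.cast_zero, add_zero, neg_add_cancel_right]
  rw [Real.smoothTransition.one_of_one_le (x := s + 1) (by linarith [hs.1]),
    Real.smoothTransition.zero_of_nonpos (x := s + -1) (by linarith [hs.2])]
  ring

/-- A smooth function whose integer translates sum to one. -/
noncomputable def hatVec (t : Space) : ℝ := hat t.1 * (hat t.2.1 * hat t.2.2)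

theorem tsum_hatVec_add {t : Space} (ht : t ∈ cube) :
    ∑' n : LatticeIndex, hatVec (t + intVec n) = 1 := by
  have h0 : ∀ n ∉ ({-1, 0} : Finset ℤ) ×ˢ ({-1, 0} : Finset ℤ) ×ˢ ({-1, 0} : Finset ℤ),
      hatVec (t + intVec n) = 0 := by
    intro n hn
    simp only [Finset.mem_product, not_and_or] at hn
    simp only [hatVec, intVec, Prod.fst_add, Prod.snd_add]
    rcases hn with h | h | h
    · rw [hat_add_eq_zero ht.1 h, zero_mul]
    · rw [hat_add_eq_zero ht.2.1 h, zero_mul, mul_zero]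
    · rw [hat_add_eq_zero ht.2.2 h, mul_zero, mul_zero]
  rw [tsum_eq_sum h0, Finset.sum_product]
  simp only [Finset.sum_product, hatVec, intVec, Prod.fst_add, Prod.snd_add, ← Finset.mul_sum]
  rw [sum_hat_add ht.2.2]
  simp only [mul_one]
  rw [sum_hat_add ht.2.1]
  simp only [mul_one]
  exact sum_hat_add ht.1

theorem contDiff_torusExp (n : LatticeIndex) {m : WithTop ℕ∞} : ContDiff ℝ m (torusExp n) := by
  have h : ContDiff ℝ m (fun t : Space =>
      2 * Real.pi * (n.1 * t.1 + n.2.1 * t.2.1 + n.2.2 * t.2.2)) := by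
    fun_prop
  exact (contDiff_const.mul (Complex.ofRealCLM.contDiff.comp h)).cexp

/-- The localized plane wave times a function of the oscillator coordinate. -/
noncomputable def localMode (n : LatticeIndex) (ρ : ℝ → ℂ) (x : Config) : ℂ :=
  (hatVec x.2 : ℂ) * (ρ x.1 * torusExp n x.2)

theorem contDiff_localMode (n : LatticeIndex) {ρ : ℝ → ℂ} (hρ : ContDiff ℝ ∞ ρ) :
    ContDiff ℝ ∞ (localMode n ρ) := by
  have h : ContDiff ℝ ∞ (fun x : Config => hatVec x.2) := by
    unfold hatVec
    exact (contDiff_hat.comp (by fun_prop)).mul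
      ((contDiff_hat.comp (by fun_prop)).mul (contDiff_hat.comp (by fun_prop)))
  exact (Complex.ofRealCLM.contDiff.comp h).mul
    ((hρ.comp contDiff_fst).mul ((contDiff_torusExp n).comp contDiff_snd))

theorem hasCompactSupport_localMode (n : LatticeIndex) {ρ : ℝ → ℂ} (hρ : HasCompactSupport ρ) :
    HasCompactSupport (localMode n ρ) := by
  refine HasCompactSupport.intro (K := tsupport ρ ×ˢ (Set.Icc (-1 : ℝ) 1 ×ˢ
    (Set.Icc (-1 : ℝ) 1 ×ˢ Set.Icc (-1 : ℝ) 1)))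
    (IsCompact.prod hρ (isCompact_Icc.prod (isCompact_Icc.prod isCompact_Icc))) fun x hx => ?_
  have key : ∀ s : ℝ, s ∉ Set.Icc (-1 : ℝ) 1 → hat s = 0 := by
    intro s hs
    rw [Set.mem_Icc, not_and_or, not_le, not_le] at hs
    rcases hs with h | h
    · exact hat_eq_zero_of_le h.le
    · exact hat_eq_zero_of_ge h.le
  rw [localMode, hatVec]
  simp only [Set.mem_prod, not_and_or] at hx
  rcases hx with h | h | h | h
  · rw [image_eq_zero_of_notMem_tsupport h]
    ring
  · rw [key _ h]
    simp
  · rw [key _ h]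
    simp
  · rw [key _ h]
    simp

/-- The partition of unity restores the plane wave exactly: a compactly supported test function
folds to a pure mode. -/
theorem periodize_localMode (n : LatticeIndex) (ρ : ℝ → ℂ) {x : Config} (hx : x.2 ∈ cube) :
    periodize (localMode n ρ) x = ρ x.1 * torusExp n x.2 := by
  have e : ∀ m, localMode n ρ (cellShift m x)
      = (hatVec (x.2 + intVec m) : ℂ) * (ρ x.1 * torusExp n x.2) := by
    intro m
    rw [localMode, cellShift, torusExp_add_intVec]
  rw [periodize]
  simp only [e]
  rw [tsum_mul_right, ← Complex.ofReal_tsum, tsum_hatVec_add hx, Complex.ofReal_one, one_mul]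

theorem integral_mul_deriv_deriv {f ρ : ℝ → ℂ} (hf : ContDiff ℝ 2 f) (hρ : ContDiff ℝ 2 ρ)
    (hs : HasCompactSupport ρ) :
    ∫ v, f v * deriv (deriv ρ) v = ∫ v, deriv (deriv f) v * ρ v := by
  have key : ∀ {a b : ℝ → ℂ}, ContDiff ℝ 1 a → ContDiff ℝ 1 b → HasCompactSupport b →
      ∫ v, a v * deriv b v = -∫ v, deriv a v * b v := by
    intro a b ha hb hsb
    have ca := ha.continuous_deriv le_rfl
    have cb := hb.continuous_deriv le_rfl
    exact integral_mul_deriv_eq_deriv_mul_of_integrable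
      (fun s _ => (ha.differentiable one_ne_zero s).hasDerivAt)
      (fun s _ => (hb.differentiable one_ne_zero s).hasDerivAt)
      ((ha.continuous.mul cb).integrable_of_hasCompactSupport hsb.deriv.mul_left)
      ((ca.mul hb.continuous).integrable_of_hasCompactSupport hsb.mul_left)
      ((ha.continuous.mul hb.continuous).integrable_of_hasCompactSupport hsb.mul_left)
  have h2 : ∀ {a : ℝ → ℂ}, ContDiff ℝ 2 a → ContDiff ℝ 1 (deriv a) := fun ha =>
    (contDiff_succ_iff_deriv.1 (by simpa [one_add_one_eq_two] using ha)).2.2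
  rw [key (hf.of_le (by norm_num)) (h2 hρ) hs.deriv, key (h2 hf) (hρ.of_le (by norm_num)) hs,
    neg_neg]

namespace Params

variable (P : Params) {vext : Space → ℝ}

theorem integral_phi_mul_shiftedOscillator (j : ℕ) (a : ℝ) {ρ : ℝ → ℂ} (hρ : ContDiff ℝ 2 ρ)
    (hs : HasCompactSupport ρ) :
    ∫ v, conj (P.phi j (v - a)) * P.shiftedOscillator a ρ v
      = (P.energy j : ℂ) * ∫ v, conj (P.phi j (v - a)) * ρ v := by
  have hφ : ContDiff ℝ 2 (fun v => P.phi j (v - a)) :=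
    ((P.contDiff_phi j).of_le two_le_infty).comp (contDiff_id.sub contDiff_const)
  have h2 : ∀ {g : ℝ → ℂ}, ContDiff ℝ 2 g → Continuous (deriv (deriv g)) := fun hg =>
    ((contDiff_succ_iff_deriv.1 (by simpa [one_add_one_eq_two] using hg)).2.2 :
      ContDiff ℝ 1 (deriv _)).continuous_deriv le_rfl
  have hI := integral_mul_deriv_deriv hφ hρ hs
  set c : ℂ := ((P.hbar ^ 2 / (2 * P.μ) : ℝ) : ℂ) with hc
  set d : ℝ → ℂ := fun v => ((P.μ * P.Ω ^ 2 / 2 * (v - a) ^ 2 : ℝ) : ℂ) with hd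
  have hdc : Continuous d := by
    rw [hd]
    fun_prop
  simp only [conj_phi]
  have e1 : ∀ v, P.phi j (v - a) * P.shiftedOscillator a ρ v
      = (-c) * (P.phi j (v - a) * deriv (deriv ρ) v) + d v * P.phi j (v - a) * ρ v := by
    intro v
    rw [shiftedOscillator]
    ring
  have e2 : ∀ v, (P.energy j : ℂ) * (P.phi j (v - a) * ρ v)
      = (-c) * (deriv (deriv fun v => P.phi j (v - a)) v * ρ v) + d v * P.phi j (v - a) * ρ v := by
    intro v
    have h := P.shiftedOscillator_phi a j v
    rw [shiftedOscillator] at h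
    linear_combination (-ρ v) * h
  have i1 : Integrable fun v => P.phi j (v - a) * deriv (deriv ρ) v :=
    (hφ.continuous.mul (h2 hρ)).integrable_of_hasCompactSupport hs.deriv.deriv.mul_left
  have i2 : Integrable fun v => deriv (deriv fun v => P.phi j (v - a)) v * ρ v :=
    ((h2 hφ).mul hρ.continuous).integrable_of_hasCompactSupport hs.mul_left
  have i3 : Integrable fun v => d v * P.phi j (v - a) * ρ v :=
    ((hdc.mul hφ.continuous).mul hρ.continuous).integrable_of_hasCompactSupport hs.mul_left
  rw [← integral_const_mul]
  simp only [e1, e2]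
  rw [integral_add (i1.const_mul _) i3, integral_add (i2.const_mul _) i3, integral_const_mul,
    integral_const_mul, hI]

theorem modeCoeff_mul_torusExp (k : Space) (n : LatticeIndex) (ρ : ℝ → ℂ) (c : LatticeIndex × ℕ) :
    P.modeCoeff k (fun x => ρ x.1 * torusExp n x.2) c
      = (∫ v, conj (P.phi c.2 (v - P.A k.1 c.1.1)) * ρ v) * if c.1 = n then 1 else 0 := by
  rw [modeCoeff, ← integral_conj_torusExp_mul, stripMeasure, ← integral_prod_mul]
  refine integral_congr_ae (Eventually.of_forall fun x => ?_)
  simp only [cellMode, map_mul]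
  ring

/-- The function with prescribed twisted form. -/
noncomputable def untwist (k : Space) (G : Config → ℂ) (q : Config) : ℂ :=
  phase k q * G (P.latEquiv.symm q)

theorem twist_untwist (k : Space) (G : Config → ℂ) : P.twist k (P.untwist k G) = G := by
  ext x
  rw [twist, untwist, ← mul_assoc, conj_phase_mul_phase, one_mul,
    ContinuousLinearEquiv.symm_apply_apply]

theorem contDiff_untwist (k : Space) {G : Config → ℂ} (hG : ContDiff ℝ ∞ G) :
    ContDiff ℝ ∞ (P.untwist k G) :=
  (contDiff_phase k).mul (hG.comp P.latEquiv.symm.contDiff)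

theorem hasCompactSupport_untwist (k : Space) {G : Config → ℂ} (hG : HasCompactSupport G) :
    HasCompactSupport (P.untwist k G) :=
  (hG.comp_homeomorph P.latEquiv.symm.toHomeomorph).mul_left

theorem continuous_shiftedOscillator (a : ℝ) {ρ : ℝ → ℂ} (hρ : ContDiff ℝ 2 ρ) :
    Continuous (P.shiftedOscillator a ρ) := by
  have h2 : Continuous (deriv (deriv ρ)) :=
    ((contDiff_succ_iff_deriv.1 (by simpa [one_add_one_eq_two] using hρ)).2.2 :
      ContDiff ℝ 1 (deriv _)).continuous_deriv le_rfl
  have h3 := hρ.continuous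
  unfold shiftedOscillator
  fun_prop

theorem hasCompactSupport_shiftedOscillator (a : ℝ) {ρ : ℝ → ℂ} (hs : HasCompactSupport ρ) :
    HasCompactSupport (P.shiftedOscillator a ρ) :=
  hs.deriv.deriv.mul_left.add hs.mul_left

/-- Obtained without differentiating the partition of unity: both sides are in `L²` of the strip and
have equal mode coefficients, because the free Hamiltonian and the shifted oscillator have the same
eigenvalues on the modes. -/
theorem periodize_twist_Hpol_zero_localMode (k : Space) (n : LatticeIndex) {ρ : ℝ → ℂ}
    (hρ : ContDiff ℝ ∞ ρ) (hs : HasCompactSupport ρ) :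
    periodize (P.twist k (P.Hpol 0 (P.untwist k (localMode n ρ)))) =ᵐ[stripMeasure]
      fun x => ((P.kinetic k n : ℂ) * ρ x.1 + P.shiftedOscillator (P.A k.1 n.1) ρ x.1)
        * torusExp n x.2 := by
  have hρ2 := hρ.of_le two_le_infty
  have cF := P.contDiff_untwist k (contDiff_localMode n hρ)
  have sF := P.hasCompactSupport_untwist k (hasCompactSupport_localMode n hs)
  have hm1 := P.memLp_periodize_twist k (P.continuous_Hpol_zero (cF.of_le two_le_infty))
    (P.hasCompactSupport_Hpol_zero (cF.of_le two_le_infty) sF)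
  set ρ' : ℝ → ℂ := fun v => (P.kinetic k n : ℂ) * ρ v + P.shiftedOscillator (P.A k.1 n.1) ρ v
    with hρ'
  have c1 := P.continuous_shiftedOscillator (P.A k.1 n.1) hρ2
  have s1 := P.hasCompactSupport_shiftedOscillator (P.A k.1 n.1) hs
  have hρ'm : MemLp ρ' 2 := by
    refine Continuous.memLp_of_hasCompactSupport ?_ ((hs.mul_left).add s1)
    exact (continuous_const.mul hρ.continuous).add c1
  have hm2 : MemLp (fun x : Config => ρ' x.1 * torusExp n x.2) 2 stripMeasure :=
    memLp_two_mul_prod hρ'm (memLp_torusExp n 2)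
  have hsub := P.cellMode_separatesL2 k _ (hm1.sub hm2) fun c => by
    have h1 := P.modeCoeff_periodize_Hpol_zero k (cF.of_le two_le_infty) sF c
    have h2 : P.modeCoeff k (periodize (P.twist k (P.untwist k (localMode n ρ)))) c
        = P.modeCoeff k (fun x => ρ x.1 * torusExp n x.2) c := by
      rw [twist_untwist]
      refine integral_congr_ae ?_
      filter_upwards [ae_stripMeasure_mem] with x hx
      rw [periodize_localMode n ρ hx]
    have h3 : P.modeCoeff k (fun x => ρ' x.1 * torusExp n x.2) c
        = ((P.kinetic k c.1 + P.energy c.2 : ℝ) : ℂ)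
          * P.modeCoeff k (fun x => ρ x.1 * torusExp n x.2) c := by
      rw [modeCoeff_mul_torusExp, modeCoeff_mul_torusExp]
      split_ifs with h
      · have hφ : Continuous fun v => conj (P.phi c.2 (v - P.A k.1 c.1.1)) :=
          Complex.continuous_conj.comp ((P.continuous_phi c.2).comp (by fun_prop))
        have i1 : Integrable fun v => conj (P.phi c.2 (v - P.A k.1 c.1.1)) * ρ v :=
          (hφ.mul hρ.continuous).integrable_of_hasCompactSupport hs.mul_left
        have i2 : Integrable fun v => conj (P.phi c.2 (v - P.A k.1 c.1.1)) *
            P.shiftedOscillator (P.A k.1 c.1.1) ρ v := by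
          rw [h] at hφ ⊢
          exact (hφ.mul c1).integrable_of_hasCompactSupport s1.mul_left
        have e : ∀ v, conj (P.phi c.2 (v - P.A k.1 c.1.1)) * ρ' v
            = (P.kinetic k c.1 : ℂ) * (conj (P.phi c.2 (v - P.A k.1 c.1.1)) * ρ v)
              + conj (P.phi c.2 (v - P.A k.1 c.1.1)) *
                P.shiftedOscillator (P.A k.1 c.1.1) ρ v := by
          intro v
          rw [hρ', h]
          ring
        simp only [e]
        rw [integral_add (i1.const_mul _) i2, integral_const_mul,
          P.integral_phi_mul_shiftedOscillator _ _ hρ2 hs]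
        push_cast
        ring
      · simp
    have i1 := MemLp.integrable_conj_mul (P.memLp_cellMode k c) hm1
    have i2 := MemLp.integrable_conj_mul (P.memLp_cellMode k c) hm2
    simp only [Pi.sub_apply, mul_sub]
    rw [integral_sub i1 i2]
    change P.modeCoeff k _ c - P.modeCoeff k _ c = 0
    rw [h1, h2, h3, sub_self]
  filter_upwards [hsub] with x hx
  exact sub_eq_zero.1 hx

theorem strip_identity_of_isWeakEigenfunction (hper : P.IsLatticePeriodic vext)
    (hL2 : MemLp vext 2 (volume.restrict P.unitCell)) (k : Space) (E : ℝ) {u : Config → ℂ}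
    (hu : P.IsBlochAmplitude u)
    (hw : P.IsWeakEigenfunction vext E (blochWave k u ∘ P.toPolaritonic))
    (n : LatticeIndex) {ρ : ℝ → ℂ} (hρ : ContDiff ℝ ∞ ρ) (hs : HasCompactSupport ρ) :
    (∫ x, conj (torusExp n x.2 *
        ((P.kinetic k n : ℂ) * ρ x.1 + P.shiftedOscillator (P.A k.1 n.1) ρ x.1))
        * u (P.latEquiv x) ∂stripMeasure)
      + (∫ x, conj ((P.stripPot vext x * torusExp n x.2) * ρ x.1) * u (P.latEquiv x) ∂stripMeasure)
      = (E : ℂ) * ∫ x, conj (torusExp n x.2 * ρ x.1) * u (P.latEquiv x) ∂stripMeasure := by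
  have h := (P.isWeakEigenfunction_iff_strip hper hL2 k E hu).1 hw _
    (P.contDiff_untwist k (contDiff_localMode n hρ))
    (P.hasCompactSupport_untwist k (hasCompactSupport_localMode n hs))
  rw [twist_untwist] at h
  convert h using 2
  · refine integral_congr_ae ?_
    filter_upwards [P.periodize_twist_Hpol_zero_localMode k n hρ hs] with x hx
    rw [hx, mul_comm (torusExp n x.2)]
  · refine integral_congr_ae ?_
    filter_upwards [ae_stripMeasure_mem] with x hx
    rw [periodize_localMode n ρ hx]
    congr 2
    ring
  · refine integral_congr_ae ?_
    filter_upwards [ae_stripMeasure_mem] with x hx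
    rw [periodize_localMode n ρ hx, mul_comm (torusExp n x.2)]

end Params

/-! ### The central equation from the weak equation. -/

/-- A smooth cutoff function on the line. -/
noncomputable def cutoff (v : ℝ) : ℝ := Real.smoothTransition (2 - v ^ 2)

theorem contDiff_cutoff {n : ℕ∞} : ContDiff ℝ n cutoff :=
  Real.smoothTransition.contDiff.comp (contDiff_const.sub (contDiff_id.pow 2))

theorem cutoff_zero : cutoff 0 = 1 := Real.smoothTransition.one_of_one_le (by norm_num)

theorem hasCompactSupport_cutoff : HasCompactSupport cutoff := by
  refine HasCompactSupport.intro (K := Set.Icc (-2) 2) isCompact_Icc fun v hv => ?_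
  refine Real.smoothTransition.zero_of_nonpos ?_
  rw [Set.mem_Icc, not_and_or, not_le, not_le] at hv
  rcases hv with h | h <;> nlinarith

theorem exists_cutoff_bound : ∃ C : ℝ, 0 ≤ C ∧ (∀ v, |cutoff v| ≤ C) ∧
    (∀ v, |deriv cutoff v| ≤ C) ∧ ∀ v, |deriv (deriv cutoff) v| ≤ C := by
  have c0 : ContDiff ℝ 2 cutoff := contDiff_cutoff
  have c1 : ContDiff ℝ 1 (deriv cutoff) :=
    (contDiff_succ_iff_deriv.1 (by simpa [one_add_one_eq_two] using c0)).2.2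
  have s0 := hasCompactSupport_cutoff
  obtain ⟨C0, h0⟩ := s0.exists_bound_of_continuous c0.continuous
  obtain ⟨C1, h1⟩ := s0.deriv.exists_bound_of_continuous c1.continuous
  obtain ⟨C2, h2⟩ := s0.deriv.deriv.exists_bound_of_continuous (c1.continuous_deriv le_rfl)
  refine ⟨max C0 (max C1 C2), ?_, fun v => ?_, fun v => ?_, fun v => ?_⟩
  · exact ((norm_nonneg _).trans (h0 0)).trans (le_max_left _ _)
  · exact (h0 v).trans (le_max_left _ _)
  · exact (h1 v).trans ((le_max_left _ _).trans (le_max_right _ _))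
  · exact (h2 v).trans ((le_max_right _ _).trans (le_max_right _ _))

theorem deriv_deriv_cutoff_mul (ε : ℝ) {φ : ℝ → ℂ} (hφ : ContDiff ℝ 2 φ) (v : ℝ) :
    deriv (deriv fun v => (cutoff (ε * v) : ℂ) * φ v) v
      = (cutoff (ε * v) : ℂ) * deriv (deriv φ) v
        + ((2 * ε * deriv cutoff (ε * v) : ℝ) : ℂ) * deriv φ v
        + ((ε ^ 2 * deriv (deriv cutoff) (ε * v) : ℝ) : ℂ) * φ v := by
  have c0 : ContDiff ℝ 2 cutoff := contDiff_cutoff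
  have c1 : ContDiff ℝ 1 (deriv cutoff) :=
    (contDiff_succ_iff_deriv.1 (by simpa [one_add_one_eq_two] using c0)).2.2
  have f1 : ContDiff ℝ 1 (deriv φ) :=
    (contDiff_succ_iff_deriv.1 (by simpa [one_add_one_eq_two] using hφ)).2.2
  have hl : ∀ v : ℝ, HasDerivAt (fun v : ℝ => ε * v) ε v := fun v => by
    simpa using (hasDerivAt_id v).const_mul ε
  have d0 : ∀ v, HasDerivAt (fun v => (cutoff (ε * v) : ℂ))
      ((deriv cutoff (ε * v) * ε : ℝ) : ℂ) v := fun v =>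
    ((c0.differentiable two_ne_zero _).hasDerivAt.comp v (hl v)).ofReal_comp
  have d1 : ∀ v, HasDerivAt (fun v => ((deriv cutoff (ε * v) * ε : ℝ) : ℂ))
      ((deriv (deriv cutoff) (ε * v) * ε * ε : ℝ) : ℂ) v := fun v =>
    (((c1.differentiable one_ne_zero _).hasDerivAt.comp v (hl v)).mul_const ε).ofReal_comp
  have g0 : ∀ v, HasDerivAt φ (deriv φ v) v := fun v =>
    (hφ.differentiable two_ne_zero v).hasDerivAt
  have g1 : ∀ v, HasDerivAt (deriv φ) (deriv (deriv φ) v) v := fun v =>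
    (f1.differentiable one_ne_zero v).hasDerivAt
  have e1 : deriv (fun v => (cutoff (ε * v) : ℂ) * φ v)
      = fun v => ((deriv cutoff (ε * v) * ε : ℝ) : ℂ) * φ v
        + (cutoff (ε * v) : ℂ) * deriv φ v := funext fun v => ((d0 v).mul (g0 v)).deriv
  rw [e1]
  have e2 := (((d1 v).mul (g0 v)).add ((d0 v).mul (g1 v))).deriv
  refine Eq.trans e2 ?_
  push_cast
  ring

/-- Used with `w` a plane wave, and with `w` the potential times a plane wave; a majorant `b` in `v`
alone covers both. -/
theorem tendsto_integral_strip {w g : Config → ℂ} {a : ℕ → ℝ → ℂ} {a' b : ℝ → ℂ}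
    (ha : ∀ N, Continuous (a N)) (hb : MemLp (fun x => w x * b x.1) 2 stripMeasure)
    (hw : AEStronglyMeasurable w stripMeasure) (hg : MemLp g 2 stripMeasure)
    (hle : ∀ N v, ‖a N v‖ ≤ ‖b v‖) (hlim : ∀ v, Tendsto (fun N => a N v) atTop (𝓝 (a' v))) :
    Tendsto (fun N => ∫ x, conj (w x * a N x.1) * g x ∂stripMeasure) atTop
      (𝓝 (∫ x, conj (w x * a' x.1) * g x ∂stripMeasure)) := by
  refine tendsto_integral_of_dominated_convergence
    (fun x => ‖conj (w x * b x.1) * g x‖) (fun N => ?_)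
    (MemLp.integrable_conj_mul hb hg).norm (fun N => ?_) ?_
  · exact (Complex.continuous_conj.comp_aestronglyMeasurable
      (hw.mul ((ha N).comp continuous_fst).aestronglyMeasurable)).mul hg.1
  · refine Eventually.of_forall fun x => ?_
    simp only [norm_mul, RCLike.norm_conj]
    gcongr
    exact hle N x.1
  · refine Eventually.of_forall fun x => ?_
    refine Tendsto.mul_const _ ?_
    exact (Complex.continuous_conj.tendsto _).comp ((hlim x.1).const_mul _)

namespace Params

variable (P : Params) {vext : Space → ℝ}

theorem shiftedOscillator_cutoff_mul (ε a : ℝ) (j : ℕ) (v : ℝ) :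
    P.shiftedOscillator a (fun v => (cutoff (ε * v) : ℂ) * P.phi j (v - a)) v
      = (P.energy j : ℂ) * ((cutoff (ε * v) : ℂ) * P.phi j (v - a))
        - ((P.hbar ^ 2 / (2 * P.μ) : ℝ) : ℂ) *
          (((2 * ε * deriv cutoff (ε * v) : ℝ) : ℂ) * deriv (fun v => P.phi j (v - a)) v
          + ((ε ^ 2 * deriv (deriv cutoff) (ε * v) : ℝ) : ℂ) * P.phi j (v - a)) := by
  have hφ : ContDiff ℝ 2 (fun v => P.phi j (v - a)) :=
    ((P.contDiff_phi j).of_le two_le_infty).comp (contDiff_id.sub contDiff_const)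
  have h := P.shiftedOscillator_phi a j v
  rw [shiftedOscillator] at h ⊢
  rw [deriv_deriv_cutoff_mul ε hφ]
  linear_combination (cutoff (ε * v) : ℂ) * h

theorem contDiff_cutoff_mul (ε a : ℝ) (j : ℕ) :
    ContDiff ℝ ∞ fun v => (cutoff (ε * v) : ℂ) * P.phi j (v - a) := by
  have h : ContDiff ℝ ∞ fun v : ℝ => cutoff (ε * v) := contDiff_cutoff.comp (by fun_prop)
  exact (Complex.ofRealCLM.contDiff.comp h).mul
    ((P.contDiff_phi j).comp (contDiff_id.sub contDiff_const))

theorem hasCompactSupport_cutoff_mul {ε : ℝ} (hε : ε ≠ 0) (a : ℝ) (j : ℕ) :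
    HasCompactSupport fun v => (cutoff (ε * v) : ℂ) * P.phi j (v - a) := by
  have h1 : HasCompactSupport fun v : ℝ => cutoff (ε * v) :=
    hasCompactSupport_cutoff.comp_homeomorph (Homeomorph.mulLeft₀ ε hε)
  exact (h1.comp_left (g := fun x : ℝ => (x : ℂ)) Complex.ofReal_zero).mul_right

/-- The row of index `(n, j)` is the weak equation tested with `exp(2πi n · t) φ_j(v - A_n)`. As
`φ_j` lacks compact support, it is multiplied by `cutoff (ε v)`; the oscillator then produces `φ_j`
times its energy and commutator terms of order `ε`, which vanish in the limit. -/
theorem centralEquation_of_isWeakEigenfunction (hper : P.IsLatticePeriodic vext)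
    (hL2 : MemLp vext 2 (volume.restrict P.unitCell)) (k : Space) (E : ℝ) {u : Config → ℂ}
    (hu : P.IsBlochAmplitude u)
    (hw : P.IsWeakEigenfunction vext E (blochWave k u ∘ P.toPolaritonic)) :
    P.CentralEquation vext k E (P.modeCoeff k fun x => u (P.latEquiv x)) := by
  have hg := P.memLp_polCell_iff.1 hu.2
  rw [P.centralEquation_iff hper hL2 k E hg]
  rintro ⟨n, j⟩
  set a := P.A k.1 n.1 with ha
  set φ : ℝ → ℂ := fun v => P.phi j (v - a) with hφ
  set φ' : ℝ → ℂ := deriv φ with hφ'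
  have hφ2 : MemLp φ 2 := P.memLp_phi_sub j a
  have hφ'2 : MemLp φ' 2 := by
    have h := (P.memLp_deriv_phi j).comp_measurePreserving
      (measurePreserving_sub_right (volume : Measure ℝ) a)
    convert! h using 1
    ext v
    exact deriv_comp_sub_const (f := P.phi j) a v
  obtain ⟨C, hC0, b0, b1, b2⟩ := exists_cutoff_bound
  set ε : ℕ → ℝ := fun N => 1 / ((N : ℝ) + 1) with hε
  have hε0 : ∀ N, 0 < ε N := fun N => by positivity
  have hε1 : ∀ N, ε N ≤ 1 := fun N => by
    rw [hε]
    simp only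
    rw [div_le_one (by positivity)]
    linarith [Nat.cast_nonneg (α := ℝ) N]
  have hεt : Tendsto ε atTop (𝓝 0) := tendsto_one_div_add_atTop_nhds_zero_nat
  set ρ : ℕ → ℝ → ℂ := fun N v => (cutoff (ε N * v) : ℂ) * φ v with hρ
  have cρ : ∀ N, ContDiff ℝ ∞ (ρ N) := fun N => P.contDiff_cutoff_mul (ε N) a j
  have sρ : ∀ N, HasCompactSupport (ρ N) := fun N =>
    P.hasCompactSupport_cutoff_mul (hε0 N).ne' a j
  have hid := fun N => P.strip_identity_of_isWeakEigenfunction hper hL2 k E hu hw n (cρ N) (sρ N)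
  have hcut : ∀ v, Tendsto (fun N => (cutoff (ε N * v) : ℂ)) atTop (𝓝 1) := by
    intro v
    have h1 : Tendsto (fun N => ε N * v) atTop (𝓝 0) := by simpa using hεt.mul_const v
    have h2 := ((contDiff_cutoff (n := 0)).continuous.tendsto 0).comp h1
    rw [cutoff_zero] at h2
    have h3 := (Complex.continuous_ofReal.tendsto 1).comp h2
    rw [Complex.ofReal_one] at h3
    exact h3
  have hρlim : ∀ v, Tendsto (fun N => ρ N v) atTop (𝓝 (φ v)) := fun v => by
    simpa using (hcut v).mul_const (φ v)
  have hρle : ∀ N v, ‖ρ N v‖ ≤ ‖(C : ℂ) * φ v‖ := by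
    intro N v
    rw [hρ]
    simp only [norm_mul, Complex.norm_real, Real.norm_eq_abs]
    exact mul_le_mul_of_nonneg_right ((b0 _).trans (le_abs_self C)) (norm_nonneg _)
  set γ₀ : ℝ := P.hbar ^ 2 / (2 * P.μ) with hγ₀
  have hγ0 : 0 ≤ γ₀ := by
    have := P.μ_pos
    positivity
  set κ₀ : ℝ := P.kinetic k n with hκ₀
  have hκ0 : 0 ≤ κ₀ := P.kinetic_nonneg k n
  have hE0 : 0 ≤ P.energy j := P.energy_pos j |>.le
  -- `D` and `D'` add up the bounds on the coefficients of `φ` and `φ'` that hold uniformly for `0 <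
  -- ε ≤ 1`.
  set D : ℝ := κ₀ * C + P.energy j * C + γ₀ * C with hD
  set D' : ℝ := γ₀ * (2 * C) with hD'
  set b : ℝ → ℂ := fun v => ((D * ‖φ v‖ + D' * ‖φ' v‖ : ℝ) : ℂ) with hb
  have hb2 : MemLp b 2 := ((hφ2.norm.const_mul D).add (hφ'2.norm.const_mul D')).ofReal
  have hform : ∀ N v, (κ₀ : ℂ) * ρ N v + P.shiftedOscillator a (ρ N) v
      = (κ₀ : ℂ) * ρ N v + ((P.energy j : ℂ) * ρ N v - (γ₀ : ℂ) *
        (((2 * ε N * deriv cutoff (ε N * v) : ℝ) : ℂ) * φ' v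
          + ((ε N ^ 2 * deriv (deriv cutoff) (ε N * v) : ℝ) : ℂ) * φ v)) := by
    intro N v
    rw [hρ, hφ', hφ]
    simp only
    rw [P.shiftedOscillator_cutoff_mul (ε N) a j v]
  have hAle : ∀ N v, ‖(κ₀ : ℂ) * ρ N v + P.shiftedOscillator a (ρ N) v‖ ≤ ‖b v‖ := by
    intro N v
    rw [hform]
    have n1 : ‖ρ N v‖ ≤ C * ‖φ v‖ := by
      refine (hρle N v).trans_eq ?_
      rw [norm_mul, Complex.norm_real, Real.norm_of_nonneg hC0]
    have n2 : ‖((2 * ε N * deriv cutoff (ε N * v) : ℝ) : ℂ) * φ' v‖ ≤ 2 * C * ‖φ' v‖ := by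
      rw [norm_mul, Complex.norm_real, Real.norm_eq_abs, abs_mul,
        abs_of_nonneg (by have := (hε0 N).le; positivity)]
      have h1 := b1 (ε N * v)
      have h2 := hε1 N
      have h3 := (hε0 N).le
      gcongr
      nlinarith [mul_nonneg h3 hC0, mul_le_mul_of_nonneg_left h1 h3]
    have n3 : ‖((ε N ^ 2 * deriv (deriv cutoff) (ε N * v) : ℝ) : ℂ) * φ v‖ ≤ C * ‖φ v‖ := by
      rw [norm_mul, Complex.norm_real, Real.norm_eq_abs, abs_mul, abs_of_nonneg (sq_nonneg _)]
      have h1 := b2 (ε N * v)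
      have h2 : ε N ^ 2 ≤ 1 := pow_le_one₀ (hε0 N).le (hε1 N)
      gcongr
      calc ε N ^ 2 * |deriv (deriv cutoff) (ε N * v)| ≤ 1 * C := by gcongr
        _ = C := one_mul C
    have n4 : ‖b v‖ = D * ‖φ v‖ + D' * ‖φ' v‖ := by
      rw [hb]
      simp only
      rw [Complex.norm_real, Real.norm_of_nonneg]
      positivity
    rw [n4]
    calc ‖(κ₀ : ℂ) * ρ N v + ((P.energy j : ℂ) * ρ N v - (γ₀ : ℂ) *
        (((2 * ε N * deriv cutoff (ε N * v) : ℝ) : ℂ) * φ' v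
          + ((ε N ^ 2 * deriv (deriv cutoff) (ε N * v) : ℝ) : ℂ) * φ v))‖
        ≤ ‖(κ₀ : ℂ) * ρ N v‖ + (‖(P.energy j : ℂ) * ρ N v‖ + ‖(γ₀ : ℂ) *
        (((2 * ε N * deriv cutoff (ε N * v) : ℝ) : ℂ) * φ' v
          + ((ε N ^ 2 * deriv (deriv cutoff) (ε N * v) : ℝ) : ℂ) * φ v)‖) :=
          (norm_add_le _ _).trans (by gcongr; exact norm_sub_le _ _)
      _ ≤ κ₀ * (C * ‖φ v‖) + (P.energy j * (C * ‖φ v‖)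
          + γ₀ * (2 * C * ‖φ' v‖ + C * ‖φ v‖)) := by
          rw [norm_mul (κ₀ : ℂ), norm_mul (P.energy j : ℂ), norm_mul (γ₀ : ℂ),
            Complex.norm_real κ₀, Complex.norm_real (P.energy j), Complex.norm_real γ₀,
            Real.norm_of_nonneg hκ0, Real.norm_of_nonneg hE0, Real.norm_of_nonneg hγ0]
          gcongr
          exact (norm_add_le _ _).trans (add_le_add n2 n3)
      _ = D * ‖φ v‖ + D' * ‖φ' v‖ := by
          rw [hD, hD']
          ring
  have hsmall : ∀ (f : ℝ → ℝ) (v : ℝ), (∀ s, |f s| ≤ C) →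
      Tendsto (fun N => ε N * f (ε N * v)) atTop (𝓝 0) := by
    intro f v hf
    refine squeeze_zero_norm (a := fun N => ε N * C) (fun N => ?_) (by simpa using hεt.mul_const C)
    rw [norm_mul, Real.norm_of_nonneg (hε0 N).le]
    exact mul_le_mul_of_nonneg_left (hf _) (hε0 N).le
  have hAlim : ∀ v, Tendsto (fun N => (κ₀ : ℂ) * ρ N v + P.shiftedOscillator a (ρ N) v) atTop
      (𝓝 (((κ₀ + P.energy j : ℝ) : ℂ) * φ v)) := by
    intro v
    simp only [hform]
    have l1 : Tendsto (fun N => ((2 * ε N * deriv cutoff (ε N * v) : ℝ) : ℂ)) atTop (𝓝 0) := by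
      have h := (hsmall (deriv cutoff) v b1).const_mul 2
      have h2 := (Complex.continuous_ofReal.tendsto _).comp h
      simpa [Function.comp_def, mul_assoc] using h2
    have l2 : Tendsto (fun N => ((ε N ^ 2 * deriv (deriv cutoff) (ε N * v) : ℝ) : ℂ)) atTop
        (𝓝 0) := by
      have h := hεt.mul (hsmall (deriv (deriv cutoff)) v b2)
      have h2 := (Complex.continuous_ofReal.tendsto _).comp h
      simpa [Function.comp_def, sq, mul_assoc] using h2
    have l3 := ((hρlim v).const_mul (κ₀ : ℂ)).add (((hρlim v).const_mul (P.energy j : ℂ)).sub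
      (((l1.mul_const (φ' v)).add (l2.mul_const (φ v))).const_mul (γ₀ : ℂ)))
    convert l3 using 2
    push_cast
    ring
  have cA : ∀ N, Continuous fun v => (κ₀ : ℂ) * ρ N v + P.shiftedOscillator a (ρ N) v := fun N =>
    (continuous_const.mul (cρ N).continuous).add
      (P.continuous_shiftedOscillator a ((cρ N).of_le two_le_infty))
  have wm : AEStronglyMeasurable (fun x : Config => torusExp n x.2) stripMeasure :=
    ((continuous_torusExp n).comp continuous_snd).aestronglyMeasurable
  have vm : AEStronglyMeasurable (fun x => P.stripPot vext x * torusExp n x.2) stripMeasure :=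
    (P.aestronglyMeasurable_stripPot hper hL2).mul wm
  have mT : ∀ {f : ℝ → ℂ}, MemLp f 2 →
      MemLp (fun x : Config => torusExp n x.2 * f x.1) 2 stripMeasure := by
    intro f hf
    have h : MemLp (fun x : Config => f x.1 * torusExp n x.2) 2 stripMeasure :=
      memLp_two_mul_prod hf (memLp_torusExp n 2)
    simpa only [mul_comm (f _)] using h
  have hCφ : MemLp (fun v => (C : ℂ) * φ v) 2 := hφ2.const_mul _
  have mV : MemLp (fun x : Config => (P.stripPot vext x * torusExp n x.2) * ((C : ℂ) * φ x.1)) 2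
      stripMeasure := by
    have h := memLp_torusExp_mul (P.memLp_mul_stripPot hper hL2 hCφ) n
    refine (memLp_congr_ae (Eventually.of_forall fun x => ?_)).1 h
    ring
  have t1 := tendsto_integral_strip cA (mT hb2) wm hg hAle hAlim
  have t2 := tendsto_integral_strip (fun N => (cρ N).continuous) mV vm hg hρle hρlim
  have t3 := tendsto_integral_strip (fun N => (cρ N).continuous) (mT hCφ) wm hg hρle hρlim
  have hfin := tendsto_nhds_unique ((t1.add t2).congr hid) (t3.const_mul (E : ℂ))
  have f3 : ∫ x, conj (torusExp n x.2 * φ x.1) * u (P.latEquiv x) ∂stripMeasure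
      = P.modeCoeff k (fun x => u (P.latEquiv x)) (n, j) := by
    refine integral_congr_ae (Eventually.of_forall fun x => ?_)
    simp only [cellMode, hφ, ha, mul_comm (torusExp n x.2)]
  have f2 : ∫ x, conj (P.stripPot vext x * torusExp n x.2 * φ x.1) * u (P.latEquiv x) ∂stripMeasure
      = P.potCoeff vext k (fun x => u (P.latEquiv x)) (n, j) := by
    refine integral_congr_ae (Eventually.of_forall fun x => ?_)
    simp only [cellMode, hφ, ha, mul_assoc, mul_comm (torusExp n x.2)]
  have f1 : ∫ x, conj (torusExp n x.2 * (((κ₀ + P.energy j : ℝ) : ℂ) * φ x.1))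
      * u (P.latEquiv x) ∂stripMeasure
      = ((κ₀ + P.energy j : ℝ) : ℂ) * P.modeCoeff k (fun x => u (P.latEquiv x)) (n, j) := by
    rw [← f3, ← integral_const_mul]
    refine integral_congr_ae (Eventually.of_forall fun x => ?_)
    simp only [map_mul, Complex.conj_ofReal]
    ring
  rw [f1, f2, f3] at hfin
  simp only
  push_cast at hfin ⊢
  linear_combination hfin

end Params

/-! ### The pointwise equation for `C²` amplitudes, and the existence statement. -/

namespace Params

variable (P : Params) {vext : Space → ℝ}

theorem integrable_stripPot_mul (hper : P.IsLatticePeriodic vext)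
    (hL2 : MemLp vext 2 (volume.restrict P.unitCell)) {f : Config → ℂ} (hc : Continuous f)
    (hs : HasCompactSupport f) : Integrable fun x => P.stripPot vext x * f x := by
  obtain ⟨R, hR⟩ := hs.isBounded.exists_norm_le
  -- An indicator in `v` alone is periodic in `t` and in `L²` of the strip, and equals `1` on the
  -- support of `f`; unfolding against it yields plain integrability.
  set g : ℝ → ℂ := (Set.Icc (-R) R).indicator fun _ => (1 : ℂ) with hg
  have hg2 : MemLp g 2 :=
    memLp_indicator_const 2 measurableSet_Icc _ (Or.inr (by simp))
  have hg3 : MemLp (fun x : Config => g x.1) 2 stripMeasure := by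
    have h := memLp_two_mul_prod hg2 (memLp_torusExp 0 2)
    refine (memLp_congr_ae (Eventually.of_forall fun x => ?_)).1 h
    simp [torusExp]
  have h1 := ((P.isCellFinite_stripPot_mul hper hL2 hc hs).integral_conj_mul hg3
    fun n => Eventually.of_forall fun x => rfl).1
  have h2 := Complex.conjCLE.integrable_comp_iff.2 h1
  refine h2.congr (Eventually.of_forall fun x => ?_)
  simp only [Complex.conjCLE_apply, map_mul, Complex.conj_conj]
  by_cases hx : f x = 0
  · rw [hx, mul_zero, zero_mul]
  · have h3 : x.1 ∈ Set.Icc (-R) R :=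
      abs_le.1 ((norm_fst_le x).trans (hR x (subset_tsupport f hx)))
    rw [hg, Set.indicator_of_mem h3, map_one, mul_one]

theorem locallyIntegrable_stripPot (hper : P.IsLatticePeriodic vext)
    (hL2 : MemLp vext 2 (volume.restrict P.unitCell)) : LocallyIntegrable (P.stripPot vext) := by
  rw [locallyIntegrable_iff]
  intro K hK
  obtain ⟨R, hR⟩ := hK.isBounded.exists_norm_le
  let χ : ContDiffBump (0 : Config) := ⟨|R| + 1, |R| + 2, by positivity, by linarith⟩
  have h1 := P.integrable_stripPot_mul hper hL2 (f := fun x => (χ x : ℂ))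
    (Complex.continuous_ofReal.comp χ.continuous)
    (χ.hasCompactSupport.comp_left (g := fun x : ℝ => (x : ℂ)) Complex.ofReal_zero)
  refine h1.integrableOn.congr_fun (fun x hx => ?_) hK.measurableSet
  have h2 : χ x = 1 := χ.one_of_mem_closedBall (by
    rw [mem_closedBall_zero_iff]
    exact (hR x hx).trans ((le_abs_self R).trans (by simp [χ])))
  simp only [h2, Complex.ofReal_one, mul_one]

theorem locallyIntegrable_positionOf (hper : P.IsLatticePeriodic vext)
    (hL2 : MemLp vext 2 (volume.restrict P.unitCell)) :
    LocallyIntegrable fun q => (vext (P.positionOf q) : ℂ) := by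
  rw [locallyIntegrable_iff]
  intro K hK
  rw [IntegrableOn, ← memLp_one_iff_integrable, ← memLp_comp_iff volume P.latEquiv K,
    memLp_one_iff_integrable]
  exact (P.locallyIntegrable_stripPot hper hL2).integrableOn_isCompact
    (P.latEquiv.toHomeomorph.isCompact_preimage.2 hK)

theorem integral_conj_Hpol_mul (hper : P.IsLatticePeriodic vext)
    (hL2 : MemLp vext 2 (volume.restrict P.unitCell)) {F ψ : Config → ℂ} (hF : ContDiff ℝ 2 F)
    (hs : HasCompactSupport F) (hψ : ContDiff ℝ 2 ψ) :
    ∫ q, conj (P.Hpol vext F q) * ψ q = ∫ q, conj (F q) * P.Hpol vext ψ q := by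
  have hV := (P.locallyIntegrable_positionOf hper hL2).smul_continuous hψ.continuous
  have cF : Continuous fun q => conj (F q) := Complex.continuous_conj.comp hF.continuous
  have sF : HasCompactSupport fun q => conj (F q) := hs.comp_left (map_zero _)
  have i3 := hV.integrable_smul_left_of_hasCompactSupport cF sF
  simp only [smul_eq_mul] at i3
  have i1 : Integrable fun q => conj (P.Hpol 0 F q) * ψ q :=
    ((Complex.continuous_conj.comp (P.continuous_Hpol_zero hF)).mul
      hψ.continuous).integrable_of_hasCompactSupport
      (((P.hasCompactSupport_Hpol_zero hF hs).comp_left (map_zero (starRingEnd ℂ))).mul_right)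
  have i2 : Integrable fun q => conj (F q) * P.Hpol 0 ψ q :=
    (cF.mul (P.continuous_Hpol_zero hψ)).integrable_of_hasCompactSupport sF.mul_right
  have e1 : ∀ q, conj (P.Hpol vext F q) * ψ q
      = conj (P.Hpol 0 F q) * ψ q + conj (F q) * ((vext (P.positionOf q) : ℂ) * ψ q) := by
    intro q
    rw [P.Hpol_eq_add, map_add, map_mul, Complex.conj_ofReal]
    ring
  have e2 : ∀ q, conj (F q) * P.Hpol vext ψ q
      = conj (F q) * P.Hpol 0 ψ q + conj (F q) * ((vext (P.positionOf q) : ℂ) * ψ q) := by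
    intro q
    rw [P.Hpol_eq_add, mul_add]
  simp only [e1, e2]
  rw [integral_add i1 i3, integral_add i2 i3, P.integral_conj_Hpol_zero_mul hF hs hψ]

/-- Symmetry of the Hamiltonian moves all derivatives onto `ψ`. The residual `H ψ - E ψ` is only
locally integrable because of the potential, so the fundamental lemma, for which real test functions
suffice, gives equality almost everywhere. -/
theorem isWeakEigenfunction_iff_ae (hper : P.IsLatticePeriodic vext)
    (hL2 : MemLp vext 2 (volume.restrict P.unitCell)) (E : ℝ) {ψ : Config → ℂ}
    (hψ : ContDiff ℝ 2 ψ) :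
    P.IsWeakEigenfunction vext E (ψ ∘ P.toPolaritonic) ↔
      ∀ᵐ p, P.Heff vext (ψ ∘ P.toPolaritonic) p = (E : ℂ) * (ψ ∘ P.toPolaritonic) p := by
  have h1 : (∀ᵐ p, P.Heff vext (ψ ∘ P.toPolaritonic) p = (E : ℂ) * (ψ ∘ P.toPolaritonic) p) ↔
      ∀ᵐ q, P.Hpol vext ψ q = (E : ℂ) * ψ q := by
    rw [← ae_comp_iff volume P.polEquiv (p := fun q => P.Hpol vext ψ q = (E : ℂ) * ψ q)]
    simp only [P.Heff_comp_toPolaritonic vext hψ, coe_polEquiv, Function.comp_apply]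
  rw [h1, isWeakEigenfunction_comp_iff]
  have hV := (P.locallyIntegrable_positionOf hper hL2).smul_continuous hψ.continuous
  have hloc : LocallyIntegrable fun q => P.Hpol vext ψ q - (E : ℂ) * ψ q := by
    have h2 : LocallyIntegrable fun q => P.Hpol 0 ψ q - (E : ℂ) * ψ q :=
      ((P.continuous_Hpol_zero hψ).sub (continuous_const.mul hψ.continuous)).locallyIntegrable
    refine (h2.add hV).congr (Eventually.of_forall fun q => ?_)
    simp only [Pi.add_apply, smul_eq_mul]
    rw [P.Hpol_eq_add vext]
    ring
  have key : ∀ F : Config → ℂ, ContDiff ℝ ∞ F → HasCompactSupport F →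
      ((∫ q, conj (P.Hpol vext F q) * ψ q = (E : ℂ) * ∫ q, conj (F q) * ψ q) ↔
        ∫ q, conj (F q) * (P.Hpol vext ψ q - (E : ℂ) * ψ q) = 0) := by
    intro F hF hs
    rw [P.integral_conj_Hpol_mul hper hL2 (hF.of_le two_le_infty) hs hψ]
    have cF : Continuous fun q => conj (F q) := Complex.continuous_conj.comp hF.continuous
    have sF : HasCompactSupport fun q => conj (F q) := hs.comp_left (map_zero _)
    have i1 := hloc.integrable_smul_left_of_hasCompactSupport cF sF
    simp only [smul_eq_mul] at i1
    have i2 : Integrable fun q => conj (F q) * ψ q :=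
      (cF.mul hψ.continuous).integrable_of_hasCompactSupport sF.mul_right
    have e : ∀ q, conj (F q) * P.Hpol vext ψ q
        = conj (F q) * (P.Hpol vext ψ q - (E : ℂ) * ψ q) + (E : ℂ) * (conj (F q) * ψ q) := by
      intro q
      ring
    simp only [e]
    rw [integral_add i1 (i2.const_mul _), integral_const_mul, add_eq_right]
  constructor
  · intro hw
    have h2 := ae_eq_zero_of_integral_contDiff_smul_eq_zero hloc fun g hg hgs => by
      have h3 := (key (fun q => (g q : ℂ)) (Complex.ofRealCLM.contDiff.comp hg)
        (hgs.comp_left (g := fun x : ℝ => (x : ℂ)) Complex.ofReal_zero)).1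
        (hw _ (Complex.ofRealCLM.contDiff.comp hg)
          (hgs.comp_left (g := fun x : ℝ => (x : ℂ)) Complex.ofReal_zero))
      simpa only [Complex.conj_ofReal, Complex.real_smul] using h3
    filter_upwards [h2] with q hq
    exact sub_eq_zero.1 hq
  · intro hae F hF hs
    rw [key F hF hs]
    refine integral_eq_zero_of_ae ?_
    filter_upwards [hae] with q hq
    rw [hq, sub_self, mul_zero, Pi.zero_apply]

theorem _root_.QEDBloch.contDiff_blochWave (k : Space) {u : Config → ℂ} {n : WithTop ℕ∞} (hu : ContDiff ℝ n u) :
    ContDiff ℝ n (blochWave k u) :=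
  (contDiff_phase k).mul hu

theorem isWeakEigenfunction_iff_centralEquation (hper : P.IsLatticePeriodic vext)
    (hL2 : MemLp vext 2 (volume.restrict P.unitCell)) {k : Space} {u : Config → ℂ}
    {U : LatticeIndex × ℕ → ℂ} (E : ℝ) (hu : P.IsBlochAmplitude u)
    (hU : P.HasPolaritonExpansion k u U) :
    P.IsWeakEigenfunction vext E (blochWave k u ∘ P.toPolaritonic) ↔
      P.CentralEquation vext k E U := by
  rw [(P.hasPolaritonExpansion_iff hu).1 hU]
  exact ⟨P.centralEquation_of_isWeakEigenfunction hper hL2 k E hu,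
    P.isWeakEigenfunction_of_centralEquation hper hL2 k E hu⟩

/-- Amplitudes modulo null functions correspond to square summable families, and under this
correspondence vanishing almost everywhere means `U = 0`. -/
theorem exists_blochWave_iff_exists_coefficients (hper : P.IsLatticePeriodic vext)
    (hL2 : MemLp vext 2 (volume.restrict P.unitCell)) (k : Space) (E : ℝ) :
    (∃ u : Config → ℂ, P.IsBlochAmplitude u ∧ ¬ (∀ᵐ q : Config, u q = 0) ∧
        P.IsWeakEigenfunction vext E (blochWave k u ∘ P.toPolaritonic)) ↔
      ∃ U : LatticeIndex × ℕ → ℂ, U ≠ 0 ∧ Summable (fun c => ‖U c‖ ^ 2) ∧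
        P.CentralEquation vext k E U := by
  constructor
  · rintro ⟨u, hu, h0, hw⟩
    obtain ⟨U, hU, -⟩ := P.existsUnique_hasPolaritonExpansion k hu
    refine ⟨U, ?_, (P.exists_isBlochAmplitude_iff k U).1 ⟨u, hu, hU⟩,
      (P.isWeakEigenfunction_iff_centralEquation hper hL2 E hu hU).1 hw⟩
    rwa [(P.hasPolaritonExpansion_iff hu).1 hU, Ne, ← P.ae_eq_zero_iff_modeCoeff k hu]
  · rintro ⟨U, h0, hs, hC⟩
    obtain ⟨u, hu, hU⟩ := (P.exists_isBlochAmplitude_iff k U).2 hs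
    refine ⟨u, hu, ?_, (P.isWeakEigenfunction_iff_centralEquation hper hL2 E hu hU).2 hC⟩
    rwa [P.ae_eq_zero_iff_modeCoeff k hu, ← (P.hasPolaritonExpansion_iff hu).1 hU]

end Params

end QEDBloch

theorem mainTheorem7 (P : QEDBloch.Params) (vext : QEDBloch.Space → ℝ)
    (hper : P.IsLatticePeriodic vext)
    (hL2 : MemLp vext 2 (volume.restrict P.unitCell)) :
    -- the dressed frequency, and the change to polaritonic coordinates
    (P.Ω ^ 2 = 2 * P.me / P.μ ∧ P.Ω ^ 2 = P.ωp ^ 2 + P.ωc ^ 2) ∧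
    Function.Bijective P.toPolaritonic ∧
    (∀ p : QEDBloch.Config, P.positionOf (P.toPolaritonic p) = (p.1, p.2.1, p.2.2.1)) ∧
    (∀ F : QEDBloch.Config → ℂ, ContDiff ℝ 2 F → ∀ p : QEDBloch.Config,
      P.Heff vext (F ∘ P.toPolaritonic) p = P.Hpol vext F (P.toPolaritonic p)) ∧
    -- the generalized translational symmetry
    (∀ (n : QEDBloch.LatticeIndex) (p : QEDBloch.Config),
      P.toPolaritonic (P.translate n p) = P.polTranslate n (P.toPolaritonic p)) ∧
    (∀ (n : QEDBloch.LatticeIndex) (f : QEDBloch.Config → ℂ) (p : QEDBloch.Config),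
      ContDiff ℝ 2 f → P.Heff vext (f ∘ P.translate n) p = P.Heff vext f (P.translate n p)) ∧
    -- on Bloch components: free motion in w and z, and a shifted oscillator in v
    (∀ (k : QEDBloch.Space) (n : QEDBloch.LatticeIndex) (f : ℝ → ℂ) (q : QEDBloch.Config),
      ContDiff ℝ 2 f →
      P.Hpol vext (QEDBloch.Params.blochWave k (fun q => P.planeWave n q * f q.2.2.2)) q =
        QEDBloch.Params.blochWave k (P.planeWave n) q *
          (((P.kinetic k n + vext (P.positionOf q) : ℝ) : ℂ) * f q.2.2.2
            + P.shiftedOscillator (P.A k.1 n.1) f q.2.2.2)) ∧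
    -- Landau polariton functions
    (∀ (a : ℝ) (j : ℕ) (v : ℝ),
      P.shiftedOscillator a (fun t => P.phi j (t - a)) v = (P.energy j : ℂ) * P.phi j (v - a)) ∧
    (∀ i j : ℕ, QEDBloch.braket (P.phi i) (P.phi j) = if i = j then 1 else 0) ∧
    -- the exponential series of the displacement operator converges on them
    (∀ (α : ℂ) (j : ℕ),
      (∀ s : ℝ, Summable (fun r : ℕ => P.displacementTerm α (P.phi j) r s)) ∧
      MemLp (P.displacement α (P.phi j)) 2 volume ∧
      Tendsto (fun N : ℕ => eLpNorm (fun s : ℝ => P.displacement α (P.phi j) s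
        - ∑ r ∈ Finset.range N, P.displacementTerm α (P.phi j) r s) 2 volume) atTop (𝓝 0)) ∧
    -- matrix elements of the plane waves in v
    (∀ (kx : ℝ) (n n' m m' : ℤ) (i j : ℕ),
      QEDBloch.braket (fun v => P.phi i (v - P.A kx n))
          (fun v => Complex.exp (-Complex.I *
            ((P.Gv ((m : ℝ) - m') ((n : ℝ) - n') * v : ℝ) : ℂ)) * P.phi j (v - P.A kx n')) =
        Complex.exp (-Complex.I * ((P.Gv ((m : ℝ) - m') ((n : ℝ) - n')
            * P.A kx (((n : ℝ) + n') / 2) : ℝ) : ℂ)) *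
          P.displacementMatrix (P.alpha ((n : ℝ) - n') ((m : ℝ) - m')) i j) ∧
    (∀ (α : ℂ) (i j : ℕ), j ≤ i →
      P.displacementMatrix α i j =
        (Real.sqrt ((j.factorial : ℝ) / (i.factorial : ℝ)) : ℂ) * α ^ (i - j) *
          (Real.exp (-(‖α‖ ^ 2) / 2) : ℂ) * (QEDBloch.laguerre j (i - j) (‖α‖ ^ 2) : ℂ)) ∧
    (∀ (α : ℂ) (i j : ℕ), i < j →
      P.displacementMatrix α i j = (-1) ^ (j - i) * conj (P.displacementMatrix α j i)) ∧
    -- the expansion, and the equivalence of the eigenproblem with the central equation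
    (∀ k : QEDBloch.Space,
      (∀ u : QEDBloch.Config → ℂ, P.IsBlochAmplitude u →
        ∃! U : QEDBloch.LatticeIndex × ℕ → ℂ, P.HasPolaritonExpansion k u U) ∧
      (∀ U : QEDBloch.LatticeIndex × ℕ → ℂ,
        (∃ u, P.IsBlochAmplitude u ∧ P.HasPolaritonExpansion k u U) ↔
          Summable (fun c => ‖U c‖ ^ 2)) ∧
      (∀ (u : QEDBloch.Config → ℂ) (U : QEDBloch.LatticeIndex × ℕ → ℂ) (E : ℝ),
        P.IsBlochAmplitude u → P.HasPolaritonExpansion k u U →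
        (P.IsWeakEigenfunction vext E (QEDBloch.Params.blochWave k u ∘ P.toPolaritonic) ↔
          P.CentralEquation vext k E U)) ∧
      (∀ (u : QEDBloch.Config → ℂ) (E : ℝ), P.IsBlochAmplitude u → ContDiff ℝ 2 u →
        (P.IsWeakEigenfunction vext E (QEDBloch.Params.blochWave k u ∘ P.toPolaritonic) ↔
          ∀ᵐ p : QEDBloch.Config,
            P.Heff vext (QEDBloch.Params.blochWave k u ∘ P.toPolaritonic) p =
              (E : ℂ) * (QEDBloch.Params.blochWave k u ∘ P.toPolaritonic) p)) ∧
      (∀ E : ℝ,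
        (∃ u : QEDBloch.Config → ℂ, P.IsBlochAmplitude u ∧
            ¬ (∀ᵐ q : QEDBloch.Config, u q = 0) ∧
            P.IsWeakEigenfunction vext E (QEDBloch.Params.blochWave k u ∘ P.toPolaritonic)) ↔
          ∃ U : QEDBloch.LatticeIndex × ℕ → ℂ, U ≠ 0 ∧ Summable (fun c => ‖U c‖ ^ 2) ∧
            P.CentralEquation vext k E U)) := by
  refine ⟨⟨P.Ω_sq, P.Ω_sq_eq_add⟩, P.toPolaritonic_bijective, P.positionOf_toPolaritonic,
    fun F hF p => P.Heff_comp_toPolaritonic vext hF p, P.toPolaritonic_translate,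
    fun n f p _ => P.Heff_comp_translate hper n f p,
    fun k n f q _ => P.Hpol_blochWave vext k n f q, P.shiftedOscillator_phi, P.braket_phi,
    fun α j => ⟨fun s => (P.hasSum_displacementTerm α j s).summable, ?_,
      P.tendsto_displacement_phi α j⟩,
    P.braket_planeWave, P.displacementMatrix_of_le, P.displacementMatrix_of_lt,
    fun k => ⟨?_, ?_, ?_, ?_, ?_⟩⟩
  · rw [P.displacement_phi]
    exact P.memLp_weyl_phi α j
  · exact fun u hu => P.existsUnique_hasPolaritonExpansion k hu
  · exact P.exists_isBlochAmplitude_iff k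
  · exact fun u U E hu hU => P.isWeakEigenfunction_iff_centralEquation hper hL2 E hu hU
  · exact fun u E _ hu => P.isWeakEigenfunction_iff_ae hper hL2 E (QEDBloch.contDiff_blochWave k hu)
  · exact P.exists_blochWave_iff_exists_coefficients hper hL2 k
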